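/- Let $M$ be a compact connected $d$-dimensional smooth Riemannian manifold (without boundary) with Riemannian measure $m$, and let $r\ge 1$ be an integer. For $k\ge 0$ let $C^k(M)$ be the space of $C^k$ functions $M\to\mathbb R$, with a norm $\|\cdot\|_{C^k(M)}$ that induces the $C^k$ topology (so that $C^k(M)$ is a Banach space), and let $C^r(M,M)$ be the space of $C^r$ maps $M\to M$ with the $C^r$ topology and its Borel $\sigma$-algebra. For a probability measure $\nu$ on $C^r(M,M)$ let $P^\nu$ be the Markov kernel on $M$ given by $P^\nu f(x)=\int f(\varphi(x))\,\nu(d\varphi)$. Let $0<a<1$, let $\nu_0,\nu_1$ be probability measures on $C^r(M,M)$, and put $\nu=(1-a)\nu_0+a\nu_1$ and $P=P^\nu$. Assume the following. 1. There are $n\ge d$, a smooth $n$-dimensional Riemannian manifold $\Theta$ with Riemannian measure $d\theta$, a $C^r$ probability density $h_0:\Theta\to[0,\infty)$ with respect to $d\theta$ with compact support $\operatorname{supp}(h_0)$, and a $C^r$ map $\mathbf\Phi:M\times\Theta\to M$, such that $\nu_0$ is the image of $h_0(\theta)\,d\theta$ under $\theta\mapsto\mathbf\Phi(\cdot,\theta)$,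 and such that $\partial_\theta\mathbf\Phi(x,\theta):T_\theta\Theta\to T_{\mathbf\Phi(x,\theta)}M$ is surjective for all $x\in M$ and $\theta\in\operatorname{supp}(h_0)$. 2. $\nu_1(\mathrm{Diff}^r_{loc}(M))=1$, where $\mathrm{Diff}^r_{loc}(M)$ is the set of $\varphi\in C^r(M,M)$ such that $D\varphi(x):T_xM\to T_{\varphi(x)}M$ is invertible for every $x\in M$. For $\varphi\in \mathrm{Diff}^r_{loc}(M)$ let $J(\varphi,x)=|\det D\varphi(x)|$ be the Jacobian with respect to $m$ (the determinant being taken in orthonormal bases), and let $$\mathcal L_\varphi\rho(y)=\sum_{x\in\varphi^{-1}(y)}\frac{\rho(x)}{J(\varphi,x)},\qquad \mathcal L_{\nu_1}\rho(y)=\int_{\mathrm{Diff}^r_{loc}(M)}\mathcal L_\varphi\rho(y)\,\nu_1(d\varphi).$$ Let $\|\mathcal L_\varphi\|_{C^{r-1}(M)}$ be the operator norm of $\mathcal L_\varphi$ on $C^{r-1}(M)$. Suppose that $$\int_{\mathrm{Diff}^r_{loc}(M)}\|\mathcal L_\varphi\|_{C^{r-1}(M)}\,\nu_1(d\varphi)<\infty$$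 (in which case $\mathcal L_{\nu_1}$ is a bounded operator on $C^{r-1}(M)$), and that $1/a$ is in the resolvent set of $\mathcal L_{\nu_1}$ on $C^{r-1}(M)$. Then every invariant probability measure of $P$ has a $C^{r-1}$ density with respect to $m$. -/

import Mathlib

open Set Filter Topology MeasureTheory ProbabilityTheory
open scoped Manifold ContDiff ENNReal

noncomputable section

namespace RandomMaps

/-! ### The `C^n` topology on spaces of `C^n` maps -/

section CkTopology

variable {d : ℕ} {M : Type*} [TopologicalSpace M] [ChartedSpace (EuclideanSpace ℝ (Fin d)) M]
  {F : Type*} [NormedAddCommGroup F] [NormedSpace ℝ F] {G : Type*} [TopologicalSpace G]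
  {J : ModelWithCorners ℝ F G} {N : Type*} [TopologicalSpace N] [ChartedSpace G N]
  {n : ℕ∞ω}

/-- The map `h : M → N` read in the chart of `M` around `p` and the chart of `N` around `q`. -/
def inCharts (J : ModelWithCorners ℝ F G) (p : M) (q : N) (h : M → N) :
    EuclideanSpace ℝ (Fin d) → F :=
  extChartAt J q ∘ h ∘ (extChartAt (𝓡 d) p).symm

/-- The basic set around `f` given by a compact set `K` in the chart domain around `p`, a chart
of `N` around `q` and `ε`: all `C^n` maps `h` that send `K` into the domain of the chart around `q`
and whose derivatives of order at most `n` in these charts are `ε`-close to those of `f`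
on `K`. -/
def ckBasicSet (f : C^n⟮𝓡 d, M; J, N⟯) (p : M) (q : N) (K : Set M) (ε : ℝ) :
    Set C^n⟮𝓡 d, M; J, N⟯ :=
  {h | MapsTo h K (chartAt G q).source ∧
    ∀ x ∈ K, ∀ j : ℕ, (j : ℕ∞ω) ≤ n →
      ‖iteratedFDeriv ℝ j (inCharts J p q h) (extChartAt (𝓡 d) p x) -
        iteratedFDeriv ℝ j (inCharts J p q f) (extChartAt (𝓡 d) p x)‖ < ε}

/-- The `C^n` (compact-open, also called weak Whitney) topology on the space of `C^n` maps between
two manifolds: uniform convergence on compact sets, in charts, of all derivatives of order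
at most `n`. -/
instance ckTopology : TopologicalSpace C^n⟮𝓡 d, M; J, N⟯ :=
  TopologicalSpace.generateFrom
    {S | ∃ (f : C^n⟮𝓡 d, M; J, N⟯) (p : M) (q : N) (K : Set M) (ε : ℝ),
      IsCompact K ∧ K ⊆ (chartAt (EuclideanSpace ℝ (Fin d)) p).source ∧
      MapsTo f K (chartAt G q).source ∧ 0 < ε ∧ S = ckBasicSet f p q K ε}

/-- The Borel sigma-algebra of the `C^n` topology. -/
instance ckMeasurableSpace : MeasurableSpace C^n⟮𝓡 d, M; J, N⟯ := borel _

instance ckBorelSpace : BorelSpace C^n⟮𝓡 d, M; J, N⟯ := ⟨rfl⟩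

/-- Evaluation `(x, φ) ↦ φ x` is jointly continuous for the `C^n` topology. -/
theorem continuous_eval :
    Continuous fun z : M × C^n⟮𝓡 d, M; J, N⟯ => z.2 z.1 := by
  rw [continuous_iff_continuousAt]
  rintro ⟨x₀, f⟩
  intro U hU
  have hfc : Continuous f := f.contMDiff.continuous
  set q : N := f x₀ with hq
  -- a ball in the chart of the target around `q`
  have h1 : ∀ᶠ w in 𝓝[range J] (extChartAt J q q), (extChartAt J q).symm w ∈ U := by
    have := (continuousAt_extChartAt_symm (I := J) q).continuousWithinAt (s := range J)
    have h2 := this.tendsto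
    rw [extChartAt_to_inv] at h2
    exact h2 hU
  obtain ⟨ε, hε, hball⟩ := Metric.mem_nhdsWithin_iff.1 h1
  have hε2 : 0 < ε / 2 := by positivity
  -- a compact neighbourhood of `x₀`
  have : LocallyCompactSpace M := ChartedSpace.locallyCompactSpace (EuclideanSpace ℝ (Fin d)) M
  have hA : {x | x ∈ (chartAt (EuclideanSpace ℝ (Fin d)) x₀).source ∧
      f x ∈ (chartAt G q).source ∧
      dist (extChartAt J q (f x)) (extChartAt J q q) < ε / 2} ∈ 𝓝 x₀ := by
    refine Filter.inter_mem ((chartAt _ x₀).open_source.mem_nhds (mem_chart_source _ x₀))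
      (Filter.inter_mem (hfc.continuousAt
        ((chartAt G q).open_source.mem_nhds (mem_chart_source G q))) ?_)
    have hc : ContinuousAt (fun x => extChartAt J q (f x)) x₀ :=
      ContinuousAt.comp (g := extChartAt J q) (continuousAt_extChartAt (I := J) q)
        hfc.continuousAt
    exact hc (Metric.ball_mem_nhds _ hε2)
  obtain ⟨K, hK, hKA, hKc⟩ := local_compact_nhds hA
  have hopen : IsOpen (ckBasicSet f x₀ q K (ε / 2)) :=
    TopologicalSpace.isOpen_generateFrom_of_mem
      ⟨f, x₀, q, K, ε / 2, hKc, fun x hx => (hKA hx).1, fun x hx => (hKA hx).2.1, hε2, rfl⟩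
  have hmem : f ∈ ckBasicSet f x₀ q K (ε / 2) :=
    ⟨fun x hx => (hKA hx).2.1, fun x _ j _ => by simpa using hε2⟩
  refine Filter.mem_map.2 (Filter.mem_of_superset (prod_mem_nhds hK (hopen.mem_nhds hmem)) ?_)
  rintro ⟨x, h⟩ ⟨hx, hh⟩
  have hx' : x ∈ K := hx
  have hsrc : h x ∈ (chartAt G q).source := hh.1 hx'
  have h0 := hh.2 x hx' 0 (by simp)
  have hxs : x ∈ (extChartAt (𝓡 d) x₀).source := by
    rw [extChartAt_source]; exact (hKA hx').1
  have hd : dist (extChartAt J q (h x)) (extChartAt J q (f x)) < ε / 2 := by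
    rw [iteratedFDeriv_zero_eq_comp, iteratedFDeriv_zero_eq_comp] at h0
    simp only [Function.comp_apply, ← map_sub, LinearIsometryEquiv.norm_map, inCharts] at h0
    rw [(extChartAt (𝓡 d) x₀).left_inv hxs] at h0
    rwa [dist_eq_norm]
  have hs' : h x ∈ (extChartAt J q).source := by rw [extChartAt_source]; exact hsrc
  have hin : extChartAt J q (h x) ∈ Metric.ball (extChartAt J q q) ε ∩ range J := by
    refine ⟨?_, ?_⟩
    · have := dist_triangle (extChartAt J q (h x)) (extChartAt J q (f x)) (extChartAt J q q)
      have h3 := (hKA hx').2.2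
      rw [Metric.mem_ball]
      linarith
    · exact extChartAt_target_subset_range q ((extChartAt J q).map_source hs')
  have hU' : (extChartAt J q).symm (extChartAt J q (h x)) ∈ U := hball hin
  rwa [(extChartAt J q).left_inv hs'] at hU'

end CkTopology

/-! ### Riemannian geometry: Riemannian measure and Jacobians -/

section Riemannian

variable {d : ℕ} {M : Type*} [TopologicalSpace M] [ChartedSpace (EuclideanSpace ℝ (Fin d)) M]
  [IsManifold (𝓡 d) ∞ M]

/-- Smooth Riemannian metrics on a smooth `d`-dimensional manifold `M` (without boundary). -/
abbrev RiemMetric (d : ℕ) (M : Type*) [TopologicalSpace M]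
    [ChartedSpace (EuclideanSpace ℝ (Fin d)) M] [IsManifold (𝓡 d) ∞ M] :=
  Bundle.ContMDiffRiemannianMetric (𝓡 d) ∞ (EuclideanSpace ℝ (Fin d))
    (fun x : M => TangentSpace (𝓡 d) x)

/-- The Gram determinant `det (g_x(v i, v j))` of `d` tangent vectors at `x`. -/
def gramDet (g : RiemMetric d M) (x : M) (v : Fin d → TangentSpace (𝓡 d) x) : ℝ :=
  (Matrix.of fun i j => g.inner x (v i) (v j)).det

/-- The `i`-th vector of the standard basis of `ℝ^d`. -/
def stdVec (i : Fin d) : EuclideanSpace ℝ (Fin d) := EuclideanSpace.single i 1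

/-- The density `√ det (g_ij)` of the Riemannian measure in the chart around `p`, as a function
on the target of the chart. -/
def chartDensity (g : RiemMetric d M) (p : M) (y : EuclideanSpace ℝ (Fin d)) : ℝ :=
  Real.sqrt (gramDet g ((chartAt (EuclideanSpace ℝ (Fin d)) p).symm y) fun i =>
    mfderiv 𝓘(ℝ, EuclideanSpace ℝ (Fin d)) (𝓡 d)
      (chartAt (EuclideanSpace ℝ (Fin d)) p).symm y (stdVec i))

/-- The Riemannian measure of the domain of the chart around `p`, as a measure on `M` carried by
this domain: the image of `√ det (g_ij) dy` under the inverse of the chart. -/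
def chartMeasure [MeasurableSpace M] (g : RiemMetric d M) (p : M) : Measure M :=
  ((volume.restrict (chartAt (EuclideanSpace ℝ (Fin d)) p).target).withDensity
    fun y => ENNReal.ofReal (chartDensity g p y)).map
      (chartAt (EuclideanSpace ℝ (Fin d)) p).symm

/-- The Riemannian measure: the measure whose restriction to the domain of each chart is
`√ det (g_ij) dy`. The measures `chartMeasure g p` agree on the overlaps of chart domains, so that
on a second countable manifold the measure glued from them is their least upper bound. -/
def riemMeasure [MeasurableSpace M] (g : RiemMetric d M) : Measure M :=
  ⨆ p : M, chartMeasure g p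

/-- The Jacobian `J(φ, x) = |det Dφ(x)|` with respect to the Riemannian measure, the determinant
being taken in orthonormal bases of `T_x M` and `T_{φ x} M`. For an arbitrary basis `v` of `T_x M`
this number is `√ (det g_{φ x}(Dφ v_i, Dφ v_j) / det g_x(v_i, v_j))`. -/
def jacobian (g : RiemMetric d M) (φ : M → M) (x : M) : ℝ :=
  Real.sqrt (gramDet g (φ x) (fun i => mfderiv (𝓡 d) (𝓡 d) φ x (stdVec i)) /
    gramDet g x (fun i => stdVec i))

/-- `μ` has a `C^k` density with respect to the Riemannian measure. -/
def HasCkDensity [MeasurableSpace M] (g : RiemMetric d M) (k : ℕ) (μ : Measure M) : Prop :=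
  ∃ ρ : C^k⟮𝓡 d, M; ℝ⟯, (∀ x, 0 ≤ ρ x) ∧
    μ = (riemMeasure g).withDensity fun x => ENNReal.ofReal (ρ x)

end Riemannian

/-! ### The Banach space `C^k(M)` -/

section BanachCk

variable {d : ℕ} {M : Type*} [TopologicalSpace M] [ChartedSpace (EuclideanSpace ℝ (Fin d)) M]

/-- A norm on `C^k(M)` inducing the `C^k` topology. When `M` is compact such norms exist, any two
of them are equivalent, and `C^k(M)` is complete for them. -/
structure CkNorm (d : ℕ) (M : Type*) [TopologicalSpace M]
    [ChartedSpace (EuclideanSpace ℝ (Fin d)) M] (k : ℕ) where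
  /-- the norm -/
  toSeminorm : Seminorm ℝ C^k⟮𝓡 d, M; ℝ⟯
  eq_zero : ∀ ρ, toSeminorm ρ = 0 → ρ = 0
  isOpen_iff : ∀ S : Set C^k⟮𝓡 d, M; ℝ⟯,
    IsOpen S ↔ ∀ ρ ∈ S, ∃ ε > 0, ∀ η, toSeminorm (η - ρ) < ε → η ∈ S

variable {k : ℕ}

/-- The space `C^k(M)` normed by `N`. -/
def CkNorm.Space (_ : CkNorm d M k) : Type _ := C^k⟮𝓡 d, M; ℝ⟯

variable (N : CkNorm d M k)

instance : FunLike N.Space M ℝ := inferInstanceAs (FunLike C^k⟮𝓡 d, M; ℝ⟯ M ℝ)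

instance : AddCommGroup N.Space := inferInstanceAs (AddCommGroup C^k⟮𝓡 d, M; ℝ⟯)

instance : Module ℝ N.Space := inferInstanceAs (Module ℝ C^k⟮𝓡 d, M; ℝ⟯)

instance : Norm N.Space := ⟨fun ρ => N.toSeminorm ρ⟩

theorem CkNorm.core : NormedSpace.Core ℝ N.Space where
  norm_nonneg ρ := apply_nonneg N.toSeminorm ρ
  norm_smul c ρ := map_smul_eq_mul N.toSeminorm c ρ
  norm_triangle ρ η := map_add_le_add N.toSeminorm ρ η
  norm_eq_zero_iff ρ := ⟨N.eq_zero ρ, fun h => by rw [h]; exact map_zero N.toSeminorm⟩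

instance : NormedAddCommGroup N.Space := NormedAddCommGroup.ofCore N.core

instance : NormedSpace ℝ N.Space := NormedSpace.ofCore N.core

/-- The norm of a function on `M`, with value `∞` if the function is not `C^k`. -/
def CkNorm.eNorm (f : M → ℝ) : ℝ≥0∞ :=
  open Classical in
  if h : ContMDiff (𝓡 d) 𝓘(ℝ, ℝ) k f then ‖(show N.Space from (⟨f, h⟩ : C^k⟮𝓡 d, M; ℝ⟯))‖ₑ else ⊤

/-- The operator norm `sup {‖L ρ‖ : ‖ρ‖ ≤ 1}` on `C^k(M)` of an operator `L` acting on
functions. -/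
def CkNorm.opENorm (L : (M → ℝ) → (M → ℝ)) : ℝ≥0∞ :=
  ⨆ (ρ : N.Space) (_ : ‖ρ‖ ≤ 1), N.eNorm (L ρ)

/-- An operator `L` acting on functions, seen as a bounded operator on the Banach space `C^k(M)`
(with the value `0` if `L` does not act on `C^k(M)` as a bounded linear operator). -/
def CkNorm.toCLM (L : (M → ℝ) → (M → ℝ)) : N.Space →L[ℝ] N.Space :=
  open Classical in
  if h : ∃ T : N.Space →L[ℝ] N.Space, ∀ ρ, ⇑(T ρ) = L ρ then h.choose else 0

theorem CkNorm.toCLM_apply (L : (M → ℝ) → (M → ℝ))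
    (h : ∃ T : N.Space →L[ℝ] N.Space, ∀ ρ, ⇑(T ρ) = L ρ) (ρ : N.Space) :
    ⇑(N.toCLM L ρ) = L ρ := by
  unfold CkNorm.toCLM
  rw [dif_pos h]
  exact h.choose_spec ρ

end BanachCk

/-! ### Random maps and transfer operators -/

section RandomMapsAndTransfer

variable {d : ℕ} {M : Type*} [TopologicalSpace M] [ChartedSpace (EuclideanSpace ℝ (Fin d)) M]
  {r : ℕ}

/-- The kernel `P^ν(x, A) = ν {φ | φ x ∈ A}` of the Markov chain `X_{k+1} = φ_{k+1}(X_k)` where the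
`φ_k` are independent with law `ν`. -/
def inducedKernel [SecondCountableTopology M] [MeasurableSpace M] [BorelSpace M]
    (ν : Measure C^r⟮𝓡 d, M; 𝓡 d, M⟯) [SFinite ν] : Kernel M M where
  toFun x := ν.map fun φ => φ x
  measurable' := by
    have hm : Measurable fun z : M × C^r⟮𝓡 d, M; 𝓡 d, M⟯ => z.2 z.1 :=
      continuous_eval.measurable
    refine Measure.measurable_of_measurable_coe _ fun s hs => ?_
    have h1 := measurable_measure_prodMk_left (ν := ν) (hm hs)
    convert h1 using 2 with x
    have hx : Measurable fun φ : C^r⟮𝓡 d, M; 𝓡 d, M⟯ => φ x :=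
      (continuous_eval.comp (Continuous.prodMk_right x)).measurable
    rw [Measure.map_apply hx hs]
    rfl

/-- The set of `C^r` local diffeomorphisms of `M`: the `C^r` maps whose tangent map is invertible
at every point. -/
def diffLoc (d : ℕ) (M : Type*) [TopologicalSpace M] [ChartedSpace (EuclideanSpace ℝ (Fin d)) M]
    (r : ℕ) : Set C^r⟮𝓡 d, M; 𝓡 d, M⟯ :=
  {φ | ∀ x, Function.Bijective (mfderiv (𝓡 d) (𝓡 d) φ x)}

/-- The transfer operator `(L_φ ρ)(y) = ∑_{x ∈ φ⁻¹(y)} ρ(x) / J(φ, x)`. -/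
def transfer [IsManifold (𝓡 d) ∞ M] (g : RiemMetric d M) (φ : M → M) (ρ : M → ℝ) (y : M) : ℝ :=
  ∑ᶠ x ∈ φ ⁻¹' {y}, ρ x / jacobian g φ x

/-- The averaged transfer operator `(L_ν ρ)(y) = ∫ (L_φ ρ)(y) ν(dφ)`, the integral being over the
local diffeomorphisms. -/
def avgTransfer [IsManifold (𝓡 d) ∞ M] (g : RiemMetric d M)
    (ν : Measure C^r⟮𝓡 d, M; 𝓡 d, M⟯) (ρ : M → ℝ) (y : M) : ℝ :=
  ∫ φ in diffLoc d M r, transfer g φ ρ y ∂ν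

/-- The `C^r` map `x ↦ Φ(x, θ)` obtained from a `C^r` family by fixing the parameter. -/
def fiberMap {n : ℕ} {Θ : Type*} [TopologicalSpace Θ] [ChartedSpace (EuclideanSpace ℝ (Fin n)) Θ]
    (Φ : C^r⟮(𝓡 d).prod (𝓡 n), M × Θ; 𝓡 d, M⟯) (θ : Θ) : C^r⟮𝓡 d, M; 𝓡 d, M⟯ :=
  ⟨fun x => Φ (x, θ), Φ.contMDiff.comp (contMDiff_id.prodMk contMDiff_const)⟩

end RandomMapsAndTransfer

end RandomMaps

end

open RandomMaps

/-!
The invariance of `μ` reads `μ = (1 - a) P₀* μ + a P₁* μ`, where `P₀* μ` and `P₁* μ` are the laws of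
`φ x` for `x` of law `μ` and an independent `φ` of law `ν₀` or `ν₁`. The proof shows that the first
term has a `C^{r-1}` density, solves the equation among `C^{r-1}` densities, and checks that `μ` is
the solution.

*The first term.* By `exists_density_of_submersive_family`, `P₀* μ = ρ₀ m` with `ρ₀` of class
`C^{r-1}`, whatever `μ` is. A partition of unity on `M × Θ` reduces this to a density `w` supported
in a small coordinate domain (`exists_nhds_density`). There (`exists_density_of_surjective`) choose
a right inverse `R` of `∂_θ Φ` at the centre. The integral over `θ` does not change if `θ` is
replaced by `θ + R s` and the result is averaged over small `s ∈ ℝ^d`, and the map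
`s ↦ Φ (x, θ + R s)` is a local diffeomorphism, so that a change of variables in `s` gives a density
that is `C^{r-1}` in the image point and in the parameters `(x, θ)`. Integration over the parameters
keeps this regularity. One derivative is lost because the change of variables involves a Jacobian.

*The second term.* For a local diffeomorphism `φ`, the inverse function theorem gives finitely many
local inverse branches, so `L_φ` acts on `C^{r-1}(M)` (`contMDiff_transfer`), and the area formula
makes it dual to `η ↦ η ∘ φ` (`lintegral_transfer`). Differentiation under the integral sign shows
that `L_{ν₁}` is a bounded operator of `C^{r-1}(M)` (`exists_clm_avgTransfer`). Measurability in
`φ` comes from the duality: `L_φ ρ (y)` is a limit of averages over small neighbourhoods of `y`,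
which are integrals of `ρ` over preimages. Fubini's theorem then makes `L_{ν₁}` dual to the Markov
operator `P₁` of `ν₁` (`integral_avgTransfer_mul`).

*Conclusion.* Since `1 / a` is in the resolvent set, there is `ρ ∈ C^{r-1}(M)` with
`ρ = (1 - a) ρ₀ + a L_{ν₁} ρ`. The finite signed measure `σ = μ - ρ m` satisfies `σ = a P₁* σ`.
As `P₁` does not increase the sup norm and `a < 1`, iteration gives `σ = 0`
(`integral_eq_of_contraction`). Hence `μ = ρ m`, and the continuous function `ρ` is nonnegative
because the Riemannian measure charges every nonempty open set.
-/

noncomputable section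

set_option linter.unusedSectionVars false

/-- The model space `ℝ^d`. -/
abbrev Eu (d : ℕ) := EuclideanSpace ℝ (Fin d)

/-! ### Gram determinants, chart densities and Jacobians -/

section Gram

variable {d : ℕ}

/-- The Gram determinant of `d` vectors of `ℝ^d` for a bilinear form. -/
def gram (b : Eu d →L[ℝ] Eu d →L[ℝ] ℝ) (v : Fin d → Eu d) : ℝ :=
  (Matrix.of fun i j => b (v i) (v j)).det

theorem eu_eq_sum_stdVec (v : Eu d) : v = ∑ i, v i • stdVec i := by
  simpa [stdVec] using ((EuclideanSpace.basisFun (Fin d) ℝ).sum_repr v).symm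

theorem det_eq_matrix_det (A : Eu d →L[ℝ] Eu d) :
    A.det = (Matrix.of fun k i => (A (stdVec i)) k).det := by
  rw [ContinuousLinearMap.det,
    ← LinearMap.det_toMatrix (EuclideanSpace.basisFun (Fin d) ℝ).toBasis]
  congr 1

theorem contDiff_det : ContDiff ℝ ω fun A : Eu d →L[ℝ] Eu d => A.det := by
  simp only [det_eq_matrix_det, Matrix.det_apply, Matrix.of_apply]
  refine ContDiff.sum fun σ _ => ContDiff.const_smul _ (contDiff_prod fun i _ => ?_)
  exact ((EuclideanSpace.proj (𝕜 := ℝ) (σ i)).comp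
    (ContinuousLinearMap.apply ℝ (Eu d) (stdVec i))).contDiff

/-- The effect of a linear change of the vectors on a Gram determinant. -/
theorem gram_comp (b : Eu d →L[ℝ] Eu d →L[ℝ] ℝ) (B A : Eu d →L[ℝ] Eu d) :
    gram b (fun i => B (A (stdVec i))) = A.det ^ 2 * gram b fun i => B (stdVec i) := by
  set Q : Matrix (Fin d) (Fin d) ℝ := Matrix.of fun k i => (A (stdVec i)) k with hQ
  set G : Matrix (Fin d) (Fin d) ℝ := Matrix.of fun i j => b (B (stdVec i)) (B (stdVec j)) with hG
  have h : (Matrix.of fun i j => b (B (A (stdVec i))) (B (A (stdVec j))) :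
      Matrix (Fin d) (Fin d) ℝ) = Q.transpose * G * Q := by
    ext i j
    rw [Matrix.of_apply, eu_eq_sum_stdVec (A (stdVec i)), eu_eq_sum_stdVec (A (stdVec j))]
    simp only [map_sum, map_smul, sum_apply, smul_apply,
      smul_eq_mul, Matrix.mul_apply, Matrix.transpose_apply, hQ, hG, Matrix.of_apply,
      Finset.mul_sum, Finset.sum_mul]
    refine Finset.sum_congr rfl fun k _ => Finset.sum_congr rfl fun l _ => ?_
    ring
  unfold gram
  rw [h, Matrix.det_mul, Matrix.det_mul, Matrix.det_transpose, det_eq_matrix_det A]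
  ring

theorem gram_pos {b : Eu d →L[ℝ] Eu d →L[ℝ] ℝ} (hs : ∀ v w, b v w = b w v)
    (hb : ∀ v, v ≠ 0 → 0 < b v v) {B : Eu d →L[ℝ] Eu d}
    (hB : Function.Injective B) : 0 < gram b fun i => B (stdVec i) := by
  refine Matrix.PosDef.det_pos (Matrix.PosDef.of_dotProduct_mulVec_pos ?_ fun v hv => ?_)
  · ext i j
    simp [hs (B (stdVec i))]
  · have h0 : B (∑ i, v i • stdVec i) ≠ 0 := by
      intro h
      rw [← map_zero B] at h
      have h1 := hB h
      have h2 := eu_eq_sum_stdVec (WithLp.toLp 2 v : Eu d)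
      simp only at h2
      rw [h1] at h2
      exact hv (by simpa using congrArg WithLp.ofLp h2)
    have := hb _ h0
    have h3 : star v ⬝ᵥ (Matrix.of fun i j => b (B (stdVec i)) (B (stdVec j))).mulVec v =
        b (B (∑ i, v i • stdVec i)) (B (∑ i, v i • stdVec i)) := by
      simp only [map_sum, map_smul, sum_apply, smul_apply,
        smul_eq_mul, dotProduct, Matrix.mulVec, Finset.mul_sum, Matrix.of_apply, star_trivial]
      refine Finset.sum_congr rfl fun k _ => Finset.sum_congr rfl fun l _ => ?_
      rw [hs]
      ring
    exact h3.symm ▸ this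

variable {M : Type*} [TopologicalSpace M] [ChartedSpace (Eu d) M]

/-- A map of `M` read in the charts around `p` and `q`. -/
abbrev chartMap (p q : M) (f : M → M) : Eu d → Eu d :=
  chartAt (Eu d) q ∘ f ∘ (chartAt (Eu d) p).symm

/-- The coordinate frame of the chart around `p` at the point of coordinates `y`. -/
def chartFrame (p : M) (y : Eu d) : Eu d →L[ℝ] Eu d :=
  mfderiv (𝓡 d) (𝓡 d) (chartAt (Eu d) p).symm y

/-- The tangent map, with the tangent spaces identified with `ℝ^d`. -/
def tangentAt (f : M → M) (x : M) : Eu d →L[ℝ] Eu d := mfderiv (𝓡 d) (𝓡 d) f x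

variable [IsManifold (𝓡 d) ∞ M]

/-- The Riemannian metric at `x`, with the tangent space identified with `ℝ^d`. -/
def metricForm (g : RiemMetric d M) (x : M) : Eu d →L[ℝ] Eu d →L[ℝ] ℝ := g.inner x

theorem metricForm_gram_pos (g : RiemMetric d M) (x : M) {B : Eu d →L[ℝ] Eu d}
    (hB : Function.Injective B) : 0 < gram (metricForm g x) fun i => B (stdVec i) :=
  gram_pos (g.symm x) (g.pos x) hB

theorem chartDensity_eq (g : RiemMetric d M) (p : M) (y : Eu d) : chartDensity g p y =
    √(gram (metricForm g ((chartAt (Eu d) p).symm y)) fun i => chartFrame p y (stdVec i)) := rfl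

theorem jacobian_eq_gram (g : RiemMetric d M) (f : M → M) (x : M) : jacobian g f x =
    √(gram (metricForm g (f x)) (fun i => tangentAt f x (stdVec i)) /
      gram (metricForm g x) stdVec) := rfl

/-- The chain rule in charts: the coordinate frames intertwine the tangent map of `f` with the
derivative of its coordinate expression. -/
theorem tangentAt_comp_chartFrame {f : M → M} {p q x : M} (hx : x ∈ (chartAt (Eu d) p).source)
    (hfx : f x ∈ (chartAt (Eu d) q).source) (hf : MDifferentiableAt (𝓡 d) (𝓡 d) f x) :
    DifferentiableAt ℝ (chartMap p q f) (chartAt (Eu d) p x) ∧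
    (tangentAt f x).comp (chartFrame p (chartAt (Eu d) p x)) =
      (chartFrame q (chartAt (Eu d) q (f x))).comp
        (fderiv ℝ (chartMap p q f) (chartAt (Eu d) p x)) := by
  have hp := mdifferentiable_chart (I := 𝓡 d) p
  have hq := mdifferentiable_chart (I := 𝓡 d) q
  set y := chartAt (Eu d) p x with hy
  have hyt : y ∈ (chartAt (Eu d) p).target := (chartAt (Eu d) p).map_source hx
  have hyx : (chartAt (Eu d) p).symm y = x := (chartAt (Eu d) p).left_inv hx
  have h1 : MDifferentiableAt (𝓡 d) (𝓡 d) (chartAt (Eu d) p).symm y :=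
    hp.mdifferentiableAt_symm hyt
  have h2 : MDifferentiableAt (𝓡 d) (𝓡 d) (f ∘ (chartAt (Eu d) p).symm) y :=
    MDifferentiableAt.comp y (by rw [hyx]; exact hf) h1
  have h3 : MDifferentiableAt (𝓡 d) (𝓡 d) (chartMap p q f) y :=
    MDifferentiableAt.comp y (g := chartAt (Eu d) q)
      (hq.mdifferentiableAt (by simpa [hyx] using hfx)) h2
  refine ⟨h3.differentiableAt, ?_⟩
  have e : f ∘ (chartAt (Eu d) p).symm =ᶠ[𝓝 y] (chartAt (Eu d) q).symm ∘ chartMap p q f := by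
    have : ∀ᶠ z in 𝓝 y, f ((chartAt (Eu d) p).symm z) ∈ (chartAt (Eu d) q).source := by
      refine h2.continuousAt.eventually ((chartAt (Eu d) q).open_source.mem_nhds ?_)
      simpa [hyx] using hfx
    filter_upwards [this] with z hz
    simp [chartMap, (chartAt (Eu d) q).left_inv hz]
  have hz : chartMap p q f y = chartAt (Eu d) q (f x) := by simp [chartMap, hyx]
  have e1 := e.mfderiv_eq (I := 𝓡 d) (I' := 𝓡 d)
  have h4 : MDifferentiableAt (𝓡 d) (𝓡 d) (chartAt (Eu d) q).symm (chartMap p q f y) := by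
    rw [hz]
    exact hq.mdifferentiableAt_symm ((chartAt (Eu d) q).map_source hfx)
  have e2 := mfderiv_comp y (by rw [hyx]; exact hf) h1
  have e3 := mfderiv_comp y h4 h3
  have e4 : (tangentAt f ((chartAt (Eu d) p).symm y)).comp (chartFrame p y) =
      (chartFrame q (chartMap p q f y)).comp (fderiv ℝ (chartMap p q f) y) := by
    rw [← mfderiv_eq_fderiv]
    exact (e2.symm.trans e1).trans e3
  rwa [hyx, hz] at e4

theorem bijective_chartFrame {p : M} {y : Eu d} (hy : y ∈ (chartAt (Eu d) p).target) :
    Function.Bijective (chartFrame p y) :=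
  (mdifferentiable_chart (I := 𝓡 d) p).symm.mfderiv_bijective hy

theorem chartDensity_pos (g : RiemMetric d M) {p : M} {y : Eu d}
    (hy : y ∈ (chartAt (Eu d) p).target) : 0 < chartDensity g p y :=
  Real.sqrt_pos.2 (metricForm_gram_pos g _ (bijective_chartFrame hy).1)

/-- The Jacobian read in charts. -/
theorem jacobian_eq (g : RiemMetric d M) {f : M → M} {p q x : M}
    (hx : x ∈ (chartAt (Eu d) p).source)
    (hfx : f x ∈ (chartAt (Eu d) q).source) (hf : MDifferentiableAt (𝓡 d) (𝓡 d) f x) :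
    jacobian g f x = chartDensity g q (chartAt (Eu d) q (f x)) *
      |(fderiv ℝ (chartMap p q f) (chartAt (Eu d) p x)).det| /
        chartDensity g p (chartAt (Eu d) p x) := by
  have h2 := (tangentAt_comp_chartFrame hx hfx hf).2
  set y := chartAt (Eu d) p x with hy
  have hyt : y ∈ (chartAt (Eu d) p).target := (chartAt (Eu d) p).map_source hx
  have hyx : (chartAt (Eu d) p).symm y = x := (chartAt (Eu d) p).left_inv hx
  have hzx : (chartAt (Eu d) q).symm (chartAt (Eu d) q (f x)) = f x :=
    (chartAt (Eu d) q).left_inv hfx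
  have hCb := bijective_chartFrame hyt
  rw [jacobian_eq_gram, chartDensity_eq, chartDensity_eq, hyx, hzx]
  set C := chartFrame p y
  set Dq := chartFrame q (chartAt (Eu d) q (f x))
  set A := fderiv ℝ (chartMap p q f) y
  set F : Eu d →L[ℝ] Eu d := tangentAt f x
  obtain ⟨e, he⟩ : ∃ e : Eu d ≃L[ℝ] Eu d, (e : Eu d →L[ℝ] Eu d) = C :=
    ⟨(LinearEquiv.ofBijective C.toLinearMap hCb).toContinuousLinearEquiv, by ext1 v; rfl⟩
  have hCi : ∀ v, C (e.symm v) = v := fun v => by rw [← he]; simp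
  have h1 : gram (metricForm g x) stdVec = (e.symm : Eu d →L[ℝ] Eu d).det ^ 2 *
      gram (metricForm g x) (fun i => C (stdVec i)) := by
    rw [← gram_comp _ C]
    simp [hCi]
  have h3 : gram (metricForm g (f x)) (fun i => F (stdVec i)) =
      (e.symm : Eu d →L[ℝ] Eu d).det ^ 2 *
      (A.det ^ 2 * gram (metricForm g (f x)) (fun i => Dq (stdVec i))) := by
    rw [← gram_comp _ Dq]
    have := gram_comp (metricForm g (f x)) (F.comp C) e.symm
    simp only [ContinuousLinearMap.comp_apply, ContinuousLinearEquiv.coe_coe, hCi] at this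
    rw [this]
    congr 2
    funext i
    exact congrArg (fun L : Eu d →L[ℝ] Eu d => L (stdVec i)) h2
  have hdet : (e.symm : Eu d →L[ℝ] Eu d).det ^ 2 ≠ 0 :=
    pow_ne_zero _ (LinearEquiv.isUnit_det' e.symm.toLinearEquiv).ne_zero
  rw [h1, h3, mul_div_mul_left _ _ hdet, Real.sqrt_div', Real.sqrt_mul (sq_nonneg _),
    Real.sqrt_sq_eq_abs, mul_comm]
  exact (metricForm_gram_pos g x hCb.1).le

theorem jacobian_id (g : RiemMetric d M) (x : M) : jacobian g id x = 1 := by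
  have h1 := metricForm_gram_pos g x (B := ContinuousLinearMap.id ℝ (Eu d)) Function.injective_id
  have h2 : tangentAt (id : M → M) x = ContinuousLinearMap.id ℝ (Eu d) := mfderiv_id
  rw [jacobian_eq_gram, h2]
  simp only [ContinuousLinearMap.id_apply, id] at h1 ⊢
  rw [div_self h1.ne', Real.sqrt_one]

/-- Change of the Riemannian density under a change of charts. -/
theorem chartDensity_transition (g : RiemMetric d M) {p q x : M}
    (hp : x ∈ (chartAt (Eu d) p).source) (hq : x ∈ (chartAt (Eu d) q).source) :
    chartDensity g p (chartAt (Eu d) p x) = chartDensity g q (chartAt (Eu d) q x) *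
      |(fderiv ℝ (chartMap p q id) (chartAt (Eu d) p x)).det| := by
  have h := jacobian_eq g (f := id) hp hq mdifferentiableAt_id
  rw [jacobian_id, eq_div_iff
    (chartDensity_pos g ((chartAt (Eu d) p).map_source hp)).ne', one_mul] at h
  exact h

theorem contDiffOn_chartDensity (g : RiemMetric d M) (p : M) :
    ContDiffOn ℝ ∞ (chartDensity g p) (chartAt (Eu d) p).target := by
  set e := chartAt (Eu d) p with he
  have hX : ∀ i, ContMDiffOn (𝓡 d) ((𝓡 d).prod (𝓡 d)) ∞
      (fun y => (Bundle.TotalSpace.mk' (Eu d) (e.symm y)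
        (mfderiv (𝓡 d) (𝓡 d) e.symm y (stdVec i) : TangentSpace (𝓡 d) (e.symm y)) :
        TangentBundle (𝓡 d) M)) e.target := by
    intro i
    have h1 : ContMDiffOn (𝓡 d) (𝓡 d) ∞ e.symm e.target := contMDiffOn_chart_symm
    have h2 := h1.contMDiffOn_tangentMapWithin (m := ∞) (by simp) e.open_target.uniqueMDiffOn
    have h3 : ContMDiff (𝓡 d) ((𝓡 d).prod (𝓡 d)) ∞
        (fun y : Eu d =>
          (Bundle.TotalSpace.mk' (Eu d) y (stdVec i) : TangentBundle (𝓡 d) (Eu d))) := by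
      exact (contMDiff_vectorSpace_iff_contDiff (V := fun _ : Eu d => stdVec i)).2 contDiff_const
    have h4 := h2.comp h3.contMDiffOn (s := e.target) (fun y hy => hy)
    refine h4.congr fun y hy => ?_
    have : mfderivWithin (𝓡 d) (𝓡 d) e.symm e.target y = mfderiv (𝓡 d) (𝓡 d) e.symm y :=
      mfderivWithin_of_isOpen e.open_target hy
    change _ = tangentMapWithin (𝓡 d) (𝓡 d) e.symm e.target _
    unfold tangentMapWithin
    rw [← this]
  have hg : ∀ i j, ContDiffOn ℝ ∞ (fun y => metricForm g (e.symm y)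
      (chartFrame p y (stdVec i)) (chartFrame p y (stdVec j))) e.target := by
    intro i j
    have h0 := g.contMDiff.comp_contMDiffOn (contMDiffOn_chart_symm (I := 𝓡 d) (n := ∞) (x := p))
    have := ContMDiffOn.clm_bundle_apply₂ (E₃ := fun _ : M => ℝ) (F₃ := ℝ) (b := e.symm)
      (ψ := fun y => g.inner (e.symm y)) h0 (hX i) (hX j)
    intro y hy
    have h := this y hy
    rw [Bundle.contMDiffWithinAt_totalSpace] at h
    exact h.2.contDiffWithinAt
  have hgr : ContDiffOn ℝ ∞ (fun y => gram (metricForm g (e.symm y))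
      fun i => chartFrame p y (stdVec i)) e.target := by
    simp only [gram, Matrix.det_apply, Matrix.of_apply]
    exact ContDiffOn.sum fun σ _ => ContDiffOn.const_smul _ (contDiffOn_prod fun i _ => hg _ _)
  exact hgr.sqrt fun y hy => (metricForm_gram_pos g _ (bijective_chartFrame hy).1).ne'

theorem contDiffOn_chartMap {n : ℕ} {f : M → M} (hf : ContMDiff (𝓡 d) (𝓡 d) n f) (p q : M) :
    ContDiffOn ℝ n (chartMap p q f) ((chartAt (Eu d) p).target ∩
      (chartAt (Eu d) p).symm ⁻¹' (f ⁻¹' (chartAt (Eu d) q).source)) := by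
  rw [← contMDiffOn_iff_contDiffOn]
  have : IsManifold (𝓡 d) n M := IsManifold.of_le (n := ∞) (mod_cast le_top)
  exact (contMDiffOn_chart (I := 𝓡 d) (x := q)).comp
    (hf.comp_contMDiffOn ((contMDiffOn_chart_symm (I := 𝓡 d) (x := p)).mono inter_subset_left))
    fun y hy => hy.2

end Gram

/-! ### The Riemannian measure in charts -/

section RiemMeasure

variable {d : ℕ} {M : Type*} [TopologicalSpace M] [ChartedSpace (Eu d) M]
  [IsManifold (𝓡 d) ∞ M] [MeasurableSpace M] [BorelSpace M]

theorem measurableSet_inter_preimage {X Y : Type*} [TopologicalSpace X] [MeasurableSpace X]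
    [OpensMeasurableSpace X] [TopologicalSpace Y] [MeasurableSpace Y] [BorelSpace Y] {A : Set X}
    (hA : MeasurableSet A) {f : X → Y} (hf : ContinuousOn f A) {S : Set Y}
    (hS : MeasurableSet S) : MeasurableSet (A ∩ f ⁻¹' S) := by
  have h := hA.subtype_image ((continuousOn_iff_continuous_domRestrict.1 hf).measurable hS)
  convert h using 1
  ext x
  simp [and_comm]

theorem aemeasurable_chart_symm (p : M) :
    AEMeasurable (chartAt (Eu d) p).symm (volume.restrict (chartAt (Eu d) p).target) :=
  (chartAt (Eu d) p).continuousOn_symm.aemeasurable (chartAt (Eu d) p).open_target.measurableSet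

theorem measurableSet_chart_preimage (p : M) {S : Set M} (hS : MeasurableSet S) :
    MeasurableSet ((chartAt (Eu d) p).target ∩ (chartAt (Eu d) p).symm ⁻¹' S) :=
  measurableSet_inter_preimage (chartAt (Eu d) p).open_target.measurableSet
    (chartAt (Eu d) p).continuousOn_symm hS

theorem aemeasurable_chartDensity (g : RiemMetric d M) (p : M) :
    AEMeasurable (fun y => ENNReal.ofReal (chartDensity g p y))
      (volume.restrict (chartAt (Eu d) p).target) :=
  ((contDiffOn_chartDensity g p).continuousOn.aemeasurable
    (chartAt (Eu d) p).open_target.measurableSet).ennreal_ofReal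

theorem lintegral_chartMeasure (g : RiemMetric d M) (p : M) {f : M → ℝ≥0∞}
    (hf : AEMeasurable f (chartMeasure g p)) :
    ∫⁻ x, f x ∂(chartMeasure g p) = ∫⁻ y in (chartAt (Eu d) p).target,
      ENNReal.ofReal (chartDensity g p y) * f ((chartAt (Eu d) p).symm y) := by
  have hs := (aemeasurable_chart_symm (d := d) p).mono_ac
    (withDensity_absolutelyContinuous _ fun y => ENNReal.ofReal (chartDensity g p y))
  unfold chartMeasure at hf ⊢
  rw [lintegral_map' hf hs]
  exact lintegral_withDensity_eq_lintegral_mul₀' (aemeasurable_chartDensity g p)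
    (hf.comp_aemeasurable hs)

theorem chartMeasure_apply (g : RiemMetric d M) (p : M) {S : Set M} (hS : MeasurableSet S) :
    chartMeasure g p S = ∫⁻ y in (chartAt (Eu d) p).target ∩ (chartAt (Eu d) p).symm ⁻¹' S,
      ENNReal.ofReal (chartDensity g p y) := by
  rw [← lintegral_indicator_one hS,
    lintegral_chartMeasure g p (measurable_one.indicator hS).aemeasurable,
    ← lintegral_indicator (chartAt (Eu d) p).open_target.measurableSet,
    ← lintegral_indicator (measurableSet_chart_preimage p hS)]
  congr 1
  funext y
  by_cases h1 : y ∈ (chartAt (Eu d) p).target <;>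
    by_cases h2 : (chartAt (Eu d) p).symm y ∈ S <;> simp [h1, h2]

/-- The measures `chartMeasure g p` agree on the overlaps of chart domains, by the change of
variables formula. -/
theorem chartMeasure_eq_of_subset (g : RiemMetric d M) (p q : M) {S : Set M}
    (hS : MeasurableSet S) (hp : S ⊆ (chartAt (Eu d) p).source)
    (hq : S ⊆ (chartAt (Eu d) q).source) : chartMeasure g p S = chartMeasure g q S := by
  set e := chartAt (Eu d) p with he
  set e' := chartAt (Eu d) q with he'
  have hpre : ∀ p : M, S ⊆ (chartAt (Eu d) p).source → (chartAt (Eu d) p).target ∩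
      (chartAt (Eu d) p).symm ⁻¹' S = chartAt (Eu d) p '' S := fun p hp =>
    ((chartAt (Eu d) p).image_eq_target_inter_inv_preimage hp).symm
  have hm := measurableSet_chart_preimage (d := d) p hS
  rw [chartMeasure_apply g p hS, chartMeasure_apply g q hS]
  rw [hpre p hp] at hm ⊢
  rw [hpre q hq]
  have him : e' '' S = chartMap p q id '' (e '' S) := by
    rw [image_image]
    refine image_congr fun x hx => ?_
    simp [chartMap, ← he, e.left_inv (hp hx), he']
  rw [him, lintegral_image_eq_lintegral_abs_det_fderiv_mul volume hm
    (f' := fun y => fderiv ℝ (chartMap p q id) y)]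
  · refine setLIntegral_congr_fun hm ?_
    rintro _ ⟨x, hx, rfl⟩
    dsimp only
    rw [chartDensity_transition g (hp hx) (hq hx), ENNReal.ofReal_mul' (abs_nonneg _), mul_comm]
    simp [chartMap, ← he, e.left_inv (hp hx)]
  · rintro _ ⟨x, hx, rfl⟩
    exact (tangentAt_comp_chartFrame (f := id) (hp hx) (hq hx)
      mdifferentiableAt_id).1.hasFDerivAt.hasFDerivWithinAt
  · rintro _ ⟨x, hx, rfl⟩ _ ⟨x', hx', rfl⟩ h
    simp only [chartMap, Function.comp_apply, id, ← he, e.left_inv (hp hx),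
      e.left_inv (hp hx')] at h
    rw [e'.injOn (hq hx) (hq hx') h]

theorem chartMeasure_compl_source (g : RiemMetric d M) (p : M) :
    chartMeasure g p (chartAt (Eu d) p).sourceᶜ = 0 := by
  rw [chartMeasure_apply g p (chartAt (Eu d) p).open_source.measurableSet.compl]
  have : (chartAt (Eu d) p).target ∩
      (chartAt (Eu d) p).symm ⁻¹' (chartAt (Eu d) p).sourceᶜ = ∅ := by
    ext y
    simp only [mem_inter_iff, mem_preimage, mem_compl_iff, mem_empty_iff_false, iff_false, not_and,
      not_not]
    exact fun hy => (chartAt (Eu d) p).map_target hy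
  rw [this]
  simp

variable [SecondCountableTopology M]

/-- The Riemannian measure is given by the density `√ det (g_ij)` in each chart. -/
theorem riemMeasure_restrict_source (g : RiemMetric d M) (p : M) :
    (riemMeasure g).restrict (chartAt (Eu d) p).source = chartMeasure g p := by
  -- a countable measurable partition subordinate to charts, and the measure glued along it
  obtain ⟨s, hsc, hs⟩ := TopologicalSpace.countable_cover_nhds
    fun x : M => (chartAt (Eu d) x).open_source.mem_nhds (mem_chart_source (Eu d) x)
  have hne : s.Nonempty := by
    by_contra h
    rw [not_nonempty_iff_eq_empty] at h
    simp only [h, mem_empty_iff_false, iUnion_of_empty, iUnion_empty] at hs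
    exact (hs ▸ mem_univ p : p ∈ (∅ : Set M))
  obtain ⟨u, rfl⟩ := hsc.exists_eq_range hne
  set B : ℕ → Set M := disjointed fun n => (chartAt (Eu d) (u n)).source with hB
  have hBm : ∀ n, MeasurableSet (B n) :=
    MeasurableSet.disjointed fun n => (chartAt (Eu d) (u n)).open_source.measurableSet
  have hBd : Pairwise fun i j => Disjoint (B i) (B j) := disjoint_disjointed _
  have hBU : ⋃ n, B n = univ := by
    rw [hB, iUnion_disjointed, ← hs, biUnion_range]
  have hBs : ∀ n, B n ⊆ (chartAt (Eu d) (u n)).source := fun n => disjointed_subset _ n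
  have hsplit : ∀ (m : Measure M) {S : Set M}, MeasurableSet S → m S = ∑' n, m (S ∩ B n) := by
    intro m S hS
    rw [← measure_iUnion (fun i j hij => (hBd hij).mono inter_subset_right inter_subset_right)
      fun n => hS.inter (hBm n), ← inter_iUnion, hBU, inter_univ]
  set m' : Measure M := Measure.sum fun n => (chartMeasure g (u n)).restrict (B n) with hm'
  have hm'S : ∀ {S : Set M}, MeasurableSet S → m' S = ∑' n, chartMeasure g (u n) (S ∩ B n) := by
    intro S hS
    rw [hm', Measure.sum_apply _ hS]
    simp only [Measure.restrict_apply hS]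
  have hA : ∀ (p : M) {S : Set M}, MeasurableSet S →
      chartMeasure g p S = m' (S ∩ (chartAt (Eu d) p).source) := by
    intro p S hS
    have hsm := (chartAt (Eu d) p).open_source.measurableSet
    rw [hm'S (hS.inter hsm), hsplit _ hS]
    refine tsum_congr fun n => ?_
    rw [inter_right_comm, ← chartMeasure_eq_of_subset g p (u n) ((hS.inter (hBm n)).inter hsm)
      inter_subset_right (inter_subset_left.trans (inter_subset_right.trans (hBs n)))]
    exact (measure_inter_conull (chartMeasure_compl_source g p)).symm
  have hriem : riemMeasure g = m' := by
    refine le_antisymm (iSup_le fun p => Measure.le_iff.2 fun S hS => ?_)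
      (Measure.le_iff.2 fun S hS => ?_)
    · rw [hA p hS]
      exact measure_mono inter_subset_left
    · rw [hm'S hS, hsplit _ hS]
      exact ENNReal.tsum_le_tsum fun n => le_iSup (chartMeasure g) (u n) _
  ext S hS
  rw [Measure.restrict_apply hS, hriem, hA p hS]

theorem lintegral_riemMeasure_source (g : RiemMetric d M) (p : M) {f : M → ℝ≥0∞}
    (hf : AEMeasurable f ((riemMeasure g).restrict (chartAt (Eu d) p).source)) :
    ∫⁻ x in (chartAt (Eu d) p).source, f x ∂(riemMeasure g) = ∫⁻ y in (chartAt (Eu d) p).target,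
      ENNReal.ofReal (chartDensity g p y) * f ((chartAt (Eu d) p).symm y) := by
  rw [riemMeasure_restrict_source] at hf ⊢
  exact lintegral_chartMeasure g p hf

theorem setLIntegral_riemMeasure (g : RiemMetric d M) (p : M) {f : M → ℝ≥0∞}
    {S : Set M} (hS : MeasurableSet S) (hSp : S ⊆ (chartAt (Eu d) p).source)
    (hf : AEMeasurable f ((riemMeasure g).restrict S)) :
    ∫⁻ x in S, f x ∂(riemMeasure g) =
      ∫⁻ y in (chartAt (Eu d) p).target ∩ (chartAt (Eu d) p).symm ⁻¹' S,
        ENNReal.ofReal (chartDensity g p y) * f ((chartAt (Eu d) p).symm y) := by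
  have h := lintegral_riemMeasure_source g p (f := S.indicator f) (by
    rwa [aemeasurable_indicator_iff hS, Measure.restrict_restrict hS, inter_eq_left.2 hSp])
  rw [lintegral_indicator hS, Measure.restrict_restrict hS, inter_eq_left.2 hSp] at h
  rw [h, ← lintegral_indicator (chartAt (Eu d) p).open_target.measurableSet,
    ← lintegral_indicator (measurableSet_chart_preimage p hS)]
  congr 1
  funext y
  by_cases h1 : y ∈ (chartAt (Eu d) p).target <;>
    by_cases h2 : (chartAt (Eu d) p).symm y ∈ S <;> simp [h1, h2]

theorem isLocallyFiniteMeasure_riemMeasure (g : RiemMetric d M) :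
    IsLocallyFiniteMeasure (riemMeasure g) := by
  refine ⟨fun x => ?_⟩
  set e := chartAt (Eu d) x with he
  have hx : e x ∈ e.target := e.map_source (mem_chart_source _ x)
  have hc : ContinuousAt (chartDensity g x) (e x) :=
    (contDiffOn_chartDensity g x).continuousOn.continuousAt (e.open_target.mem_nhds hx)
  set V : Set (Eu d) := {y | chartDensity g x y < chartDensity g x (e x) + 1} ∩
    Metric.ball (e x) 1 with hV
  have hVn : V ∈ 𝓝 (e x) := inter_mem (hc.eventually_lt continuousAt_const (by simp))
    (Metric.ball_mem_nhds _ one_pos)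
  obtain ⟨W, hWV, hWo, hxW⟩ := mem_nhds_iff.1 hVn
  refine ⟨e.source ∩ e ⁻¹' W, (e.isOpen_inter_preimage hWo).mem_nhds
    ⟨mem_chart_source _ x, hxW⟩, ?_⟩
  have hSo : MeasurableSet (e.source ∩ e ⁻¹' W) := (e.isOpen_inter_preimage hWo).measurableSet
  have h := setLIntegral_riemMeasure g x hSo inter_subset_left measurable_one.aemeasurable
  simp only [Pi.one_apply, setLIntegral_one, mul_one] at h
  rw [h]
  have hsub : e.target ∩ e.symm ⁻¹' (e.source ∩ e ⁻¹' W) ⊆ W := by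
    rintro y ⟨hy, -, hy2⟩
    rwa [mem_preimage, e.right_inv hy] at hy2
  calc _ ≤ ∫⁻ y in e.target ∩ e.symm ⁻¹' (e.source ∩ e ⁻¹' W),
        ENNReal.ofReal (chartDensity g x (e x) + 1) :=
        setLIntegral_mono measurable_const fun y hy =>
          ENNReal.ofReal_le_ofReal (hWV (hsub hy)).1.le
    _ ≤ ENNReal.ofReal (chartDensity g x (e x) + 1) * volume (Metric.ball (e x) 1) := by
        rw [setLIntegral_const]
        gcongr
        exact hsub.trans (hWV.trans inter_subset_right)
    _ < ⊤ := ENNReal.mul_lt_top ENNReal.ofReal_lt_top measure_ball_lt_top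

theorem isOpenPosMeasure_riemMeasure (g : RiemMetric d M) :
    (riemMeasure g).IsOpenPosMeasure := by
  refine ⟨fun U hU ⟨x, hxU⟩ h0 => ?_⟩
  set e := chartAt (Eu d) x with he
  have hO : IsOpen (e.source ∩ U) := e.open_source.inter hU
  have h := setLIntegral_riemMeasure g x hO.measurableSet inter_subset_left
    measurable_one.aemeasurable
  simp only [Pi.one_apply, setLIntegral_one, mul_one] at h
  rw [measure_mono_null inter_subset_right h0] at h
  have hopen : IsOpen (e.target ∩ e.symm ⁻¹' (e.source ∩ U)) := e.isOpen_inter_preimage_symm hO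
  have hae : AEMeasurable (fun y => ENNReal.ofReal (chartDensity g x y))
      (volume.restrict (e.target ∩ e.symm ⁻¹' (e.source ∩ U))) :=
    (aemeasurable_chartDensity g x).mono_set inter_subset_left
  have h' := (setLIntegral_eq_zero_iff' hopen.measurableSet hae).1 h.symm
  have hnull : volume (e.target ∩ e.symm ⁻¹' (e.source ∩ U)) = 0 := by
    refine measure_mono_null (fun y hy => ?_) (ae_iff.1 h')
    intro h0
    have := ENNReal.ofReal_eq_zero.1 (h0 hy)
    exact absurd (chartDensity_pos g hy.1) (not_lt.2 this)
  exact hopen.measure_ne_zero volume ⟨e x, e.map_source (mem_chart_source _ x), by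
    simp [he, mem_chart_source, hxU]⟩ hnull

end RiemMeasure

/-! ### Local diffeomorphisms: inverse branches and Jacobians -/

/-- The inverse function theorem on an open set where all the derivatives are invertible. -/
theorem exists_openPartialHomeomorph_of_bijective_fderiv {E F : Type*} [NormedAddCommGroup E]
    [NormedSpace ℝ E] [CompleteSpace E] [NormedAddCommGroup F] [NormedSpace ℝ F] [CompleteSpace F]
    {n : ℕ∞ω} (hn : n ≠ 0) {f : E → F} {O : Set E} (hO : IsOpen O) (hf : ContDiffOn ℝ n f O)
    (hbij : ∀ x ∈ O, Function.Bijective (fderiv ℝ f x)) {a : E} (ha : a ∈ O) :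
    ∃ e : OpenPartialHomeomorph E F, a ∈ e.source ∧ e.source ⊆ O ∧ ⇑e = f ∧
      ContDiffOn ℝ n e.symm e.target := by
  have hat : ∀ x ∈ O, ContDiffAt ℝ n f x := fun x hx => hf.contDiffAt (hO.mem_nhds hx)
  have hder : ∀ x ∈ O, ∃ f' : E ≃L[ℝ] F, HasFDerivAt f (f' : E →L[ℝ] F) x := by
    intro x hx
    refine ⟨ContinuousLinearEquiv.ofBijective (fderiv ℝ f x)
      (LinearMap.ker_eq_bot.2 (hbij x hx).1) (LinearMap.range_eq_top.2 (hbij x hx).2), ?_⟩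
    rw [ContinuousLinearEquiv.coe_ofBijective]
    exact ((hat x hx).differentiableAt hn).hasFDerivAt
  obtain ⟨f', hf'⟩ := hder a ha
  refine ⟨((hat a ha).toOpenPartialHomeomorph f hf' hn).restrOpen O hO, ?_, ?_, ?_, ?_⟩
  · rw [OpenPartialHomeomorph.restrOpen_source]
    exact ⟨(hat a ha).mem_toOpenPartialHomeomorph_source hf' hn, ha⟩
  · rw [OpenPartialHomeomorph.restrOpen_source]
    exact inter_subset_right
  · rfl
  · intro y hy
    set e := ((hat a ha).toOpenPartialHomeomorph f hf' hn).restrOpen O hO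
    have hx : e.symm y ∈ O := by
      have := e.map_target hy
      rw [OpenPartialHomeomorph.restrOpen_source] at this
      exact this.2
    obtain ⟨f'', hf''⟩ := hder _ hx
    exact (e.contDiffAt_symm hy (f₀' := f'') hf'' (hat _ hx)).contDiffWithinAt

section LocalDiffeo

variable {d : ℕ} {M : Type*} [TopologicalSpace M] [ChartedSpace (Eu d) M]
  [IsManifold (𝓡 d) ∞ M]

theorem natCast_le_infty (n : ℕ) : (n : ℕ∞ω) ≤ (∞ : ℕ∞ω) := by
  have h : (n : ℕ∞) ≤ ⊤ := le_top
  exact_mod_cast h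

theorem isManifold_nat (r : ℕ) : IsManifold (𝓡 d) r M :=
  IsManifold.of_le (n := ∞) (mod_cast le_top)

theorem bijective_fderiv_chartMap {f : M → M} {p q x : M} (hx : x ∈ (chartAt (Eu d) p).source)
    (hfx : f x ∈ (chartAt (Eu d) q).source) (hf : MDifferentiableAt (𝓡 d) (𝓡 d) f x) :
    Function.Bijective (fderiv ℝ (chartMap p q f) (chartAt (Eu d) p x)) ↔
      Function.Bijective (mfderiv (𝓡 d) (𝓡 d) f x) := by
  have h := (tangentAt_comp_chartFrame hx hfx hf).2
  have h1 := bijective_chartFrame ((chartAt (Eu d) p).map_source hx)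
  have h2 := bijective_chartFrame ((chartAt (Eu d) q).map_source hfx)
  have h3 : (tangentAt f x : Eu d → Eu d) ∘ (chartFrame p (chartAt (Eu d) p x)) =
      (chartFrame q (chartAt (Eu d) q (f x))) ∘
        (fderiv ℝ (chartMap p q f) (chartAt (Eu d) p x)) :=
    congrArg (fun L : Eu d →L[ℝ] Eu d => (L : Eu d → Eu d)) h
  have h4 : Function.Bijective (tangentAt f x : Eu d → Eu d) ↔
      Function.Bijective (fderiv ℝ (chartMap p q f) (chartAt (Eu d) p x)) := by
    rw [← Function.Bijective.of_comp_iff _ h1, h3, Function.Bijective.of_comp_iff' h2]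
  exact h4.symm

/-- The partial homeomorphism `e` is a restriction of `f` with an inverse of class `C^r`, so that
`e.symm` is a `C^r` inverse branch of `f`. -/
structure IsInverseBranch (d : ℕ) {M : Type*} [TopologicalSpace M] [ChartedSpace (Eu d) M]
    (r : ℕ) (f : M → M) (e : OpenPartialHomeomorph M M) : Prop where
  eqOn : EqOn e f e.source
  contMDiffOn_symm : ContMDiffOn (𝓡 d) (𝓡 d) r e.symm e.target

theorem IsInverseBranch.restr {r : ℕ} {f : M → M} {e : OpenPartialHomeomorph M M}
    (h : IsInverseBranch d r f e) {O : Set M} (hO : IsOpen O) :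
    IsInverseBranch d r f (e.restrOpen O hO) := by
  constructor
  · intro x hx
    rw [OpenPartialHomeomorph.restrOpen_source] at hx
    exact h.eqOn hx.1
  · refine h.contMDiffOn_symm.mono ?_
    intro y hy
    have : y ∈ e.target ∩ e.symm ⁻¹' O := by simpa using hy
    exact this.1

theorem exists_isInverseBranch {r : ℕ} (hr : 1 ≤ r) {f : M → M} (hf : ContMDiff (𝓡 d) (𝓡 d) r f)
    (hbij : ∀ x, Function.Bijective (mfderiv (𝓡 d) (𝓡 d) f x)) (x : M) :
    ∃ e : OpenPartialHomeomorph M M, x ∈ e.source ∧ IsInverseBranch d r f e := by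
  have hr0 : (r : ℕ∞ω) ≠ 0 := by exact_mod_cast (by omega : r ≠ 0)
  set p := chartAt (Eu d) x with hp
  set q := chartAt (Eu d) (f x) with hq
  set O := p.target ∩ p.symm ⁻¹' (f ⁻¹' q.source) with hOd
  have hO : IsOpen O := p.isOpen_inter_preimage_symm (q.open_source.preimage hf.continuous)
  have hdiff : ∀ z, MDifferentiableAt (𝓡 d) (𝓡 d) f z := fun z =>
    (hf z).mdifferentiableAt hr0
  have hbij' : ∀ y ∈ O, Function.Bijective (fderiv ℝ (chartMap x (f x) f) y) := by
    intro y hy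
    have := (bijective_fderiv_chartMap (p := x) (q := f x) (p.map_target hy.1) hy.2
      (hdiff _)).2 (hbij (p.symm y))
    rwa [← hp, p.right_inv hy.1] at this
  obtain ⟨e, he1, he2, he3, he4⟩ := exists_openPartialHomeomorph_of_bijective_fderiv hr0 hO
    (contDiffOn_chartMap hf x (f x)) hbij' (a := p x)
    ⟨p.map_source (mem_chart_source _ x), by simp [hp, hq]⟩
  refine ⟨(p.trans e).trans q.symm, ?_, ?_, ?_⟩
  · rw [hp] at he1
    simp [he1, he3, hp, hq]
  · intro z hz
    simp only [OpenPartialHomeomorph.trans_source, mem_inter_iff, mem_preimage] at hz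
    have h1 := he2 hz.1.2
    simp only [OpenPartialHomeomorph.coe_trans, Function.comp_apply, he3, chartMap]
    have h2 : f (p.symm (p z)) ∈ q.source := h1.2
    rw [← hp, ← hq, p.left_inv hz.1.1] at *
    exact q.left_inv h2
  · have hM := isManifold_nat (d := d) (M := M) r
    have h1 : ContMDiffOn (𝓡 d) (𝓡 d) r e.symm e.target := he4.contMDiffOn
    have h2 : ContMDiffOn (𝓡 d) (𝓡 d) r q q.source := contMDiffOn_chart
    have h3 : ContMDiffOn (𝓡 d) (𝓡 d) r p.symm p.target := contMDiffOn_chart_symm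
    have h4 : ContMDiffOn (𝓡 d) (𝓡 d) r (p.symm ∘ e.symm ∘ q)
        (q.source ∩ q ⁻¹' (e.target ∩ e.symm ⁻¹' p.target)) :=
      h3.comp (h1.comp (h2.mono inter_subset_left) (fun z hz => hz.2.1)) (fun z hz => hz.2.2)
    refine h4.mono fun z hz => ?_
    simp only [OpenPartialHomeomorph.trans_target, mem_inter_iff, mem_preimage,
      OpenPartialHomeomorph.symm_target, OpenPartialHomeomorph.symm_symm] at hz
    exact ⟨hz.1, hz.2.1, hz.2.2⟩

theorem jacobian_pos (g : RiemMetric d M) {f : M → M} {x : M}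
    (hf : MDifferentiableAt (𝓡 d) (𝓡 d) f x)
    (hbij : Function.Bijective (mfderiv (𝓡 d) (𝓡 d) f x)) : 0 < jacobian g f x := by
  have hx := mem_chart_source (Eu d) x
  have hfx := mem_chart_source (Eu d) (f x)
  rw [jacobian_eq g hx hfx hf]
  have h := (bijective_fderiv_chartMap hx hfx hf).2 hbij
  refine div_pos (mul_pos (chartDensity_pos g ((chartAt (Eu d) _).map_source hfx))
    (abs_pos.2 ?_)) (chartDensity_pos g ((chartAt (Eu d) _).map_source hx))
  exact (LinearEquiv.isUnit_det' (LinearEquiv.ofBijective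
    (fderiv ℝ (chartMap x (f x) f) (chartAt (Eu d) x x)).toLinearMap h)).ne_zero

theorem contMDiff_jacobian (g : RiemMetric d M) {r : ℕ} (hr : 1 ≤ r) {f : M → M}
    (hf : ContMDiff (𝓡 d) (𝓡 d) r f)
    (hbij : ∀ x, Function.Bijective (mfderiv (𝓡 d) (𝓡 d) f x)) :
    ContMDiff (𝓡 d) 𝓘(ℝ, ℝ) (r - 1 : ℕ) (jacobian g f) := by
  intro x
  have hr0 : (r : ℕ∞ω) ≠ 0 := by exact_mod_cast (by omega : r ≠ 0)
  have hM := isManifold_nat (d := d) (M := M) (r - 1)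
  have hdiff : ∀ z, MDifferentiableAt (𝓡 d) (𝓡 d) f z := fun z => (hf z).mdifferentiableAt hr0
  set p := chartAt (Eu d) x with hp
  set q := chartAt (Eu d) (f x) with hq
  set O := p.target ∩ p.symm ⁻¹' (f ⁻¹' q.source) with hOd
  have hO : IsOpen O := p.isOpen_inter_preimage_symm (q.open_source.preimage hf.continuous)
  have hr1 : ((r - 1 : ℕ) : ℕ∞ω) + 1 ≤ r := by
    exact_mod_cast (by omega : r - 1 + 1 ≤ r)
  have hr2 : ((r - 1 : ℕ) : ℕ∞ω) ≤ (∞ : ℕ∞ω) := natCast_le_infty _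
  have hr3 : ((r - 1 : ℕ) : ℕ∞ω) ≤ r := le_trans le_self_add hr1
  have hc := contDiffOn_chartMap hf x (f x)
  have hbij' : ∀ y ∈ O, Function.Bijective (fderiv ℝ (chartMap x (f x) f) y) := by
    intro y hy
    have := (bijective_fderiv_chartMap (p := x) (q := f x) (p.map_target hy.1) hy.2
      (hdiff _)).2 (hbij (p.symm y))
    rwa [← hp, p.right_inv hy.1] at this
  have h1 : ContDiffOn ℝ (r - 1 : ℕ) (fun y => |(fderiv ℝ (chartMap x (f x) f) y).det|) O := by
    intro y hy
    have h0 := ((contDiff_det (d := d)).of_le le_top).comp_contDiffOn (hc.fderiv_of_isOpen hO hr1)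
    refine (ContDiffAt.abs (h0.contDiffAt (hO.mem_nhds hy)) ?_).contDiffWithinAt
    exact (LinearEquiv.isUnit_det' (LinearEquiv.ofBijective
      (fderiv ℝ (chartMap x (f x) f) y).toLinearMap (hbij' y hy))).ne_zero
  have h2 : ContDiffOn ℝ (r - 1 : ℕ) (fun y => chartDensity g (f x) (chartMap x (f x) f y)) O :=
    ((contDiffOn_chartDensity g (f x)).of_le hr2).comp (hc.of_le hr3) fun y hy =>
      q.map_source hy.2
  have h3 : ContDiffOn ℝ (r - 1 : ℕ) (chartDensity g x) O :=
    ((contDiffOn_chartDensity g x).of_le hr2).mono inter_subset_left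
  have h4 := ((h2.mul h1).div h3 fun y hy => (chartDensity_pos g hy.1).ne').contMDiffOn
  have h5 : ContMDiffOn (𝓡 d) 𝓘(ℝ, ℝ) (r - 1 : ℕ) _ (p.source ∩ f ⁻¹' q.source) :=
    h4.comp ((contMDiffOn_chart (I := 𝓡 d) (x := x) (n := (r - 1 : ℕ))).mono
      inter_subset_left) (fun z hz =>
      ⟨p.map_source hz.1, by
        rw [mem_preimage, ← hp, p.left_inv hz.1]
        exact hz.2⟩)
  have hn : p.source ∩ f ⁻¹' q.source ∈ 𝓝 x :=
    (p.open_source.inter (q.open_source.preimage hf.continuous)).mem_nhds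
      ⟨mem_chart_source _ x, mem_chart_source _ _⟩
  refine (h5.contMDiffAt hn).congr_of_eventuallyEq ?_
  filter_upwards [hn] with z hz
  rw [jacobian_eq g hz.1 hz.2 (hdiff z)]
  simp [chartMap, ← hp, p.left_inv hz.1]

variable [T2Space M] [CompactSpace M]

/-- The preimages under a local diffeomorphism of the points near `y₀` are the values of finitely
many inverse branches. -/
theorem exists_inverseBranches {r : ℕ} (hr : 1 ≤ r) {f : M → M}
    (hf : ContMDiff (𝓡 d) (𝓡 d) r f)
    (hbij : ∀ x, Function.Bijective (mfderiv (𝓡 d) (𝓡 d) f x)) (y₀ : M) :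
    ∃ (t : Finset M) (e : M → OpenPartialHomeomorph M M) (W : Set M), IsOpen W ∧ y₀ ∈ W ∧
      (∀ x ∈ t, IsInverseBranch d r f (e x) ∧ x ∈ (e x).source ∧
        (e x).source ⊆ (chartAt (Eu d) x).source) ∧
      (∀ x ∈ t, W ⊆ (e x).target) ∧ W ⊆ (chartAt (Eu d) y₀).source ∧
      (t : Set M).PairwiseDisjoint (fun x => (e x).source) ∧
      ∀ y ∈ W, f ⁻¹' {y} = (fun x => (e x).symm y) '' t := by
  classical
  choose e0 he0 hb0 using exists_isInverseBranch hr hf hbij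
  have hfin : (f ⁻¹' {y₀}).Finite := by
    have hcomp : IsCompact (f ⁻¹' {y₀}) := (isClosed_singleton.preimage hf.continuous).isCompact
    refine hcomp.finite ((isDiscrete_iff_forall_mem_exists_isOpen ..).2 fun x hx => ?_)
    refine ⟨(e0 x).source, (e0 x).open_source, ?_⟩
    ext z
    simp only [mem_inter_iff, mem_preimage, mem_singleton_iff]
    constructor
    · rintro ⟨hz, hz2⟩
      exact (e0 x).injOn hz (he0 x) (by rw [hb0 x |>.eqOn hz, hb0 x |>.eqOn (he0 x), hz2, hx])
    · rintro rfl
      exact ⟨he0 _, hx⟩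
  -- shrink the branches through the preimages of `y₀` until their domains are disjoint, and take
  -- `W` off the image of the compact set that these domains leave out
  obtain ⟨U, hU, hUd⟩ := hfin.t2_separation
  set O : M → Set M := fun x => U x ∩ (chartAt (Eu d) x).source with hOdef
  have hO : ∀ x, IsOpen (O x) := fun x => (hU x).2.inter (chartAt (Eu d) x).open_source
  set e : M → OpenPartialHomeomorph M M := fun x => (e0 x).restrOpen (O x) (hO x) with he
  have hb : ∀ x, IsInverseBranch d r f (e x) := fun x => (hb0 x).restr (hO x)
  have hsub : ∀ x, (e x).source ⊆ O x := fun x => by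
    rw [he]
    simp only [OpenPartialHomeomorph.restrOpen_source]
    exact inter_subset_right
  have hmem : ∀ x, x ∈ (e x).source := fun x => by
    rw [he]
    simp only [OpenPartialHomeomorph.restrOpen_source]
    exact ⟨he0 x, (hU x).1, mem_chart_source _ x⟩
  set t := hfin.toFinset with ht
  have htm : ∀ x, x ∈ t ↔ f x = y₀ := fun x => by simp [ht]
  have hKc : IsClosed (f '' (⋃ x ∈ t, (e x).source)ᶜ) :=
    ((isOpen_biUnion fun x _ => (e x).open_source).isClosed_compl.isCompact.image
      hf.continuous).isClosed
  refine ⟨t, e, (⋂ x ∈ t, (e x).target) ∩ (f '' (⋃ x ∈ t, (e x).source)ᶜ)ᶜ ∩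
    (chartAt (Eu d) y₀).source, ?_, ?_, ?_, ?_, inter_subset_right, ?_, ?_⟩
  · exact ((isOpen_biInter_finset fun x _ => (e x).open_target).inter hKc.isOpen_compl).inter
      (chartAt (Eu d) y₀).open_source
  · refine ⟨⟨?_, ?_⟩, mem_chart_source _ _⟩
    · simp only [mem_iInter]
      intro x hx
      have := (e x).map_source (hmem x)
      rwa [(hb x).eqOn (hmem x), (htm x).1 hx] at this
    · rintro ⟨x, hx, hxy⟩
      exact hx (mem_biUnion ((htm x).2 hxy) (hmem x))
  · exact fun x _ => ⟨hb x, hmem x, (hsub x).trans inter_subset_right⟩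
  · intro x hx y hy
    exact mem_iInter₂.1 hy.1.1 x hx
  · intro x hx x' hx' hne
    exact (hUd ((htm x).1 hx) ((htm x').1 hx') hne).mono ((hsub x).trans inter_subset_left)
      ((hsub x').trans inter_subset_left)
  · intro y hy
    have hy1 : ∀ x ∈ t, y ∈ (e x).target := fun x hx => mem_iInter₂.1 hy.1.1 x hx
    ext z
    simp only [mem_preimage, mem_singleton_iff, mem_image, Finset.mem_coe]
    constructor
    · intro hz
      have : z ∈ ⋃ x ∈ t, (e x).source := by
        by_contra h
        exact hy.1.2 ⟨z, h, hz⟩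
      obtain ⟨x, hx, hzx⟩ := mem_iUnion₂.1 this
      refine ⟨x, hx, ?_⟩
      rw [← hz, ← (hb x).eqOn hzx, (e x).left_inv hzx]
    · rintro ⟨x, hx, rfl⟩
      rw [← (hb x).eqOn ((e x).map_target (hy1 x hx)), (e x).right_inv (hy1 x hx)]

end LocalDiffeo

/-! ### The transfer operator of a local diffeomorphism -/

section Transfer

variable {d : ℕ} {M : Type*} [TopologicalSpace M] [ChartedSpace (Eu d) M]
  [IsManifold (𝓡 d) ∞ M] [T2Space M] [CompactSpace M]

theorem finite_fiber {r : ℕ} (hr : 1 ≤ r) {f : M → M} (hf : ContMDiff (𝓡 d) (𝓡 d) r f)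
    (hbij : ∀ x, Function.Bijective (mfderiv (𝓡 d) (𝓡 d) f x)) (y : M) :
    (f ⁻¹' {y}).Finite := by
  obtain ⟨t, e, W, -, hyW, -, -, -, -, h⟩ := exists_inverseBranches hr hf hbij y
  rw [h y hyW]
  exact t.finite_toSet.image _

theorem transfer_add (g : RiemMetric d M) {r : ℕ} (hr : 1 ≤ r) {f : M → M}
    (hf : ContMDiff (𝓡 d) (𝓡 d) r f)
    (hbij : ∀ x, Function.Bijective (mfderiv (𝓡 d) (𝓡 d) f x)) (ρ η : M → ℝ) (y : M) :
    transfer g f (ρ + η) y = transfer g f ρ y + transfer g f η y := by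
  unfold transfer
  rw [← finsum_mem_add_distrib (finite_fiber hr hf hbij y)]
  simp only [Pi.add_apply, add_div]

theorem transfer_smul (g : RiemMetric d M) {r : ℕ} (hr : 1 ≤ r) {f : M → M}
    (hf : ContMDiff (𝓡 d) (𝓡 d) r f)
    (hbij : ∀ x, Function.Bijective (mfderiv (𝓡 d) (𝓡 d) f x)) (c : ℝ) (ρ : M → ℝ) (y : M) :
    transfer g f (c • ρ) y = c * transfer g f ρ y := by
  unfold transfer
  rw [finsum_mem_eq_finite_toFinset_sum _ (finite_fiber hr hf hbij y),
    finsum_mem_eq_finite_toFinset_sum _ (finite_fiber hr hf hbij y), Finset.mul_sum]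
  simp only [Pi.smul_apply, smul_eq_mul, mul_div_assoc]

theorem transfer_eq_sum (g : RiemMetric d M) {f : M → M} {ρ : M → ℝ} {t : Finset M}
    {e : M → OpenPartialHomeomorph M M} {y : M}
    (hd : (t : Set M).PairwiseDisjoint (fun x => (e x).source))
    (hy : ∀ x ∈ t, y ∈ (e x).target) (h : f ⁻¹' {y} = (fun x => (e x).symm y) '' t) :
    transfer g f ρ y = ∑ x ∈ t, ρ ((e x).symm y) / jacobian g f ((e x).symm y) := by
  unfold transfer
  rw [h, finsum_mem_image, finsum_mem_coe_finset]
  intro x hx x' hx' hxx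
  by_contra hne
  have hxx' : (e x).symm y = (e x').symm y := hxx
  exact Set.disjoint_left.1 (hd hx hx' hne) ((e x).map_target (hy x hx))
    (hxx' ▸ (e x').map_target (hy x' hx'))

/-- The transfer operator of a `C^r` local diffeomorphism preserves `C^k` only for `k ≤ r - 1`,
because of the Jacobian in its definition. -/
theorem contMDiff_transfer (g : RiemMetric d M) {r : ℕ} (hr : 1 ≤ r) {f : M → M}
    (hf : ContMDiff (𝓡 d) (𝓡 d) r f)
    (hbij : ∀ x, Function.Bijective (mfderiv (𝓡 d) (𝓡 d) f x)) {k : ℕ}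
    (hk : k ≤ r - 1) {ρ : M → ℝ} (hρ : ContMDiff (𝓡 d) 𝓘(ℝ, ℝ) k ρ) :
    ContMDiff (𝓡 d) 𝓘(ℝ, ℝ) k (transfer g f ρ) := by
  intro y
  have hr0 : (r : ℕ∞ω) ≠ 0 := by exact_mod_cast (by omega : r ≠ 0)
  have hr3 : (k : ℕ∞ω) ≤ r := by exact_mod_cast (by omega : k ≤ r)
  obtain ⟨t, e, W, hWo, hyW, hb, hWt, -, hd, h⟩ := exists_inverseBranches hr hf hbij y
  have hJ := (contMDiff_jacobian g hr hf hbij).of_le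
    (show (k : ℕ∞ω) ≤ (r - 1 : ℕ) by exact_mod_cast hk)
  have hq : ContMDiff (𝓡 d) 𝓘(ℝ, ℝ) k (fun x => ρ x / jacobian g f x) :=
    hρ.div₀ hJ fun x => (jacobian_pos g ((hf x).mdifferentiableAt hr0) (hbij x)).ne'
  have h1 : ContMDiffOn (𝓡 d) 𝓘(ℝ, ℝ) k
      (fun y => ∑ x ∈ t, ρ ((e x).symm y) / jacobian g f ((e x).symm y)) W := by
    refine contMDiffOn_finsetSum fun x hx => ?_
    exact hq.comp_contMDiffOn (((hb x hx).1.contMDiffOn_symm.of_le hr3).mono (hWt x hx))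
  refine (h1.contMDiffAt (hWo.mem_nhds hyW)).congr_of_eventuallyEq ?_
  filter_upwards [hWo.mem_nhds hyW] with z hz
  exact transfer_eq_sum g hd (fun x hx => hWt x hx hz) (h z hz)

variable [MeasurableSpace M] [BorelSpace M] [SecondCountableTopology M]

omit [T2Space M] [CompactSpace M] in
/-- The area formula for the Riemannian measure, for an injective map between two charts. -/
theorem lintegral_image_riemMeasure (g : RiemMetric d M) {f : M → M} {p q : M} {S : Set M}
    (hS : MeasurableSet S) (hfS : MeasurableSet (f '' S)) (hp : S ⊆ (chartAt (Eu d) p).source)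
    (hq : f '' S ⊆ (chartAt (Eu d) q).source) (hinj : InjOn f S)
    (hdiff : ∀ x ∈ S, MDifferentiableAt (𝓡 d) (𝓡 d) f x) {F : M → ℝ≥0∞}
    (hF : AEMeasurable F ((riemMeasure g).restrict (f '' S)))
    (hF' : AEMeasurable (fun x => ENNReal.ofReal (jacobian g f x) * F (f x))
      ((riemMeasure g).restrict S)) :
    ∫⁻ y in f '' S, F y ∂(riemMeasure g) =
      ∫⁻ x in S, ENNReal.ofReal (jacobian g f x) * F (f x) ∂(riemMeasure g) := by
  rw [setLIntegral_riemMeasure g q hfS hq hF, setLIntegral_riemMeasure g p hS hp hF']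
  set e := chartAt (Eu d) p with he
  set e' := chartAt (Eu d) q with he'
  have hm := measurableSet_chart_preimage (d := d) p hS
  have hpre : ∀ (p : M) {S : Set M}, S ⊆ (chartAt (Eu d) p).source → (chartAt (Eu d) p).target ∩
      (chartAt (Eu d) p).symm ⁻¹' S = chartAt (Eu d) p '' S := fun p S hp =>
    ((chartAt (Eu d) p).image_eq_target_inter_inv_preimage hp).symm
  rw [hpre p hp] at hm
  rw [he', he, hpre q hq, hpre p hp, ← he, ← he']
  have him : e' '' (f '' S) = chartMap p q f '' (e '' S) := by
    rw [image_image, image_image]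
    refine image_congr fun x hx => ?_
    simp [chartMap, ← he, e.left_inv (hp hx), he']
  rw [him, lintegral_image_eq_lintegral_abs_det_fderiv_mul volume hm
    (f' := fun y => fderiv ℝ (chartMap p q f) y)]
  · refine setLIntegral_congr_fun hm ?_
    rintro _ ⟨x, hx, rfl⟩
    have hfx := hq (mem_image_of_mem f hx)
    dsimp only
    have h1 : e'.symm (chartMap p q f (e x)) = f x := by
      simp only [chartMap, Function.comp_apply, ← he, ← he']
      rw [e.left_inv (hp hx), e'.left_inv hfx]
    have h2 : chartMap p q f (e x) = e' (f x) := by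
      simp only [chartMap, Function.comp_apply, ← he, ← he']
      rw [e.left_inv (hp hx)]
    rw [h1, h2, e.left_inv (hp hx), jacobian_eq g (hp hx) hfx (hdiff x hx), ← mul_assoc,
      ← mul_assoc, ← ENNReal.ofReal_mul (abs_nonneg _), ← ENNReal.ofReal_mul
        (chartDensity_pos g (e.map_source (hp hx))).le]
    congr 2
    have := (chartDensity_pos g (e.map_source (hp hx))).ne'
    rw [← he, ← he', mul_div_cancel₀ _ this, mul_comm]
  · rintro _ ⟨x, hx, rfl⟩
    exact (tangentAt_comp_chartFrame (hp hx) (hq (mem_image_of_mem f hx))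
      (hdiff x hx)).1.hasFDerivAt.hasFDerivWithinAt
  · rintro _ ⟨x, hx, rfl⟩ _ ⟨x', hx', rfl⟩ h
    simp only [chartMap, Function.comp_apply, ← he, e.left_inv (hp hx),
      e.left_inv (hp hx')] at h
    rw [hinj hx hx' (e'.injOn (hq (mem_image_of_mem f hx)) (hq (mem_image_of_mem f hx')) h)]

/-- The transfer operator of `f` is dual to the composition with `f`. -/
theorem lintegral_transfer (g : RiemMetric d M) {r : ℕ} (hr : 1 ≤ r) {f : M → M}
    (hf : ContMDiff (𝓡 d) (𝓡 d) r f)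
    (hbij : ∀ x, Function.Bijective (mfderiv (𝓡 d) (𝓡 d) f x)) {ρ : M → ℝ}
    (hρ : Continuous ρ) (hρ0 : ∀ x, 0 ≤ ρ x) {η : M → ℝ≥0∞} (hη : Measurable η) :
    ∫⁻ y, ENNReal.ofReal (transfer g f ρ y) * η y ∂(riemMeasure g) =
      ∫⁻ x, ENNReal.ofReal (ρ x) * η (f x) ∂(riemMeasure g) := by
  have hr0 : (r : ℕ∞ω) ≠ 0 := by exact_mod_cast (by omega : r ≠ 0)
  have hdiff : ∀ z, MDifferentiableAt (𝓡 d) (𝓡 d) f z := fun z => (hf z).mdifferentiableAt hr0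
  have hJpos : ∀ x, 0 < jacobian g f x := fun x => jacobian_pos g (hdiff x) (hbij x)
  have hJc : Continuous (jacobian g f) := (contMDiff_jacobian g hr hf hbij).continuous
  have hfc := hf.continuous
  choose t e W hWo hyW hb hWt hWs hd h using exists_inverseBranches hr hf hbij
  -- the formula for functions `η` carried by a small set `B`
  have key : ∀ (y₀ : M) {B : Set M}, MeasurableSet B → B ⊆ W y₀ →
      ∫⁻ y in B, ENNReal.ofReal (transfer g f ρ y) * η y ∂(riemMeasure g) =
      ∫⁻ x in f ⁻¹' B, ENNReal.ofReal (ρ x) * η (f x) ∂(riemMeasure g) := by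
    intro y₀ B hB hBW
    set S : M → Set M := fun x => (e y₀ x).source ∩ f ⁻¹' B with hS
    have hSm : ∀ x, MeasurableSet (S x) := fun x =>
      (e y₀ x).open_source.measurableSet.inter (hfc.measurable hB)
    have himS : ∀ x ∈ t y₀, f '' S x = B := by
      intro x hx
      ext y
      constructor
      · rintro ⟨z, hz, rfl⟩
        exact hz.2
      · intro hy
        have hyt := hWt y₀ x hx (hBW hy)
        have h1 : f ((e y₀ x).symm y) = y := by
          rw [← (hb y₀ x hx).1.eqOn ((e y₀ x).map_target hyt), (e y₀ x).right_inv hyt]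
        exact ⟨(e y₀ x).symm y, ⟨(e y₀ x).map_target hyt, by rwa [mem_preimage, h1]⟩, h1⟩
    have hsymm : ∀ x ∈ t y₀, AEMeasurable (e y₀ x).symm ((riemMeasure g).restrict B) := by
      intro x hx
      exact ((e y₀ x).continuousOn_symm.mono (hBW.trans (hWt y₀ x hx))).aemeasurable hB
    have hFm : ∀ x ∈ t y₀, AEMeasurable (fun y => ENNReal.ofReal (ρ ((e y₀ x).symm y) /
        jacobian g f ((e y₀ x).symm y)) * η y) ((riemMeasure g).restrict B) := by
      intro x hx
      exact ((hρ.div hJc fun x => (hJpos x).ne').measurable.comp_aemeasurable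
        (hsymm x hx)).ennreal_ofReal.mul hη.aemeasurable
    calc ∫⁻ y in B, ENNReal.ofReal (transfer g f ρ y) * η y ∂(riemMeasure g)
        = ∫⁻ y in B, ∑ x ∈ t y₀, ENNReal.ofReal (ρ ((e y₀ x).symm y) /
            jacobian g f ((e y₀ x).symm y)) * η y ∂(riemMeasure g) := by
          refine setLIntegral_congr_fun hB fun y hy => ?_
          rw [transfer_eq_sum g (hd y₀) (fun x hx => hWt y₀ x hx (hBW hy)) (h y₀ y (hBW hy)),
            ENNReal.ofReal_sum_of_nonneg fun x _ => div_nonneg (hρ0 _) (hJpos _).le,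
            Finset.sum_mul]
      _ = ∑ x ∈ t y₀, ∫⁻ y in B, ENNReal.ofReal (ρ ((e y₀ x).symm y) /
            jacobian g f ((e y₀ x).symm y)) * η y ∂(riemMeasure g) :=
          lintegral_finsetSum' _ hFm
      _ = ∑ x ∈ t y₀, ∫⁻ z in S x, ENNReal.ofReal (ρ z) * η (f z) ∂(riemMeasure g) := by
          refine Finset.sum_congr rfl fun x hx => ?_
          have hpt : ∀ z ∈ S x, ENNReal.ofReal (jacobian g f z) * (ENNReal.ofReal
              (ρ ((e y₀ x).symm (f z)) / jacobian g f ((e y₀ x).symm (f z))) * η (f z)) =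
              ENNReal.ofReal (ρ z) * η (f z) := by
            intro z hz
            rw [← (hb y₀ x hx).1.eqOn hz.1, (e y₀ x).left_inv hz.1, ← mul_assoc,
              ← ENNReal.ofReal_mul (hJpos z).le, mul_div_cancel₀ _ (hJpos z).ne']
          have hm1 : AEMeasurable (fun z => ENNReal.ofReal (ρ z) * η (f z))
              ((riemMeasure g).restrict (S x)) :=
            (hρ.measurable.ennreal_ofReal.mul (hη.comp hfc.measurable)).aemeasurable
          have := lintegral_image_riemMeasure g (f := f) (p := x) (q := y₀) (hSm x)
            (by rw [himS x hx]; exact hB) (inter_subset_left.trans (hb y₀ x hx).2.2)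
            (by rw [himS x hx]; exact hBW.trans (hWs y₀)) (fun z hz z' hz' hzz => by
              rw [← (hb y₀ x hx).1.eqOn hz.1, ← (hb y₀ x hx).1.eqOn hz'.1] at hzz
              exact (e y₀ x).injOn hz.1 hz'.1 hzz) (fun z _ => hdiff z)
            (by rw [himS x hx]; exact hFm x hx)
            (hm1.congr ((ae_restrict_iff' (hSm x)).2
              (Eventually.of_forall fun z hz => (hpt z hz).symm)))
          rw [himS x hx] at this
          rw [this]
          exact setLIntegral_congr_fun (hSm x) hpt
      _ = ∫⁻ x in f ⁻¹' B, ENNReal.ofReal (ρ x) * η (f x) ∂(riemMeasure g) := by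
          rw [← lintegral_biUnion_finset (fun x hx x' hx' hne =>
            (hd y₀ hx hx' hne).mono inter_subset_left inter_subset_left) fun x _ => hSm x]
          congr 2
          ext z
          simp only [mem_iUnion, exists_prop, mem_inter_iff, mem_preimage]
          refine ⟨fun ⟨x, _, hz⟩ => hz.2, fun hz => ?_⟩
          have h1 : z ∈ f ⁻¹' {f z} := rfl
          rw [h y₀ (f z) (hBW hz)] at h1
          obtain ⟨x, hx, hxz⟩ := h1
          refine ⟨x, hx, ?_, hz⟩
          rw [← hxz]
          exact (e y₀ x).map_target (hWt y₀ x hx (hBW hz))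
  -- summation over a countable partition of `M` into small sets
  obtain ⟨s, hsc, hs⟩ := TopologicalSpace.countable_cover_nhds
    fun y : M => (hWo y).mem_nhds (hyW y)
  rcases isEmpty_or_nonempty M with hM | ⟨⟨x₀⟩⟩
  · simp
  have hne : s.Nonempty := by
    by_contra hcon
    rw [not_nonempty_iff_eq_empty] at hcon
    simp only [hcon, mem_empty_iff_false, iUnion_of_empty, iUnion_empty] at hs
    exact (hs ▸ mem_univ x₀ : x₀ ∈ (∅ : Set M))
  obtain ⟨u, rfl⟩ := hsc.exists_eq_range hne
  set B : ℕ → Set M := disjointed fun n => W (u n) with hBdef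
  have hBm : ∀ n, MeasurableSet (B n) :=
    MeasurableSet.disjointed fun n => (hWo (u n)).measurableSet
  have hBd : Pairwise fun i j => Disjoint (B i) (B j) := disjoint_disjointed _
  have hBU : ⋃ n, B n = univ := by rw [hBdef, iUnion_disjointed, ← hs, biUnion_range]
  rw [← setLIntegral_univ, ← hBU, lintegral_iUnion hBm hBd,
    tsum_congr fun n => key (u n) (hBm n) (disjointed_subset _ n),
    ← lintegral_iUnion (fun n => hfc.measurable (hBm n)) (fun i j hij => (hBd hij).preimage f),
    ← preimage_iUnion, hBU, preimage_univ, setLIntegral_univ]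

end Transfer

/-! ### The `C^r` topology: local diffeomorphisms form an open set -/

section OpenDiffLoc

variable {d : ℕ} {M : Type*} [TopologicalSpace M] [ChartedSpace (Eu d) M]

theorem bijective_iff_det_ne_zero (A : Eu d →L[ℝ] Eu d) : Function.Bijective A ↔ A.det ≠ 0 :=
  ⟨fun h => (LinearEquiv.isUnit_det' (LinearEquiv.ofBijective A.toLinearMap h)).ne_zero,
    fun h => (LinearMap.equivOfDetNeZero A.toLinearMap h).bijective⟩

theorem inCharts_eq_chartMap (p q : M) (f : M → M) : inCharts (𝓡 d) p q f = chartMap p q f := by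
  ext1 y
  simp [inCharts, chartMap]

theorem norm_fderiv_sub_le {E F : Type*} [NormedAddCommGroup E] [NormedSpace ℝ E]
    [NormedAddCommGroup F] [NormedSpace ℝ F] (f h : E → F) (y : E) :
    ‖fderiv ℝ h y - fderiv ℝ f y‖ ≤ ‖iteratedFDeriv ℝ 1 h y - iteratedFDeriv ℝ 1 f y‖ := by
  refine ContinuousLinearMap.opNorm_le_bound _ (norm_nonneg _) fun v => ?_
  have := (iteratedFDeriv ℝ 1 h y - iteratedFDeriv ℝ 1 f y).le_opNorm fun _ => v
  simpa using this

variable [IsManifold (𝓡 d) ∞ M] [T2Space M] [CompactSpace M]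

/-- Local diffeomorphisms form an open set, in particular a measurable one: the derivatives stay
invertible under a `C^1`-small perturbation, uniformly because `M` is compact. -/
theorem isOpen_diffLoc {r : ℕ} (hr : 1 ≤ r) : IsOpen (diffLoc d M r) := by
  rw [isOpen_iff_mem_nhds]
  intro φ hφ
  have hr0 : (r : ℕ∞ω) ≠ 0 := by exact_mod_cast (by omega : r ≠ 0)
  have hr1 : ((0 : ℕ) : ℕ∞ω) + 1 ≤ r := by exact_mod_cast hr
  have : LocallyCompactSpace M := ChartedSpace.locallyCompactSpace (Eu d) M
  have hdiff : ∀ (h : C^r⟮𝓡 d, M; 𝓡 d, M⟯) z, MDifferentiableAt (𝓡 d) (𝓡 d) h z :=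
    fun h z => (h.contMDiff z).mdifferentiableAt hr0
  have hlocal : ∀ x : M, ∃ K ∈ 𝓝 x, ∃ V ∈ 𝓝 φ, ∀ h ∈ V, ∀ z ∈ K,
      Function.Bijective (mfderiv (𝓡 d) (𝓡 d) h z) := by
    intro x
    set p := chartAt (Eu d) x with hp
    set q := chartAt (Eu d) (φ x) with hq
    set L := fderiv ℝ (chartMap x (φ x) φ) (p x) with hL
    have hLb : L.det ≠ 0 := (bijective_iff_det_ne_zero L).1 ((bijective_fderiv_chartMap
      (mem_chart_source _ x) (mem_chart_source _ _) (hdiff φ x)).2 (hφ x))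
    obtain ⟨ε, hε, hball⟩ := Metric.isOpen_iff.1
      (isOpen_ne.preimage (contDiff_det (d := d)).continuous) L hLb
    set O := p.target ∩ p.symm ⁻¹' (φ ⁻¹' q.source) with hOd
    have hO : IsOpen O :=
      p.isOpen_inter_preimage_symm (q.open_source.preimage φ.contMDiff.continuous)
    have hxO : p x ∈ O := ⟨p.map_source (mem_chart_source _ x), by simp [hp, hq]⟩
    have hcont : ContinuousAt (fun z => fderiv ℝ (chartMap x (φ x) φ) (p z)) x := by
      have h1 := ((contDiffOn_chartMap φ.contMDiff x (φ x)).fderiv_of_isOpen hO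
        hr1).continuousOn.continuousAt (hO.mem_nhds hxO)
      exact ContinuousAt.comp (f := p) h1 (p.continuousAt (mem_chart_source _ x))
    have hnhds : {z | z ∈ p.source ∧ φ z ∈ q.source ∧
        fderiv ℝ (chartMap x (φ x) φ) (p z) ∈ Metric.ball L (ε / 2)} ∈ 𝓝 x := by
      refine inter_mem (p.open_source.mem_nhds (mem_chart_source _ x))
        (inter_mem ((q.open_source.preimage φ.contMDiff.continuous).mem_nhds
          (mem_chart_source _ _)) (hcont (Metric.ball_mem_nhds _ (half_pos hε))))
    obtain ⟨K, hK, hKsub, hKc⟩ := local_compact_nhds hnhds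
    refine ⟨K, hK, ckBasicSet φ x (φ x) K (ε / 2), ?_, ?_⟩
    · have hopen : IsOpen (ckBasicSet φ x (φ x) K (ε / 2)) :=
        TopologicalSpace.isOpen_generateFrom_of_mem ⟨φ, x, φ x, K, ε / 2, hKc,
          fun z hz => (hKsub hz).1, fun z hz => (hKsub hz).2.1, half_pos hε, rfl⟩
      refine hopen.mem_nhds ?_
      have : φ ∈ ckBasicSet φ x (φ x) K (ε / 2) :=
        ⟨fun z hz => (hKsub hz).2.1, fun z _ j _ => by simpa using hε⟩
      exact this
    · intro h hh z hz
      have h1 := hh.2 z hz 1 (by exact_mod_cast hr)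
      rw [inCharts_eq_chartMap, inCharts_eq_chartMap, extChartAt_coe] at h1
      have h2 := (norm_fderiv_sub_le _ _ _).trans_lt h1
      have h3 := (hKsub hz).2.2
      rw [Metric.mem_ball] at h3
      have h4 : fderiv ℝ (chartMap x (φ x) h) (p z) ∈ Metric.ball L ε := by
        rw [← dist_eq_norm] at h2
        have h5 := dist_triangle (fderiv ℝ (chartMap x (φ x) h) (p z))
          (fderiv ℝ (chartMap x (φ x) φ) (p z)) L
        have h2' : dist (fderiv ℝ (chartMap x (φ x) h) (p z))
          (fderiv ℝ (chartMap x (φ x) φ) (p z)) < ε / 2 := h2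
        rw [Metric.mem_ball]
        linarith
      exact (bijective_fderiv_chartMap (hKsub hz).1 (hh.1 hz) (hdiff h z)).1
        ((bijective_iff_det_ne_zero _).2 (hball h4))
  choose K hK V hV hKV using hlocal
  obtain ⟨t, ht⟩ := CompactSpace.elim_nhds_subcover K hK
  refine mem_of_superset ((biInter_finset_mem t).2 fun x _ => hV x) fun h hh z => ?_
  have : z ∈ ⋃ x ∈ t, K x := by rw [ht]; trivial
  obtain ⟨x, hx, hzx⟩ := mem_iUnion₂.1 this
  exact hKV x h (mem_iInter₂.1 hh x hx) z hzx

end OpenDiffLoc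

/-! ### The norm of `C^k(M)` and the seminorms in charts -/

section CkNorm

variable {d : ℕ} {M : Type*} [TopologicalSpace M] [ChartedSpace (Eu d) M] {k : ℕ}

theorem inCharts_real (p : M) (q : ℝ) (f : M → ℝ) :
    inCharts 𝓘(ℝ, ℝ) p q f = f ∘ (chartAt (Eu d) p).symm := by
  rfl

theorem contDiffOn_comp_chart_symm [IsManifold (𝓡 d) ∞ M] {f : M → ℝ}
    (hf : ContMDiff (𝓡 d) 𝓘(ℝ, ℝ) k f) (p : M) :
    ContDiffOn ℝ k (f ∘ (chartAt (Eu d) p).symm) (chartAt (Eu d) p).target := by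
  have := isManifold_nat (d := d) (M := M) k
  exact (hf.comp_contMDiffOn (contMDiffOn_chart_symm (I := 𝓡 d) (x := p))).contDiffOn

/-- The seminorms of `C^k(M)` in charts are continuous for the norm. -/
theorem RandomMaps.CkNorm.exists_iteratedFDeriv_le [IsManifold (𝓡 d) ∞ M] (N : CkNorm d M k)
    (p : M) {K : Set M} (hK : IsCompact K) (hKp : K ⊆ (chartAt (Eu d) p).source) :
    ∃ C : ℝ, 0 ≤ C ∧ ∀ (ρ : N.Space), ∀ x ∈ K, ∀ j ≤ k,
      ‖iteratedFDeriv ℝ j (ρ ∘ (chartAt (Eu d) p).symm) (chartAt (Eu d) p x)‖ ≤ C * ‖ρ‖ := by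
  have hopen : IsOpen (ckBasicSet (0 : C^k⟮𝓡 d, M; ℝ⟯) p (0 : ℝ) K 1) :=
    TopologicalSpace.isOpen_generateFrom_of_mem ⟨0, p, 0, K, 1, hK, hKp,
      fun x _ => by simp, one_pos, rfl⟩
  obtain ⟨ε, hε, h⟩ := (N.isOpen_iff _).1 hopen 0 ⟨fun x _ => by simp, fun x _ j _ => by simp⟩
  have h1 : ∀ ρ : N.Space, ‖ρ‖ < ε → ∀ x ∈ K, ∀ j ≤ k,
      ‖iteratedFDeriv ℝ j (ρ ∘ (chartAt (Eu d) p).symm) (chartAt (Eu d) p x)‖ < 1 := by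
    intro ρ hρ x hx j hj
    have h2 := (h (show C^k⟮𝓡 d, M; ℝ⟯ from ρ) (by rw [sub_zero]; exact hρ)).2 x hx j
      (by exact_mod_cast hj)
    rw [inCharts_real, inCharts_real] at h2
    have h3 : ((0 : C^k⟮𝓡 d, M; ℝ⟯) : M → ℝ) ∘ (chartAt (Eu d) p).symm = fun _ => 0 := rfl
    rw [h3, iteratedFDeriv_fun_zero, Pi.zero_apply, sub_zero] at h2
    exact h2
  refine ⟨2 / ε, by positivity, fun ρ x hx j hj => ?_⟩
  set c : ℝ := ‖iteratedFDeriv ℝ j (ρ ∘ (chartAt (Eu d) p).symm) (chartAt (Eu d) p x)‖ with hc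
  have hsm : ∀ s : ℝ, ‖iteratedFDeriv ℝ j ((s • ρ : N.Space) ∘ (chartAt (Eu d) p).symm)
      (chartAt (Eu d) p x)‖ = |s| * c := by
    intro s
    have h4 : ((s • ρ : N.Space) : M → ℝ) ∘ (chartAt (Eu d) p).symm =
      s • (ρ ∘ (chartAt (Eu d) p).symm) := rfl
    have h5 : ContDiffAt ℝ j (ρ ∘ (chartAt (Eu d) p).symm) (chartAt (Eu d) p x) :=
      ((contDiffOn_comp_chart_symm (k := k) (ContMDiffMap.contMDiff
        (show C^k⟮𝓡 d, M; ℝ⟯ from ρ)) p).contDiffAt ((chartAt (Eu d) p).open_target.mem_nhds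
          ((chartAt (Eu d) p).map_source (hKp hx)))).of_le (by exact_mod_cast hj)
    rw [h4, iteratedFDeriv_const_smul_apply h5, norm_smul, Real.norm_eq_abs]
  rcases eq_or_ne ‖ρ‖ 0 with h0 | h0
  · have h6 : ρ = (0 : ℝ) • ρ := by rw [zero_smul]; exact norm_eq_zero.1 h0
    have h7 := hsm 0
    rw [← h6, abs_zero, zero_mul] at h7
    rw [hc, h7, h0, mul_zero]
  · have hpos : 0 < ‖ρ‖ := lt_of_le_of_ne (norm_nonneg _) (Ne.symm h0)
    have h6 := h1 ((ε / (2 * ‖ρ‖)) • ρ) (by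
      rw [norm_smul, Real.norm_of_nonneg (by positivity)]
      field_simp
      linarith) x hx j hj
    rw [hsm, abs_of_pos (by positivity), div_mul_eq_mul_div, div_lt_one (by positivity)] at h6
    rw [div_mul_eq_mul_div, le_div_iff₀ hε]
    linarith

/-- The unit ball of `C^k(M)` contains all the functions that are small for finitely many of the
seminorms in charts. -/
theorem RandomMaps.CkNorm.exists_norm_lt_one [IsManifold (𝓡 d) ∞ M] (N : CkNorm d M k) :
    ∃ T : Set (M × Set M), T.Finite ∧
      (∀ z ∈ T, IsCompact z.2 ∧ z.2 ⊆ (chartAt (Eu d) z.1).source) ∧ ∃ δ : ℝ, 0 < δ ∧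
      ∀ ρ : N.Space, (∀ z ∈ T, ∀ x ∈ z.2, ∀ j ≤ k,
        ‖iteratedFDeriv ℝ j (ρ ∘ (chartAt (Eu d) z.1).symm) (chartAt (Eu d) z.1 x)‖ < δ) →
        ‖ρ‖ < 1 := by
  have hopen : IsOpen {ρ : C^k⟮𝓡 d, M; ℝ⟯ | N.toSeminorm ρ < 1} := by
    rw [N.isOpen_iff]
    intro ρ hρ
    refine ⟨1 - N.toSeminorm ρ, sub_pos.2 hρ, fun η hη => ?_⟩
    have := map_add_le_add N.toSeminorm (η - ρ) ρ
    rw [sub_add_cancel] at this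
    rw [mem_ofPred_eq]
    linarith
  -- every open set that contains `0` has this property, by induction over the generated topology
  have key : ∀ S : Set C^k⟮𝓡 d, M; ℝ⟯, IsOpen S → 0 ∈ S → ∃ T : Set (M × Set M), T.Finite ∧
      (∀ z ∈ T, IsCompact z.2 ∧ z.2 ⊆ (chartAt (Eu d) z.1).source) ∧ ∃ δ : ℝ, 0 < δ ∧
      ∀ ρ : C^k⟮𝓡 d, M; ℝ⟯, (∀ z ∈ T, ∀ x ∈ z.2, ∀ j ≤ k,
        ‖iteratedFDeriv ℝ j (ρ ∘ (chartAt (Eu d) z.1).symm) (chartAt (Eu d) z.1 x)‖ < δ) →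
        ρ ∈ S := by
    intro S hS
    induction hS with
    | basic S hS =>
      intro h0
      obtain ⟨f, p, q, K, ε, hK, hKp, -, hε, rfl⟩ := hS
      set e := chartAt (Eu d) p with he
      have hfc := contDiffOn_comp_chart_symm f.contMDiff p
      have hcont : ∀ j ≤ k, ContinuousOn
          (fun x => ‖iteratedFDeriv ℝ j (f ∘ e.symm) (e x)‖) K := by
        intro j hj x hx
        have h1 : ContinuousAt (iteratedFDeriv ℝ j (f ∘ e.symm)) (e x) := by
          have h2 : ContDiffAt ℝ k (f ∘ e.symm) (e x) :=
            hfc.contDiffAt (e.open_target.mem_nhds (e.map_source (hKp hx)))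
          exact h2.continuousAt_iteratedFDeriv (by exact_mod_cast hj)
        exact (ContinuousAt.comp (f := e) h1 (e.continuousAt (hKp hx))).norm.continuousWithinAt
      have hlt : ∀ j ≤ k, ∀ x ∈ K, ‖iteratedFDeriv ℝ j (f ∘ e.symm) (e x)‖ < ε := by
        intro j hj x hx
        have h2 := h0.2 x hx j (by exact_mod_cast hj)
        rw [inCharts_real, inCharts_real] at h2
        have h3 : ((0 : C^k⟮𝓡 d, M; ℝ⟯) : M → ℝ) ∘ (chartAt (Eu d) p).symm = fun _ => 0 := rfl
        rw [h3, iteratedFDeriv_fun_zero, Pi.zero_apply, zero_sub, norm_neg] at h2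
        exact h2
      -- a basic set around `f` contains `0` if the derivatives of `f` are less than `ε` on `K`;
      -- by compactness, some room `δ` is left
      have hmax : ∀ j ≤ k, ∃ δ > 0, ∀ x ∈ K,
          ‖iteratedFDeriv ℝ j (f ∘ e.symm) (e x)‖ + δ ≤ ε := by
        intro j hj
        rcases K.eq_empty_or_nonempty with rfl | hne
        · exact ⟨1, one_pos, by simp⟩
        · obtain ⟨x₀, hx₀, hmx⟩ := hK.exists_isMaxOn hne (hcont j hj)
          refine ⟨ε - ‖iteratedFDeriv ℝ j (f ∘ e.symm) (e x₀)‖, sub_pos.2 (hlt j hj x₀ hx₀),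
            fun x hx => ?_⟩
          have : ‖iteratedFDeriv ℝ j (f ∘ e.symm) (e x)‖ ≤
            ‖iteratedFDeriv ℝ j (f ∘ e.symm) (e x₀)‖ := hmx hx
          linarith
      choose! δ hδ hδK using hmax
      obtain ⟨j₀, hj₀, hmin⟩ := (Finset.range (k + 1)).exists_min_image δ ⟨0, by simp⟩
      refine ⟨{(p, K)}, finite_singleton _, by rintro _ rfl; exact ⟨hK, hKp⟩, δ j₀,
        hδ j₀ (by simpa [Nat.lt_succ_iff] using hj₀), fun ρ hρ => ⟨fun x _ => mem_univ _,
        fun x hx j hj => ?_⟩⟩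
      have hj' : j ≤ k := by exact_mod_cast hj
      rw [inCharts_real, inCharts_real]
      have h4 := hρ (p, K) rfl x hx j hj'
      have h5 := hδK j hj' x hx
      have h6 := hmin j (by simpa [Nat.lt_succ_iff] using hj')
      refine (norm_sub_le _ _).trans_lt ?_
      simp only at h4
      rw [extChartAt_coe]
      have h4' : ‖iteratedFDeriv ℝ j (ρ ∘ e.symm) (e x)‖ < δ j₀ := h4
      have : ‖iteratedFDeriv ℝ j (ρ ∘ e.symm) (e x)‖ +
          ‖iteratedFDeriv ℝ j (f ∘ e.symm) (e x)‖ < ε := by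
        linarith
      exact this
    | univ => exact fun _ => ⟨∅, finite_empty, by simp, 1, one_pos, fun _ _ => trivial⟩
    | inter S S' _ _ ih ih' =>
      intro h0
      obtain ⟨T, hT, hTK, δ, hδ, h⟩ := ih h0.1
      obtain ⟨T', hT', hTK', δ', hδ', h'⟩ := ih' h0.2
      refine ⟨T ∪ T', hT.union hT', fun z hz => hz.elim (hTK z) (hTK' z), min δ δ',
        lt_min hδ hδ', fun ρ hρ => ⟨h ρ fun z hz x hx j hj => ?_, h' ρ fun z hz x hx j hj => ?_⟩⟩
      · exact (hρ z (Or.inl hz) x hx j hj).trans_le (min_le_left _ _)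
      · exact (hρ z (Or.inr hz) x hx j hj).trans_le (min_le_right _ _)
    | sUnion 𝒮 _ ih =>
      rintro ⟨S, hS, h0⟩
      obtain ⟨T, hT, hTK, δ, hδ, h⟩ := ih S hS h0
      exact ⟨T, hT, hTK, δ, hδ, fun ρ hρ => ⟨S, hS, h ρ hρ⟩⟩
  exact key _ hopen (show N.toSeminorm 0 < 1 by rw [map_zero]; exact one_pos)

end CkNorm

/-! ### Smoothness of integrals depending on a parameter -/

section ParametricIntegral

variable {α : Type*} [MeasurableSpace α] {ν : Measure α} {d : ℕ} {U : Set (Eu d)}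

/-- A family that is continuous in the parameter and bounded by a function with finite (lower)
integral is dominated by an integrable function; the given bound itself need not be measurable. -/
theorem exists_integrable_bound {G : Type*} [NormedAddCommGroup G] {H : Eu d → α → G}
    (hc : ∀ᵐ a ∂ν, ContinuousOn (H · a) U)
    (hm : ∀ y ∈ U, AEStronglyMeasurable (H y) ν) {C : α → ℝ≥0∞} (hC : ∫⁻ a, C a ∂ν < ⊤)
    (hb : ∀ᵐ a ∂ν, ∀ y ∈ U, ‖H y a‖ₑ ≤ C a) :
    ∃ bound : α → ℝ, Integrable bound ν ∧ ∀ᵐ a ∂ν, ∀ y ∈ U, ‖H y a‖ ≤ bound a := by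
  obtain ⟨D, hDU, hDc, hUD⟩ :=
    (TopologicalSpace.IsSeparable.of_separableSpace U).exists_countable_dense_subset
  have := hDc.to_subtype
  set B : α → ℝ≥0∞ := fun a => ⨆ y : D, ‖H y a‖ₑ with hB
  have hBm : AEMeasurable B ν := AEMeasurable.iSup fun y => (hm y (hDU y.2)).enorm
  have hBi : ∫⁻ a, B a ∂ν < ⊤ := (lintegral_mono_ae (by
    filter_upwards [hb] with a ha
    exact iSup_le fun y => ha y (hDU y.2))).trans_lt hC
  refine ⟨fun a => (B a).toReal, integrable_toReal_of_lintegral_ne_top hBm hBi.ne, ?_⟩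
  filter_upwards [hc, ae_lt_top' hBm hBi.ne] with a hca hfin y hy
  have h1 : ‖H y a‖ₑ ∈ Iic (B a) := by
    rw [← isClosed_Iic.closure_eq]
    exact ((hca.enorm y hy).mono hDU).mem_closure (hUD hy)
      fun z hz => le_iSup (fun y : D => ‖H y a‖ₑ) ⟨z, hz⟩
  rw [← toReal_enorm]
  exact ENNReal.toReal_mono hfin.ne h1

theorem aestronglyMeasurable_clm {G : Type*} [NormedAddCommGroup G] [NormedSpace ℝ G]
    {L : α → Eu d →L[ℝ] G} (h : ∀ v, AEStronglyMeasurable (fun a => L a v) ν) :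
    AEStronglyMeasurable L ν := by
  have h1 : L = fun a => ∑ i, ContinuousLinearMap.smulRightL ℝ (Eu d) G
      (EuclideanSpace.proj i) (L a (stdVec i)) := by
    funext a
    ext1 v
    conv_lhs => rw [eu_eq_sum_stdVec v]
    simp
  rw [h1]
  exact Finset.aestronglyMeasurable_fun_sum _ fun i _ =>
    (ContinuousLinearMap.continuous _).comp_aestronglyMeasurable (h (stdVec i))

/-- The derivative in the parameter is measurable, as a limit of difference quotients. -/
theorem aestronglyMeasurable_fderiv {G : Type*} [NormedAddCommGroup G] [NormedSpace ℝ G]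
    (hU : IsOpen U) {F : Eu d → α → G} (hm : ∀ y ∈ U, AEStronglyMeasurable (F y) ν)
    (hd : ∀ᵐ a ∂ν, DifferentiableOn ℝ (F · a) U) {y : Eu d} (hy : y ∈ U) :
    AEStronglyMeasurable (fun a => fderiv ℝ (F · a) y) ν := by
  refine aestronglyMeasurable_clm fun v => ?_
  have h1 : Tendsto (fun n : ℕ => y + ((n : ℝ))⁻¹ • v) atTop (𝓝 y) := by
    have := (tendsto_inv_atTop_nhds_zero_nat (𝕜 := ℝ)).smul_const v
    simpa using this.const_add y
  obtain ⟨m, hmU⟩ := eventually_atTop.1 (h1.eventually (hU.mem_nhds hy))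
  refine aestronglyMeasurable_of_tendsto_ae atTop
    (f := fun (n : ℕ) a => ((n + m : ℕ) : ℝ) • (F (y + (((n + m : ℕ) : ℝ))⁻¹ • v) a - F y a))
    (fun n => ((hm _ (hmU _ (Nat.le_add_left _ _))).sub (hm y hy)).const_smul _) ?_
  filter_upwards [hd] with a ha
  have h2 := ((ha y hy).differentiableAt (hU.mem_nhds hy)).hasFDerivAt.lim_real v
  exact h2.comp (tendsto_natCast_atTop_atTop.comp (tendsto_add_atTop_nat m))

/-- Differentiation under the integral sign, up to order `k`, with a bound of the derivatives. -/
theorem contDiffOn_integral (hU : IsOpen U) {C : α → ℝ≥0∞} (hC : ∫⁻ a, C a ∂ν < ⊤) (k : ℕ) :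
    ∀ {G : Type} [NormedAddCommGroup G] [NormedSpace ℝ G] [CompleteSpace G]
    {F : Eu d → α → G}, (∀ᵐ a ∂ν, ContDiffOn ℝ k (F · a) U) →
    (∀ y ∈ U, AEStronglyMeasurable (F y) ν) →
    (∀ᵐ a ∂ν, ∀ j ≤ k, ∀ y ∈ U, ‖iteratedFDeriv ℝ j (F · a) y‖ₑ ≤ C a) →
    ContDiffOn ℝ k (fun y => ∫ a, F y a ∂ν) U ∧ ∀ j ≤ k, ∀ y ∈ U,
      ‖iteratedFDeriv ℝ j (fun y => ∫ a, F y a ∂ν) y‖ₑ ≤ ∫⁻ a, C a ∂ν := by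
  have hzero : ∀ {G : Type} [NormedAddCommGroup G] [NormedSpace ℝ G]
      {f : Eu d → G} {y : Eu d}, ‖iteratedFDeriv ℝ 0 f y‖ₑ = ‖f y‖ₑ := by
    intro G _ _ f y
    rw [← ofReal_norm, ← ofReal_norm, norm_iteratedFDeriv_zero]
  have hbase : ∀ {G : Type} [NormedAddCommGroup G] [NormedSpace ℝ G]
      {F : Eu d → α → G} {y : Eu d}, (∀ᵐ a ∂ν, ‖F y a‖ₑ ≤ C a) →
      ‖iteratedFDeriv ℝ 0 (fun y => ∫ a, F y a ∂ν) y‖ₑ ≤ ∫⁻ a, C a ∂ν := by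
    intro G _ _ F y h
    rw [hzero]
    exact (enorm_integral_le_lintegral_enorm _).trans (lintegral_mono_ae h)
  induction k with
  | zero =>
    intro G _ _ _ F hF hm hb
    have hb' : ∀ᵐ a ∂ν, ∀ y ∈ U, ‖F y a‖ₑ ≤ C a := by
      filter_upwards [hb] with a ha y hy
      rw [← hzero (f := (F · a))]
      exact ha 0 le_rfl y hy
    have hcont : ∀ᵐ a ∂ν, ContinuousOn (F · a) U := hF.mono fun a ha => ha.continuousOn
    obtain ⟨bound, hbi, hbd⟩ := exists_integrable_bound hcont hm hC hb'
    refine ⟨?_, fun j hj y hy => ?_⟩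
    · rw [Nat.cast_zero, contDiffOn_zero]
      exact continuousOn_of_dominated hm (fun y hy => hbd.mono fun a ha => ha y hy) hbi hcont
    · rw [Nat.le_zero.1 hj]
      exact hbase (hb'.mono fun a ha => ha y hy)
  | succ k ih =>
    intro G _ _ _ F hF hm hb
    have hb' : ∀ᵐ a ∂ν, ∀ y ∈ U, ‖F y a‖ₑ ≤ C a := by
      filter_upwards [hb] with a ha y hy
      rw [← hzero (f := (F · a))]
      exact ha 0 (Nat.zero_le _) y hy
    have hF1 : ∀ᵐ a ∂ν, DifferentiableOn ℝ (F · a) U ∧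
        ContDiffOn ℝ k (fun y => fderiv ℝ (F · a) y) U := by
      filter_upwards [hF] with a ha
      rw [Nat.cast_succ, contDiffOn_succ_iff_fderiv_of_isOpen hU] at ha
      exact ⟨ha.1, ha.2.2⟩
    have hm' : ∀ y ∈ U, AEStronglyMeasurable (fun a => fderiv ℝ (F · a) y) ν := fun y hy =>
      aestronglyMeasurable_fderiv hU hm (hF1.mono fun a ha => ha.1) hy
    have hbk : ∀ᵐ a ∂ν, ∀ j ≤ k, ∀ y ∈ U,
        ‖iteratedFDeriv ℝ j (fun y => fderiv ℝ (F · a) y) y‖ₑ ≤ C a := by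
      filter_upwards [hb] with a ha j hj y hy
      rw [← ofReal_norm, norm_iteratedFDeriv_fderiv (f := (F · a)), ofReal_norm]
      exact ha (j + 1) (by omega) y hy
    obtain ⟨ih1, ih2⟩ := ih (F := fun y a => fderiv ℝ (F · a) y) (hF1.mono fun a ha => ha.2)
      hm' hbk
    obtain ⟨bound, hbi, hbd⟩ := exists_integrable_bound (H := fun y a => fderiv ℝ (F · a) y)
      (hF1.mono fun a ha => ha.2.continuousOn) hm' hC (by
        filter_upwards [hbk] with a ha y hy
        rw [← hzero (f := fun y => fderiv ℝ (F · a) y)]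
        exact ha 0 (Nat.zero_le _) y hy)
    have hder : ∀ y ∈ U, HasFDerivAt (fun y => ∫ a, F y a ∂ν)
        (∫ a, fderiv ℝ (F · a) y ∂ν) y := by
      intro y hy
      refine hasFDerivAt_integral_of_dominated_of_fderiv_le (F' := fun y a => fderiv ℝ (F · a) y)
        (hU.mem_nhds hy)
        (eventually_of_mem (hU.mem_nhds hy) hm) ⟨hm y hy, ?_⟩ (hm' y hy) hbd hbi ?_
      · exact (lintegral_mono_ae (hb'.mono fun a ha => ha y hy)).trans_lt hC
      · filter_upwards [hF1] with a ha z hz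
        exact ((ha.1 z hz).differentiableAt (hU.mem_nhds hz)).hasFDerivAt
    refine ⟨?_, fun j hj y hy => ?_⟩
    · rw [Nat.cast_succ, contDiffOn_succ_iff_fderiv_of_isOpen hU]
      refine ⟨fun y hy => (hder y hy).differentiableAt.differentiableWithinAt,
        fun h => absurd h (by simp), ih1.congr fun y hy => (hder y hy).fderiv⟩
    · rcases j with _ | j
      · exact hbase (hb'.mono fun a ha => ha y hy)
      · have he : fderiv ℝ (fun y => ∫ a, F y a ∂ν) =ᶠ[𝓝 y]
            fun y => ∫ a, fderiv ℝ (F · a) y ∂ν :=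
          eventually_of_mem (hU.mem_nhds hy) fun z hz => (hder z hz).fderiv
        rw [← ofReal_norm, ← norm_iteratedFDeriv_fderiv,
          (Filter.EventuallyEq.iteratedFDeriv ℝ he j).eq_of_nhds, ofReal_norm]
        exact ih2 j (by omega) y hy

end ParametricIntegral

/-! ### Measurability of the transfer operator in the map, and its average -/

section AvgTransfer

variable {d : ℕ} {M : Type*} [TopologicalSpace M] [ChartedSpace (Eu d) M]
  [IsManifold (𝓡 d) ∞ M] [T2Space M] [CompactSpace M] [SecondCountableTopology M]
  [MeasurableSpace M] [BorelSpace M] {r : ℕ}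

theorem isFiniteMeasure_riemMeasure (g : RiemMetric d M) : IsFiniteMeasure (riemMeasure g) :=
  have := isLocallyFiniteMeasure_riemMeasure g
  ⟨isCompact_univ.measure_lt_top⟩

theorem continuous_transfer (g : RiemMetric d M) (hr : 1 ≤ r) {φ : C^r⟮𝓡 d, M; 𝓡 d, M⟯}
    (hφ : φ ∈ diffLoc d M r) {ρ : M → ℝ} (hρ : Continuous ρ) : Continuous (transfer g φ ρ) :=
  (contMDiff_transfer g hr φ.contMDiff hφ (Nat.zero_le _)
    (contMDiff_zero_iff.2 hρ)).continuous

theorem transfer_nonneg (g : RiemMetric d M) (f : M → M) {ρ : M → ℝ} (hρ : ∀ x, 0 ≤ ρ x) (y : M) :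
    0 ≤ transfer g f ρ y :=
  finsum_nonneg fun x => finsum_nonneg fun _ => div_nonneg (hρ x) (Real.sqrt_nonneg _)

/-- The average of a function over small neighbourhoods of `y` converges to its value at `y`. -/
theorem tendsto_average_of_continuous {X : Type*} [TopologicalSpace X] [MeasurableSpace X]
    {m : Measure X} {F : X → ℝ≥0∞} (hF : Continuous F) {y : X} {B : ℕ → Set X}
    (hB : (𝓝 y).HasAntitoneBasis B) (hBm : ∀ n, MeasurableSet (B n)) (hB0 : ∀ n, m (B n) ≠ 0)
    (hBt : ∀ n, m (B n) ≠ ⊤) :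
    Tendsto (fun n => (∫⁻ x in B n, F x ∂m) / m (B n)) atTop (𝓝 (F y)) := by
  rw [tendsto_order]
  constructor
  · intro c hc
    obtain ⟨c', hcc', hc'⟩ := exists_between hc
    have h1 := (hF.continuousAt (x := y)).eventually (lt_mem_nhds hc')
    filter_upwards [hB.eventually_subset h1] with n hn
    refine hcc'.trans_le ?_
    rw [ENNReal.le_div_iff_mul_le (Or.inl (hB0 n)) (Or.inl (hBt n)), ← setLIntegral_const]
    exact setLIntegral_mono' (hBm n) fun x hx => (show c' < F x from hn hx).le
  · intro c hc
    obtain ⟨c', hc', hcc'⟩ := exists_between hc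
    have h1 := (hF.continuousAt (x := y)).eventually (gt_mem_nhds hc')
    filter_upwards [hB.eventually_subset h1] with n hn
    refine lt_of_le_of_lt ?_ hcc'
    rw [ENNReal.div_le_iff (hB0 n) (hBt n), ← setLIntegral_const]
    exact setLIntegral_mono' (hBm n) fun x hx => (show F x < c' from hn hx).le

theorem measurable_eval : Measurable fun z : M × C^r⟮𝓡 d, M; 𝓡 d, M⟯ => z.2 z.1 :=
  continuous_eval.measurable

/-- Measurability of `φ ↦ L_φ ρ (y)` on the set of local diffeomorphisms. -/
theorem measurable_indicator_transfer_of_nonneg (g : RiemMetric d M) (hr : 1 ≤ r) {ρ : M → ℝ}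
    (hρ : Continuous ρ) (hρ0 : ∀ x, 0 ≤ ρ x) (y : M) :
    Measurable ((diffLoc d M r).indicator fun φ => transfer g φ ρ y) := by
  have := isFiniteMeasure_riemMeasure g
  have := isOpenPosMeasure_riemMeasure g
  have hDm : MeasurableSet (diffLoc d M r) := (isOpen_diffLoc hr).measurableSet
  obtain ⟨B, hBo, hB⟩ := (nhds_basis_opens y).exists_antitone_subbasis
  have hBm : ∀ n, MeasurableSet (B n) := fun n => (hBo n).2.measurableSet
  -- the value at `y` is the limit of the averages of `transfer g φ ρ` near `y`, and
  -- these averages are integrals of `ρ` over `φ⁻¹ (B n)`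
  set I : ℕ → C^r⟮𝓡 d, M; 𝓡 d, M⟯ → ℝ≥0∞ := fun n φ =>
    (∫⁻ x, ENNReal.ofReal (ρ x) * (B n).indicator 1 (φ x) ∂(riemMeasure g)) / riemMeasure g (B n)
    with hI
  have hIm : ∀ n, Measurable (I n) := by
    intro n
    refine Measurable.div_const (Measurable.lintegral_prod_right'
      (f := fun z : C^r⟮𝓡 d, M; 𝓡 d, M⟯ × M =>
        ENNReal.ofReal (ρ z.2) * (B n).indicator 1 (z.1 z.2)) ?_) _
    exact (hρ.measurable.comp measurable_snd).ennreal_ofReal.mul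
      ((measurable_one.indicator (hBm n)).comp (measurable_eval.comp measurable_swap))
  have hlim : ∀ φ ∈ diffLoc d M r, Tendsto (fun n => I n φ) atTop
      (𝓝 (ENNReal.ofReal (transfer g φ ρ y))) := by
    intro φ hφ
    have h1 := tendsto_average_of_continuous (m := riemMeasure g)
      (ENNReal.continuous_ofReal.comp (continuous_transfer g hr hφ hρ)) hB hBm
      (fun n => (hBo n).2.measure_ne_zero _ ⟨y, (hBo n).1⟩) (fun n => measure_ne_top _ _)
    refine h1.congr fun n => ?_
    rw [hI]
    dsimp only
    rw [← lintegral_transfer g hr φ.contMDiff hφ hρ hρ0 (measurable_one.indicator (hBm n)),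
      ← lintegral_indicator (hBm n)]
    congr 2
    funext x
    by_cases hx : x ∈ B n <;> simp [hx]
  have hm : Measurable ((diffLoc d M r).indicator fun φ => ENNReal.ofReal (transfer g φ ρ y)) := by
    refine measurable_of_tendsto_metrizable (f := fun n => (diffLoc d M r).indicator (I n))
      (fun n => (hIm n).indicator hDm) (tendsto_pi_nhds.2 fun φ => ?_)
    by_cases hφ : φ ∈ diffLoc d M r
    · simpa [hφ] using hlim φ hφ
    · simp [hφ]
  convert hm.ennreal_toReal using 1
  funext φ
  by_cases hφ : φ ∈ diffLoc d M r
  · simp [hφ, transfer_nonneg g φ hρ0 y]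
  · simp [hφ]

theorem transfer_eq_posPart_sub_negPart (g : RiemMetric d M) (hr : 1 ≤ r)
    {φ : C^r⟮𝓡 d, M; 𝓡 d, M⟯} (hφ : φ ∈ diffLoc d M r) (ρ : M → ℝ) (y : M) :
    transfer g φ ρ y = transfer g φ (fun x => max (ρ x) 0) y -
      transfer g φ (fun x => max (-ρ x) 0) y := by
  rw [eq_sub_iff_add_eq, ← transfer_add g hr φ.contMDiff hφ]
  congr 1
  funext x
  simp only [Pi.add_apply]
  rcases le_total (ρ x) 0 with h | h
  · rw [max_eq_right h, max_eq_left (neg_nonneg.2 h)]; ring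
  · rw [max_eq_left h, max_eq_right (neg_nonpos.2 h)]; ring

theorem measurable_indicator_transfer (g : RiemMetric d M) (hr : 1 ≤ r) {ρ : M → ℝ}
    (hρ : Continuous ρ) (y : M) :
    Measurable ((diffLoc d M r).indicator fun φ => transfer g φ ρ y) := by
  have h := (measurable_indicator_transfer_of_nonneg g hr (hρ.max continuous_const)
    (fun x => le_max_right _ _) y).sub (measurable_indicator_transfer_of_nonneg g hr
      (hρ.neg.max continuous_const) (fun x => le_max_right _ _) y)
  convert h using 1
  funext φ
  by_cases hφ : φ ∈ diffLoc d M r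
  · simp [hφ, transfer_eq_posPart_sub_negPart g hr hφ ρ y]
  · simp [hφ]

theorem aestronglyMeasurable_transfer (g : RiemMetric d M) (hr : 1 ≤ r)
    (ν : Measure C^r⟮𝓡 d, M; 𝓡 d, M⟯) {ρ : M → ℝ} (hρ : Continuous ρ) (y : M) :
    AEStronglyMeasurable (fun φ : C^r⟮𝓡 d, M; 𝓡 d, M⟯ => transfer g φ ρ y)
      (ν.restrict (diffLoc d M r)) :=
  ((measurable_indicator_transfer g hr hρ y).aestronglyMeasurable).congr
    (indicator_ae_eq_restrict (isOpen_diffLoc hr).measurableSet)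

variable (N : CkNorm d M (r - 1))

theorem RandomMaps.CkNorm.Space.contMDiff {N : CkNorm d M (r - 1)} (ρ : N.Space) :
    ContMDiff (𝓡 d) 𝓘(ℝ, ℝ) (r - 1 : ℕ) ρ :=
  ContMDiffMap.contMDiff (show C^(r - 1 : ℕ)⟮𝓡 d, M; ℝ⟯ from ρ)

/-- The function `transfer g φ ρ` as an element of the Banach space `C^{r-1}(M)`. -/
def transferCk (g : RiemMetric d M) (hr : 1 ≤ r) (φ : C^r⟮𝓡 d, M; 𝓡 d, M⟯)
    (hφ : φ ∈ diffLoc d M r) (ρ : N.Space) : N.Space :=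
  (⟨transfer g φ ρ, contMDiff_transfer g hr φ.contMDiff hφ le_rfl ρ.contMDiff⟩ :
    C^(r - 1 : ℕ)⟮𝓡 d, M; ℝ⟯)

theorem enorm_transferCk_le (g : RiemMetric d M) (hr : 1 ≤ r) (φ : C^r⟮𝓡 d, M; 𝓡 d, M⟯)
    (hφ : φ ∈ diffLoc d M r) (ρ : N.Space) :
    ‖transferCk N g hr φ hφ ρ‖ₑ ≤ N.opENorm (transfer g φ) * ‖ρ‖ₑ := by
  have hsmul : ∀ (c : ℝ) (η : N.Space),
      transferCk N g hr φ hφ (c • η) = c • transferCk N g hr φ hφ η := fun c η =>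
    DFunLike.ext _ _ fun y => transfer_smul g hr φ.contMDiff hφ c η y
  have hone : ∀ η : N.Space, ‖η‖ ≤ 1 → ‖transferCk N g hr φ hφ η‖ₑ ≤ N.opENorm (transfer g φ) := by
    intro η hη
    refine le_trans (le_of_eq ?_) (le_iSup₂ (f := fun (ρ : N.Space) (_ : ‖ρ‖ ≤ 1) =>
      N.eNorm (transfer g φ ρ)) η hη)
    unfold CkNorm.eNorm
    symm
    exact dif_pos (contMDiff_transfer g hr φ.contMDiff hφ le_rfl η.contMDiff)
  rcases eq_or_ne ρ 0 with rfl | h0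
  · have h1 := hsmul 0 0
    rw [zero_smul, zero_smul] at h1
    simp [h1]
  · have hpos : 0 < ‖ρ‖ := norm_pos_iff.2 h0
    have h1 := hone (‖ρ‖⁻¹ • ρ) (by rw [norm_smul, norm_inv, norm_norm, inv_mul_cancel₀ hpos.ne'])
    have h2 : transferCk N g hr φ hφ ρ = ‖ρ‖ • transferCk N g hr φ hφ (‖ρ‖⁻¹ • ρ) := by
      rw [← hsmul, smul_smul, mul_inv_cancel₀ hpos.ne', one_smul]
    rw [h2, enorm_smul, enorm_norm, mul_comm]
    gcongr

variable {N}

/-- Smoothness and bounds, near a compact subset of a chart domain, for the averaged transfer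
operator. -/
theorem avgTransfer_chart_bound (g : RiemMetric d M) (hr : 1 ≤ r)
    (ν : Measure C^r⟮𝓡 d, M; 𝓡 d, M⟯)
    (hint : ∫⁻ φ in diffLoc d M r, N.opENorm (transfer g φ) ∂ν < ⊤) (p : M) {K : Set M}
    (hK : IsCompact K) (hKp : K ⊆ (chartAt (Eu d) p).source) :
    ∃ U : Set (Eu d), IsOpen U ∧ (∀ x ∈ K, chartAt (Eu d) p x ∈ U) ∧ ∃ C : ℝ, 0 ≤ C ∧
      ∀ ρ : N.Space, ContDiffOn ℝ (r - 1 : ℕ) (avgTransfer g ν ρ ∘ (chartAt (Eu d) p).symm) U ∧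
        ∀ j ≤ r - 1, ∀ y ∈ U,
          ‖iteratedFDeriv ℝ j (avgTransfer g ν ρ ∘ (chartAt (Eu d) p).symm) y‖ ≤ C * ‖ρ‖ := by
  have : LocallyCompactSpace M := ChartedSpace.locallyCompactSpace (Eu d) M
  set e := chartAt (Eu d) p with he
  obtain ⟨K', hK'c, hKK', hK'p⟩ := exists_compact_between hK e.open_source hKp
  obtain ⟨C₀, hC₀, hbd⟩ := N.exists_iteratedFDeriv_le p hK'c hK'p
  set U : Set (Eu d) := e.target ∩ e.symm ⁻¹' interior K' with hU
  have hUo : IsOpen U := e.isOpen_inter_preimage_symm isOpen_interior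
  refine ⟨U, hUo, fun x hx => ⟨e.map_source (hKp hx), by
    rw [mem_preimage, e.left_inv (hKp hx)]; exact hKK' hx⟩,
    C₀ * (∫⁻ φ in diffLoc d M r, N.opENorm (transfer g φ) ∂ν).toReal, by positivity, ?_⟩
  intro ρ
  have hDm : MeasurableSet (diffLoc d M r) := (isOpen_diffLoc hr).measurableSet
  set C : C^r⟮𝓡 d, M; 𝓡 d, M⟯ → ℝ≥0∞ := fun φ =>
    ENNReal.ofReal C₀ * ‖ρ‖ₑ * N.opENorm (transfer g φ) with hC
  have hCt : ENNReal.ofReal C₀ * ‖ρ‖ₑ ≠ ⊤ :=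
    ENNReal.mul_ne_top ENNReal.ofReal_ne_top enorm_ne_top
  have hCi : ∫⁻ φ in diffLoc d M r, C φ ∂ν = ENNReal.ofReal C₀ * ‖ρ‖ₑ *
      ∫⁻ φ in diffLoc d M r, N.opENorm (transfer g φ) ∂ν := lintegral_const_mul' _ _ hCt
  have hmain := contDiffOn_integral (ν := ν.restrict (diffLoc d M r)) hUo (C := C)
    (by rw [hCi]; exact ENNReal.mul_lt_top hCt.lt_top hint) (r - 1)
    (F := fun y φ => transfer g φ ρ (e.symm y)) ?_ ?_ ?_
  · refine ⟨hmain.1, fun j hj y hy => ?_⟩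
    have h1 := hmain.2 j hj y hy
    rw [hCi] at h1
    have h2 := ENNReal.toReal_mono (ENNReal.mul_ne_top hCt hint.ne) h1
    rw [toReal_enorm, ENNReal.toReal_mul, ENNReal.toReal_mul, ENNReal.toReal_ofReal hC₀,
      toReal_enorm] at h2
    refine h2.trans (le_of_eq (by ring))
  · filter_upwards [ae_restrict_mem hDm] with φ hφ
    exact (contDiffOn_comp_chart_symm (transferCk N g hr φ hφ ρ).contMDiff p).mono inter_subset_left
  · exact fun y _ => aestronglyMeasurable_transfer g hr ν ρ.contMDiff.continuous _
  · filter_upwards [ae_restrict_mem hDm] with φ hφ j hj y hy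
    have h1 := hbd (transferCk N g hr φ hφ ρ) (e.symm y) (interior_subset hy.2) j hj
    rw [← he, e.right_inv hy.1] at h1
    calc _ ≤ ENNReal.ofReal (C₀ * ‖transferCk N g hr φ hφ ρ‖) := by
          rw [← ofReal_norm]
          exact ENNReal.ofReal_le_ofReal h1
      _ = ENNReal.ofReal C₀ * ‖transferCk N g hr φ hφ ρ‖ₑ := by
          rw [ENNReal.ofReal_mul hC₀, ofReal_norm]
      _ ≤ ENNReal.ofReal C₀ * (N.opENorm (transfer g φ) * ‖ρ‖ₑ) := by
          gcongr
          exact enorm_transferCk_le N g hr φ hφ ρ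
      _ = C φ := by rw [hC]; ring

theorem contMDiff_avgTransfer (g : RiemMetric d M) (hr : 1 ≤ r)
    (ν : Measure C^r⟮𝓡 d, M; 𝓡 d, M⟯)
    (hint : ∫⁻ φ in diffLoc d M r, N.opENorm (transfer g φ) ∂ν < ⊤) (ρ : N.Space) :
    ContMDiff (𝓡 d) 𝓘(ℝ, ℝ) (r - 1 : ℕ) (avgTransfer g ν ρ) := by
  intro x
  have hM := isManifold_nat (d := d) (M := M) (r - 1)
  obtain ⟨U, hUo, hxU, C, -, h⟩ := avgTransfer_chart_bound (N := N) g hr ν hint x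
    (K := {x}) isCompact_singleton (by simp)
  have h1 := (h ρ).1.contMDiffOn.contMDiffAt (hUo.mem_nhds (hxU x rfl))
  have h2 := h1.comp x (contMDiffOn_chart.contMDiffAt
    ((chartAt (Eu d) x).open_source.mem_nhds (mem_chart_source _ x)))
  refine h2.congr_of_eventuallyEq ?_
  filter_upwards [(chartAt (Eu d) x).open_source.mem_nhds (mem_chart_source _ x)] with z hz
  simp [(chartAt (Eu d) x).left_inv hz]

theorem integrable_transfer (g : RiemMetric d M) (hr : 1 ≤ r)
    (ν : Measure C^r⟮𝓡 d, M; 𝓡 d, M⟯)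
    (hint : ∫⁻ φ in diffLoc d M r, N.opENorm (transfer g φ) ∂ν < ⊤) (ρ : N.Space) (y : M) :
    Integrable (fun φ : C^r⟮𝓡 d, M; 𝓡 d, M⟯ => transfer g φ ρ y) (ν.restrict (diffLoc d M r)) := by
  obtain ⟨C₀, hC₀, hbd⟩ := N.exists_iteratedFDeriv_le y (K := {y}) isCompact_singleton (by simp)
  refine ⟨aestronglyMeasurable_transfer g hr ν ρ.contMDiff.continuous _, ?_⟩
  have hCt : ENNReal.ofReal C₀ * ‖ρ‖ₑ ≠ ⊤ :=
    ENNReal.mul_ne_top ENNReal.ofReal_ne_top enorm_ne_top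
  refine lt_of_le_of_lt (lintegral_mono_ae
    (g := fun φ : C^r⟮𝓡 d, M; 𝓡 d, M⟯ => ENNReal.ofReal C₀ * ‖ρ‖ₑ *
      N.opENorm (transfer g φ)) ?_) (by
      rw [lintegral_const_mul' _ _ hCt]
      exact ENNReal.mul_lt_top hCt.lt_top hint)
  filter_upwards [ae_restrict_mem (isOpen_diffLoc hr).measurableSet] with φ hφ
  have h1 := hbd (transferCk N g hr φ hφ ρ) y rfl 0 (Nat.zero_le _)
  rw [norm_iteratedFDeriv_zero, Function.comp_apply,
    (chartAt (Eu d) y).left_inv (mem_chart_source _ y)] at h1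
  calc _ ≤ ENNReal.ofReal (C₀ * ‖transferCk N g hr φ hφ ρ‖) := by
        rw [← ofReal_norm]
        exact ENNReal.ofReal_le_ofReal h1
    _ = ENNReal.ofReal C₀ * ‖transferCk N g hr φ hφ ρ‖ₑ := by
        rw [ENNReal.ofReal_mul hC₀, ofReal_norm]
    _ ≤ ENNReal.ofReal C₀ * (N.opENorm (transfer g φ) * ‖ρ‖ₑ) := by
        gcongr
        exact enorm_transferCk_le N g hr φ hφ ρ
    _ = _ := by ring

/-- The averaged transfer operator is a bounded operator of `C^{r-1}(M)`. -/
theorem exists_clm_avgTransfer (g : RiemMetric d M) (hr : 1 ≤ r)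
    (ν : Measure C^r⟮𝓡 d, M; 𝓡 d, M⟯)
    (hint : ∫⁻ φ in diffLoc d M r, N.opENorm (transfer g φ) ∂ν < ⊤) :
    ∃ T : N.Space →L[ℝ] N.Space, ∀ ρ, ⇑(T ρ) = avgTransfer g ν ρ := by
  have hDm : MeasurableSet (diffLoc d M r) := (isOpen_diffLoc hr).measurableSet
  set T₀ : N.Space → N.Space := fun ρ =>
    (⟨avgTransfer g ν ρ, contMDiff_avgTransfer g hr ν hint ρ⟩ : C^(r - 1 : ℕ)⟮𝓡 d, M; ℝ⟯) with hT₀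
  have hT₀a : ∀ ρ y, T₀ ρ y = avgTransfer g ν ρ y := fun ρ y => rfl
  set T : N.Space →ₗ[ℝ] N.Space :=
    { toFun := T₀
      map_add' := fun ρ η => DFunLike.ext _ _ fun y => by
        change avgTransfer g ν (ρ + η) y = avgTransfer g ν ρ y + avgTransfer g ν η y
        unfold avgTransfer
        rw [← integral_add (integrable_transfer g hr ν hint ρ y)
          (integrable_transfer g hr ν hint η y)]
        exact setIntegral_congr_fun hDm fun φ hφ => transfer_add g hr φ.contMDiff hφ ρ η y
      map_smul' := fun c ρ => DFunLike.ext _ _ fun y => by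
        change avgTransfer g ν (c • ρ) y = c * avgTransfer g ν ρ y
        unfold avgTransfer
        rw [← integral_const_mul]
        exact setIntegral_congr_fun hDm fun φ hφ => transfer_smul g hr φ.contMDiff hφ c ρ y }
    with hT
  -- boundedness: `T` is continuous at `0` for finitely many seminorms that control the norm
  obtain ⟨Z, hZ, hZK, δ, hδ, hN⟩ := N.exists_norm_lt_one
  choose! U hUo hKU C hC hb using fun (z : M × Set M) (hz : z ∈ Z) =>
    avgTransfer_chart_bound (N := N) g hr ν hint z.1 (hZK z hz).1 (hZK z hz).2
  obtain ⟨A, hA⟩ : ∃ A : ℝ, ∀ z ∈ Z, C z ≤ A := by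
    obtain ⟨A, hA⟩ := (hZ.image C).bddAbove
    exact ⟨A, fun z hz => hA (mem_image_of_mem C hz)⟩
  have hA1 : 0 < |A| + 1 := by positivity
  obtain ⟨D, hD⟩ := T.bound_of_ball_bound (r := δ / (|A| + 1)) (by positivity) 1 (by
    intro ρ hρ
    rw [mem_ball_zero_iff, lt_div_iff₀ hA1] at hρ
    refine (hN (T ρ) fun z hz x hx j hj => ?_).le
    refine ((hb z hz ρ).2 j hj _ (hKU z hz x hx)).trans_lt ?_
    have h1 : C z ≤ |A| := (hA z hz).trans (le_abs_self A)
    nlinarith [norm_nonneg ρ])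
  exact ⟨T.mkContinuous D hD, fun ρ => rfl⟩

end AvgTransfer

/-! ### Transport of compactly supported functions by a partial homeomorphism -/

section Transport

variable {X Y : Type*} [TopologicalSpace X] [TopologicalSpace Y] [T2Space Y]

/-- The function `w` transported by the partial homeomorphism `e`, extended by zero. -/
def transport (e : OpenPartialHomeomorph X Y) (w : X → ℝ) : Y → ℝ :=
  e.target.indicator (w ∘ e.symm)

theorem transport_apply {e : OpenPartialHomeomorph X Y} (w : X → ℝ) {x : X} (hx : x ∈ e.source) :
    transport e w (e x) = w x := by
  simp [transport, e.map_source hx, e.left_inv hx]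

theorem transport_nonneg (e : OpenPartialHomeomorph X Y) {w : X → ℝ} (hw : ∀ x, 0 ≤ w x) (y : Y) :
    0 ≤ transport e w y :=
  indicator_nonneg (fun _ _ => hw _) y

theorem support_transport_subset (e : OpenPartialHomeomorph X Y) (w : X → ℝ) :
    Function.support (transport e w) ⊆ e '' (tsupport w ∩ e.source) := by
  intro y hy
  have hyt : y ∈ e.target := by
    by_contra h
    exact hy (by simp [transport, h])
  refine ⟨e.symm y, ⟨subset_tsupport _ ?_, e.map_target hyt⟩, e.right_inv hyt⟩
  simpa [transport, hyt] using hy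

theorem isCompact_image_tsupport {e : OpenPartialHomeomorph X Y} {w : X → ℝ}
    (hc : HasCompactSupport w) (hs : tsupport w ⊆ e.source) : IsCompact (e '' tsupport w) :=
  hc.isCompact.image_of_continuousOn (e.continuousOn.mono hs)

theorem tsupport_transport_subset {e : OpenPartialHomeomorph X Y} {w : X → ℝ}
    (hc : HasCompactSupport w) (hs : tsupport w ⊆ e.source) :
    tsupport (transport e w) ⊆ e '' tsupport w :=
  closure_minimal ((support_transport_subset e w).trans (image_mono inter_subset_left))
    (isCompact_image_tsupport hc hs).isClosed

theorem hasCompactSupport_transport {e : OpenPartialHomeomorph X Y} {w : X → ℝ}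
    (hc : HasCompactSupport w) (hs : tsupport w ⊆ e.source) : HasCompactSupport (transport e w) :=
  (isCompact_image_tsupport hc hs).of_isClosed_subset (isClosed_tsupport _)
    (tsupport_transport_subset hc hs)

theorem tsupport_transport_subset_target {e : OpenPartialHomeomorph X Y} {w : X → ℝ}
    (hc : HasCompactSupport w) (hs : tsupport w ⊆ e.source) :
    tsupport (transport e w) ⊆ e.target :=
  (tsupport_transport_subset hc hs).trans (image_subset_iff.2 fun _ hx => e.map_source (hs hx))

variable {E F H G : Type*} [NormedAddCommGroup E] [NormedSpace ℝ E] [TopologicalSpace H]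
  {I : ModelWithCorners ℝ E H} [ChartedSpace H X] [NormedAddCommGroup F] [NormedSpace ℝ F]
  [TopologicalSpace G] {J : ModelWithCorners ℝ F G} [ChartedSpace G Y]

theorem contMDiff_transport {n : ℕ∞ω} {e : OpenPartialHomeomorph X Y} {w : X → ℝ}
    (he : ContMDiffOn J I n e.symm e.target) (hw : ContMDiff I 𝓘(ℝ, ℝ) n w)
    (hc : HasCompactSupport w) (hs : tsupport w ⊆ e.source) :
    ContMDiff J 𝓘(ℝ, ℝ) n (transport e w) := by
  refine contMDiff_of_tsupport fun y hy => ?_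
  have hyt := tsupport_transport_subset_target hc hs hy
  refine ((hw.comp_contMDiffOn he).contMDiffAt
    (e.open_target.mem_nhds hyt)).congr_of_eventuallyEq ?_
  filter_upwards [e.open_target.mem_nhds hyt] with z hz
  simp [transport, hz]

end Transport

/-! ### Densities of images under submersions, in coordinates -/

section LocalDensity

theorem contDiff_of_forall_tsupport {E : Type*} [NormedAddCommGroup E] [NormedSpace ℝ E]
    {n : ℕ∞ω} {f : E → ℝ} (h : ∀ x ∈ tsupport f, ContDiffAt ℝ n f x) : ContDiff ℝ n f :=
  contMDiff_iff_contDiff.1 (contMDiff_of_tsupport fun x hx => (h x hx).contMDiffAt)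

/-- An integral with respect to a locally finite measure of a compactly supported `C^m` function
is a `C^m` function of the remaining variables. -/
theorem contDiff_integral_of_hasCompactSupport {Z E : Type} [NormedAddCommGroup Z]
    [NormedSpace ℝ Z] [FiniteDimensional ℝ Z] [MeasurableSpace Z] [BorelSpace Z]
    [NormedAddCommGroup E] [NormedSpace ℝ E] (Λ : Measure Z) [IsLocallyFiniteMeasure Λ] {m : ℕ}
    {k : Z × E → ℝ} (hk : ContDiff ℝ m k) (hc : HasCompactSupport k) :
    ContDiff ℝ m fun y => ∫ z, k (z, y) ∂Λ := by
  -- the integral is the value at `0` of the convolution of the constant `1` with `z ↦ k (-z, y)`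
  have hK : IsCompact ((fun p : Z × E => -p.1) '' tsupport k) :=
    hc.isCompact.image (continuous_fst.neg)
  have h := contDiffOn_convolution_right_with_param (μ := Λ) (f := fun _ : Z => (1 : ℝ))
    (n := (m : ℕ∞)) (ContinuousLinearMap.lsmul ℝ ℝ : ℝ →L[ℝ] ℝ →L[ℝ] ℝ)
    (g := fun (y : E) (z : Z) => k (-z, y)) isOpen_univ hK (fun y z _ hz => by
      by_contra h0
      exact hz ⟨(-z, y), subset_tsupport _ h0, neg_neg z⟩) (locallyIntegrable_const 1) (by
      refine ContDiff.contDiffOn ?_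
      exact hk.comp ((contDiff_snd.neg).prodMk contDiff_fst))
  rw [univ_prod_univ, contDiffOn_univ] at h
  have h2 := h.comp ((contDiff_id (E := E)).prodMk (contDiff_const (c := (0 : Z))))
  have he : (fun y => ∫ z, k (z, y) ∂Λ) = (fun q : E × Z => convolution (fun _ : Z => (1 : ℝ))
      (fun z => k (-z, q.1)) (ContinuousLinearMap.lsmul ℝ ℝ) Λ q.2) ∘ fun x => (id x, 0) := by
    funext y
    simp only [Function.comp_apply, convolution_def, id, zero_sub, neg_neg,
      ContinuousLinearMap.lsmul_apply, one_smul]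
  rw [he]
  exact h2

/-- Outside the support of `w` the values of `F`, and so its regularity, do not matter. -/
theorem measurable_mul_comp {Z E : Type*} [TopologicalSpace Z] [MeasurableSpace Z]
    [BorelSpace Z] [TopologicalSpace E] [MeasurableSpace E] [BorelSpace E]
    [Nonempty E] {w : Z → ℝ} (hw : Continuous w) {F : Z → E} {O : Set Z} (hO : IsOpen O)
    (hF : ContinuousOn F O) (hwO : tsupport w ⊆ O) {η : E → ℝ≥0∞} (hη : Measurable η) :
    Measurable fun z => ENNReal.ofReal (w z) * η (F z) := by
  classical
  obtain ⟨c⟩ := ‹Nonempty E›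
  have h1 : Measurable (O.piecewise F fun _ => c) :=
    hF.measurable_piecewise continuousOn_const hO.measurableSet
  have h2 : (fun z => ENNReal.ofReal (w z) * η (F z)) =
      fun z => ENNReal.ofReal (w z) * η (O.piecewise F (fun _ => c) z) := by
    funext z
    by_cases hz : z ∈ O
    · simp [hz]
    · rw [image_eq_zero_of_notMem_tsupport fun h => hz (hwO h)]
      simp
  rw [h2]
  exact hw.measurable.ennreal_ofReal.mul (hη.comp h1)

variable {d n : ℕ}

/-- A map `(z, s) ↦ (z, f (z, s))` has an invertible derivative where the partial derivative of
`f` in `s` is invertible. -/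
theorem bijective_fderiv_prodMk {Z E : Type*} [NormedAddCommGroup Z] [NormedSpace ℝ Z]
    [NormedAddCommGroup E] [NormedSpace ℝ E] {f : Z × E → E} {p : Z × E}
    (hf : DifferentiableAt ℝ f p)
    (hb : Function.Bijective ((fderiv ℝ f p).comp (ContinuousLinearMap.inr ℝ Z E))) :
    Function.Bijective (fderiv ℝ (fun q : Z × E => (q.1, f q)) p) := by
  have h1 : fderiv ℝ (fun q : Z × E => (q.1, f q)) p =
      (ContinuousLinearMap.fst ℝ Z E).prod (fderiv ℝ f p) :=
    (hasFDerivAt_fst.prodMk hf.hasFDerivAt).fderiv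
  have h2 : ∀ (ζ : Z) (σ : E), fderiv ℝ f p (ζ, σ) = fderiv ℝ f p (ζ, 0) +
      (fderiv ℝ f p).comp (ContinuousLinearMap.inr ℝ Z E) σ := by
    intro ζ σ
    simp [← map_add]
  rw [h1]
  constructor
  · rintro ⟨ζ, σ⟩ ⟨ζ', σ'⟩ h
    simp only [ContinuousLinearMap.prod_apply, ContinuousLinearMap.coe_fst', Prod.mk.injEq] at h
    obtain ⟨rfl, h⟩ := h
    rw [h2, h2 ζ σ', add_right_inj] at h
    rw [hb.1 h]
  · rintro ⟨ζ, τ⟩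
    obtain ⟨σ, hσ⟩ := hb.2 (τ - fderiv ℝ f p (ζ, 0))
    exact ⟨(ζ, σ), by
      simp only [ContinuousLinearMap.prod_apply, ContinuousLinearMap.coe_fst', Prod.mk.injEq,
        true_and]
      rw [h2, hσ, add_sub_cancel]⟩

/-- If `f (z, ·)` is a local diffeomorphism near every point of the compact support of `v`, then
the image under `f` of the measure with density `v` has a density `k (z, ·)`, jointly of
class `C^{r-1}`. -/
theorem exists_density_of_partial_bijective {Z : Type} [NormedAddCommGroup Z] [NormedSpace ℝ Z]
    [FiniteDimensional ℝ Z] {r : ℕ} (hr : 1 ≤ r) {f : Z × Eu d → Eu d}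
    {O : Set (Z × Eu d)} (hO : IsOpen O) (hf : ContDiffOn ℝ r f O)
    (hb : ∀ p ∈ O, Function.Bijective
      ((fderiv ℝ f p).comp (ContinuousLinearMap.inr ℝ Z (Eu d)))) {a : Z × Eu d} (ha : a ∈ O) :
    ∃ O' ⊆ O, IsOpen O' ∧ a ∈ O' ∧ ∀ v : Z × Eu d → ℝ, ContDiff ℝ (r - 1 : ℕ) v →
      HasCompactSupport v → tsupport v ⊆ O' → (∀ p, 0 ≤ v p) →
      ∃ k : Z × Eu d → ℝ, ContDiff ℝ (r - 1 : ℕ) k ∧ HasCompactSupport k ∧ (∀ p, 0 ≤ k p) ∧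
        (∀ z y, k (z, y) ≠ 0 → y ∈ f '' tsupport v) ∧
        ∀ (η : Eu d → ℝ≥0∞) (z : Z), ∫⁻ s, ENNReal.ofReal (v (z, s)) * η (f (z, s)) =
          ∫⁻ y, ENNReal.ofReal (k (z, y)) * η y := by
  have hr0 : (r : ℕ∞ω) ≠ 0 := by exact_mod_cast (by omega : r ≠ 0)
  have hr1 : ((r - 1 : ℕ) : ℕ∞ω) + 1 ≤ r := by
    exact_mod_cast (by omega : r - 1 + 1 ≤ r)
  have hr3 : ((r - 1 : ℕ) : ℕ∞ω) ≤ r := le_trans le_self_add hr1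
  have hdiff : ∀ p ∈ O, DifferentiableAt ℝ f p := fun p hp =>
    (hf.contDiffAt (hO.mem_nhds hp)).differentiableAt hr0
  obtain ⟨e, hea, heO, hef, hes⟩ := exists_openPartialHomeomorph_of_bijective_fderiv hr0 hO
    (f := fun q : Z × Eu d => (q.1, f q)) (contDiffOn_fst.prodMk hf)
    (fun p hp => bijective_fderiv_prodMk (hdiff p hp) (hb p hp)) ha
  refine ⟨e.source, heO, e.open_source, hea, fun v hv hvc hvs hv0 => ?_⟩
  set D : Z × Eu d → ℝ := fun p =>
    |((fderiv ℝ f p).comp (ContinuousLinearMap.inr ℝ Z (Eu d))).det| with hD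
  have hDpos : ∀ p ∈ O, 0 < D p := fun p hp =>
    abs_pos.2 ((bijective_iff_det_ne_zero _).1 (hb p hp))
  have hDs : ∀ p ∈ O, ContDiffAt ℝ (r - 1 : ℕ) D p := by
    intro p hp
    have h1 : ContDiffAt ℝ (r - 1 : ℕ) (fderiv ℝ f) p :=
      (hf.fderiv_of_isOpen hO hr1).contDiffAt (hO.mem_nhds hp)
    have h2 : ContDiffAt ℝ (r - 1 : ℕ) (fun p => (fderiv ℝ f p).comp
      (ContinuousLinearMap.inr ℝ Z (Eu d))) p := h1.clm_comp contDiffAt_const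
    exact ContDiffAt.abs (((contDiff_det (d := d)).of_le le_top).contDiffAt.comp p h2)
      ((bijective_iff_det_ne_zero _).1 (hb p hp))
  -- divide by the Jacobian, then transport by `(z, s) ↦ (z, f (z, s))`
  set v' : Z × Eu d → ℝ := fun p => v p * (D p)⁻¹ with hv'
  have hts : tsupport v' ⊆ tsupport v := closure_mono fun p hp => left_ne_zero_of_mul hp
  have hv'c : HasCompactSupport v' := hvc.mul_right
  have hv's : ContDiff ℝ (r - 1 : ℕ) v' := contDiff_of_forall_tsupport fun p hp => by
    have hpO := heO (hvs (hts hp))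
    exact hv.contDiffAt.mul ((hDs p hpO).inv (hDpos p hpO).ne')
  have hv'0 : ∀ p, 0 ≤ v' p := fun p => mul_nonneg (hv0 p) (inv_nonneg.2 (abs_nonneg _))
  have hse := hts.trans hvs
  refine ⟨transport e v', contMDiff_iff_contDiff.1 (contMDiff_transport (hes.of_le hr3).contMDiffOn
    (contMDiff_iff_contDiff.2 hv's) hv'c hse), hasCompactSupport_transport hv'c hse,
    transport_nonneg e hv'0, ?_, ?_⟩
  · intro z y h
    obtain ⟨p, ⟨hp, -⟩, hpy⟩ := support_transport_subset e v' h
    rw [hef] at hpy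
    exact ⟨p, hts hp, (Prod.ext_iff.1 hpy).2⟩
  · intro η z
    set S : Set (Eu d) := {s | (z, s) ∈ e.source} with hS
    have hSo : IsOpen S := e.open_source.preimage (Continuous.prodMk_right z)
    have hSm := hSo.measurableSet
    have hinj : InjOn (fun s => f (z, s)) S := by
      intro s hs s' hs' h
      have : e (z, s) = e (z, s') := by
        rw [hef]
        exact Prod.ext rfl h
      exact (Prod.ext_iff.1 (e.injOn hs hs' this)).2
    have hder : ∀ s ∈ S, HasFDerivWithinAt (fun s => f (z, s))
        ((fderiv ℝ f (z, s)).comp (ContinuousLinearMap.inr ℝ Z (Eu d))) S s := by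
      intro s hs
      exact ((hdiff _ (heO hs)).hasFDerivAt.comp s
        (hasFDerivAt_prodMk_right z s)).hasFDerivWithinAt
    calc ∫⁻ s, ENNReal.ofReal (v (z, s)) * η (f (z, s))
        = ∫⁻ s in S, ENNReal.ofReal (v (z, s)) * η (f (z, s)) := by
          rw [← lintegral_indicator hSm]
          congr 1
          funext s
          by_cases hs : s ∈ S
          · simp [hs]
          · have : v (z, s) = 0 := image_eq_zero_of_notMem_tsupport fun h => hs (hvs h)
            simp [hs, this]
      _ = ∫⁻ s in S, ENNReal.ofReal
            |((fderiv ℝ f (z, s)).comp (ContinuousLinearMap.inr ℝ Z (Eu d))).det| *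
            (ENNReal.ofReal (transport e v' (z, f (z, s))) * η (f (z, s))) := by
          refine setLIntegral_congr_fun hSm fun s hs => ?_
          have h1 : transport e v' (z, f (z, s)) = v' (z, s) := by
            have := transport_apply v' hs
            rwa [hef] at this
          have h2 : v (z, s) = D (z, s) * v' (z, s) := by
            rw [hv']
            have := (hDpos _ (heO hs)).ne'
            field_simp
          rw [h1, ← mul_assoc, ← ENNReal.ofReal_mul (abs_nonneg _), h2]
      _ = ∫⁻ y in (fun s => f (z, s)) '' S, ENNReal.ofReal (transport e v' (z, y)) * η y :=
          (lintegral_image_eq_lintegral_abs_det_fderiv_mul volume hSm hder hinj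
            (fun y => ENNReal.ofReal (transport e v' (z, y)) * η y)).symm
      _ = ∫⁻ y, ENNReal.ofReal (transport e v' (z, y)) * η y := by
          refine setLIntegral_eq_of_support_subset ?_
          intro y hy
          have hk : transport e v' (z, y) ≠ 0 := fun h0 => hy (by simp [h0])
          obtain ⟨⟨z', s⟩, ⟨-, hp⟩, hpy⟩ := support_transport_subset e v' hk
          rw [hef, Prod.mk.injEq] at hpy
          obtain ⟨rfl, rfl⟩ := hpy
          exact ⟨s, hp, rfl⟩

end LocalDensity

section Submersion

variable {d n : ℕ}

/-- The continuous linear map `((x, θ), s) ↦ (x, θ + R s)`. -/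
def shear (R : Eu d →L[ℝ] Eu n) : (Eu d × Eu n) × Eu d →L[ℝ] Eu d × Eu n :=
  ContinuousLinearMap.fst ℝ (Eu d × Eu n) (Eu d) +
    ((ContinuousLinearMap.inr ℝ (Eu d) (Eu n)).comp R).comp
      (ContinuousLinearMap.snd ℝ (Eu d × Eu n) (Eu d))

theorem shear_apply (R : Eu d →L[ℝ] Eu n) (z : Eu d × Eu n) (s : Eu d) :
    shear R (z, s) = (z.1, z.2 + R s) := by
  ext <;> simp [shear]

/-- Averaging over the shears `θ ↦ θ + R s` does not change integrals over `θ`. -/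
theorem lintegral_shear (R : Eu d →L[ℝ] Eu n) (Λ : Measure (Eu d)) [IsFiniteMeasure Λ]
    {κ : Eu d → ℝ≥0∞} (hκ : Measurable κ) (hκ1 : ∫⁻ s, κ s = 1) {G : Eu d × Eu n → ℝ≥0∞}
    (hG : Measurable G) :
    ∫⁻ z, (∫⁻ s, κ s * G (shear R (z, s))) ∂(Λ.prod volume) = ∫⁻ x, (∫⁻ θ, G (x, θ)) ∂Λ := by
  have hm : Measurable fun p : (Eu d × Eu n) × Eu d => κ p.2 * G (shear R p) :=
    (hκ.comp measurable_snd).mul (hG.comp (shear R).continuous.measurable)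
  rw [lintegral_prod _ hm.lintegral_prod_right'.aemeasurable]
  refine lintegral_congr fun x => ?_
  have hm2 : Measurable fun p : Eu n × Eu d => κ p.2 * G (shear R ((x, p.1), p.2)) :=
    hm.comp (by fun_prop : Measurable fun p : Eu n × Eu d => ((x, p.1), p.2))
  rw [lintegral_lintegral_swap hm2.aemeasurable]
  have h1 : ∀ s, ∫⁻ θ, κ s * G (shear R ((x, θ), s)) = κ s * ∫⁻ θ, G (x, θ) := by
    intro s
    simp only [shear_apply]
    rw [lintegral_const_mul _ (by fun_prop)]
    rw [lintegral_add_right_eq_self (fun θ => G (x, θ))]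
  simp only [h1]
  rw [lintegral_mul_const _ hκ, hκ1, one_mul]

/-- Let `F` be of class `C^r` near `z₀ = (x₀, θ₀)`, with `∂_θ F` onto at `z₀`. For a density `w` of
class `C^{r-1}` supported near `z₀`, the image of `w (x, θ) dΛ(x) dθ` under `F` has a `C^{r-1}`
density, whatever the finite measure `Λ`. With `R` a right inverse of `∂_θ F (z₀)`, the integrals
over `θ` do not change if `θ` is replaced by `θ + R s` and the result is averaged over small
`s ∈ ℝ^d`; after this, `s ↦ F (x, θ + R s)` is a local diffeomorphism for each `(x, θ)`. -/
theorem exists_density_of_surjective {r : ℕ} (hr : 1 ≤ r) {F : Eu d × Eu n → Eu d}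
    {O : Set (Eu d × Eu n)} (hO : IsOpen O) (hF : ContDiffOn ℝ r F O) {z₀ : Eu d × Eu n}
    (hz₀ : z₀ ∈ O) (hsurj : Function.Surjective
      ((fderiv ℝ F z₀).comp (ContinuousLinearMap.inr ℝ (Eu d) (Eu n))))
    {Q : Set (Eu d)} (hQ : IsOpen Q) (hzQ : F z₀ ∈ Q) :
    ∃ W ⊆ O, IsOpen W ∧ z₀ ∈ W ∧ ∀ w : Eu d × Eu n → ℝ, ContDiff ℝ (r - 1 : ℕ) w →
      HasCompactSupport w → tsupport w ⊆ W → (∀ z, 0 ≤ w z) →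
      ∀ (Λ : Measure (Eu d)) [IsFiniteMeasure Λ], ∃ κ : Eu d → ℝ,
        ContDiff ℝ (r - 1 : ℕ) κ ∧ HasCompactSupport κ ∧ tsupport κ ⊆ Q ∧ (∀ y, 0 ≤ κ y) ∧
        ∀ η : Eu d → ℝ≥0∞, Measurable η →
          ∫⁻ x, (∫⁻ θ, ENNReal.ofReal (w (x, θ)) * η (F (x, θ))) ∂Λ =
            ∫⁻ y, ENNReal.ofReal (κ y) * η y := by
  have hr0 : (r : ℕ∞ω) ≠ 0 := by exact_mod_cast (by omega : r ≠ 0)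
  have hr1 : ((r - 1 : ℕ) : ℕ∞ω) + 1 ≤ r := by
    exact_mod_cast (by omega : r - 1 + 1 ≤ r)
  obtain ⟨R₀, hR₀⟩ := LinearMap.exists_rightInverse_of_surjective
    ((fderiv ℝ F z₀).comp (ContinuousLinearMap.inr ℝ (Eu d) (Eu n))).toLinearMap
    (LinearMap.range_eq_top.2 hsurj)
  set R : Eu d →L[ℝ] Eu n := R₀.toContinuousLinearMap with hR
  set A := shear R with hA
  set f : (Eu d × Eu n) × Eu d → Eu d := fun p => F (A p) with hf
  have hA0 : A (z₀, 0) = z₀ := by simp [hA, shear_apply]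
  have hO₁ : IsOpen (A ⁻¹' O) := hO.preimage A.continuous
  have hfO : ContDiffOn ℝ r f (A ⁻¹' O) := hF.comp A.contDiff.contDiffOn fun _ h => h
  set f' : (Eu d × Eu n) × Eu d → (Eu d →L[ℝ] Eu d) := fun p =>
    (fderiv ℝ f p).comp (ContinuousLinearMap.inr ℝ (Eu d × Eu n) (Eu d)) with hf'
  have hf'c : ContinuousOn (fun p => (f' p).det) (A ⁻¹' O) := by
    have h1 : ContinuousOn (fderiv ℝ f) (A ⁻¹' O) := (hfO.fderiv_of_isOpen hO₁ hr1).continuousOn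
    exact (contDiff_det (d := d)).continuous.comp_continuousOn (h1.clm_comp continuousOn_const)
  have hmem : (z₀, (0 : Eu d)) ∈ A ⁻¹' O := by rwa [mem_preimage, hA0]
  have hf'0 : f' (z₀, 0) = ContinuousLinearMap.id ℝ (Eu d) := by
    have h1 : HasFDerivAt f ((fderiv ℝ F z₀).comp A) (z₀, 0) := by
      have h2 : HasFDerivAt F (fderiv ℝ F z₀) (A (z₀, 0)) := by
        rw [hA0]
        exact ((hF.contDiffAt (hO.mem_nhds hz₀)).differentiableAt hr0).hasFDerivAt
      exact h2.comp (z₀, (0 : Eu d)) A.hasFDerivAt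
    ext1 s
    have h2 : A ((0 : Eu d × Eu n), s) = (0, R s) := by simp [hA, shear_apply]
    have h3 := LinearMap.congr_fun hR₀ s
    simp only [hf', h1.fderiv]
    simpa [h2, hR] using h3
  -- near `(z₀, 0)` the partial derivative of `f` in `s` is invertible and `f` takes values in `Q`
  have hO₂ : IsOpen ((A ⁻¹' O ∩ (fun p => (f' p).det) ⁻¹' {0}ᶜ) ∩ (A ⁻¹' O ∩ f ⁻¹' Q)) :=
    (hf'c.isOpen_inter_preimage hO₁ isOpen_compl_singleton).inter
      (hfO.continuousOn.isOpen_inter_preimage hO₁ hQ)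
  obtain ⟨O', hO'O, hO', hz₀O', hk⟩ := exists_density_of_partial_bijective hr hO₂
    (hfO.mono fun p hp => hp.1.1) (fun p hp => (bijective_iff_det_ne_zero _).2 hp.1.2)
    (a := (z₀, 0)) ⟨⟨hmem, by simp [hf'0, ContinuousLinearMap.det]⟩, hmem, by
      rw [mem_preimage, hf]
      simpa only [hA0] using hzQ⟩
  obtain ⟨ε, hε, hεO'⟩ := Metric.isOpen_iff.1 hO' _ hz₀O'
  obtain ⟨δ, hδ, hδε, hδR⟩ : ∃ δ > 0, δ < ε ∧ ∀ s : Eu d, ‖s‖ ≤ δ → ‖R s‖ ≤ ε / 2 := by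
    have hRp : 0 < ‖R‖ + 1 := by positivity
    refine ⟨min (ε / 2) (ε / 2 / (‖R‖ + 1)), by positivity,
      (min_le_left _ _).trans_lt (half_lt_self hε), fun s hs => ?_⟩
    have h1 : ‖s‖ ≤ ε / 2 / (‖R‖ + 1) := hs.trans (min_le_right _ _)
    rw [le_div_iff₀ hRp] at h1
    have h2 := R.le_opNorm s
    nlinarith [norm_nonneg s]
  -- for `‖s‖ ≤ δ`, if `shear R (z, s)` is in the ball of radius `ε / 2` around `z₀`, then `(z, s)` is
  -- in the ball of radius `ε` around `(z₀, 0)`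
  refine ⟨O ∩ Metric.ball z₀ (ε / 2), inter_subset_left, hO.inter Metric.isOpen_ball,
    ⟨hz₀, Metric.mem_ball_self (half_pos hε)⟩, fun w hw hwc hws hw0 Λ _ => ?_⟩
  let b : ContDiffBump (0 : Eu d) := ⟨δ / 2, δ, half_pos hδ, half_lt_self hδ⟩
  set κ₀ : Eu d → ℝ := b.normed volume with hκ₀
  have hκ₀s : ContDiff ℝ (r - 1 : ℕ) κ₀ := b.contDiff_normed
  have hκ₀t : tsupport κ₀ = Metric.closedBall 0 δ := b.tsupport_normed_eq
  have hκ₀0 : ∀ s, 0 ≤ κ₀ s := b.nonneg_normed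
  have hκ₀1 : ∫⁻ s, ENNReal.ofReal (κ₀ s) = 1 := by
    rw [← ofReal_integral_eq_lintegral_ofReal b.integrable_normed (ae_of_all _ hκ₀0),
      b.integral_normed, ENNReal.ofReal_one]
  set v : (Eu d × Eu n) × Eu d → ℝ := fun p => κ₀ p.2 * w (A p) with hv
  have hvs : ContDiff ℝ (r - 1 : ℕ) v :=
    (hκ₀s.comp contDiff_snd).mul (hw.comp A.contDiff)
  have hvt : tsupport v ⊆ A ⁻¹' tsupport w ∩ Prod.snd ⁻¹' Metric.closedBall 0 δ := by
    refine closure_minimal (fun p hp => ⟨subset_tsupport _ (right_ne_zero_of_mul hp), ?_⟩)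
      (((isClosed_tsupport w).preimage A.continuous).inter
        (Metric.isClosed_closedBall.preimage continuous_snd))
    rw [mem_preimage, ← hκ₀t]
    exact subset_tsupport _ (left_ne_zero_of_mul hp)
  have hvc : HasCompactSupport v := by
    refine ((hwc.isCompact.prod (isCompact_closedBall (0 : Eu d) δ)).image
      (f := fun q : (Eu d × Eu n) × Eu d => ((q.1.1, q.1.2 - R q.2), q.2))
      (by fun_prop)).of_isClosed_subset (isClosed_tsupport v) fun p hp => ?_
    obtain ⟨h1, h2⟩ := hvt hp
    obtain ⟨⟨x, θ⟩, s⟩ := p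
    refine ⟨(A ((x, θ), s), s), ⟨h1, h2⟩, ?_⟩
    simp [hA, shear_apply]
  have hvO' : tsupport v ⊆ O' := by
    refine fun p hp => hεO' ?_
    obtain ⟨h1, h2⟩ := hvt hp
    obtain ⟨z, s⟩ := p
    have h3 : dist (A (z, s)) z₀ < ε / 2 := (hws h1).2
    have h4 : ‖s‖ ≤ δ := by simpa using h2
    have h5 : dist z (A (z, s)) ≤ ε / 2 := by
      rw [dist_comm, dist_eq_norm, hA, shear_apply]
      have h6 : ((z.1, z.2 + R s) : Eu d × Eu n) - z = (0, R s) := by ext <;> simp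
      rw [h6, Prod.norm_mk, norm_zero]
      exact max_le (half_pos hε).le (hδR s h4)
    rw [Metric.mem_ball, Prod.dist_eq, max_lt_iff]
    refine ⟨?_, ?_⟩
    · have := dist_triangle z (A (z, s)) z₀
      simp only
      linarith
    · simp only [dist_zero_right]
      linarith
  obtain ⟨k, hks, hkc, hk0, hkv, hkη⟩ :=
    hk v hvs hvc hvO' fun p => mul_nonneg (hκ₀0 _) (hw0 _)
  set κ : Eu d → ℝ := fun y => ∫ z, k (z, y) ∂(Λ.prod volume) with hκ
  have hfv : ContinuousOn f (tsupport v) :=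
    hfO.continuousOn.mono fun p hp => (hO'O (hvO' hp)).1.1
  have hcomp : IsCompact (f '' tsupport v) := hvc.isCompact.image_of_continuousOn hfv
  have hκt : tsupport κ ⊆ f '' tsupport v := by
    refine closure_minimal (fun y hy => ?_) hcomp.isClosed
    by_contra h
    refine hy ?_
    have : ∀ z, k (z, y) = 0 := fun z => by
      by_contra h0
      exact h (hkv z y h0)
    simp [hκ, this]
  refine ⟨κ, contDiff_integral_of_hasCompactSupport _ hks hkc,
    hcomp.of_isClosed_subset (isClosed_tsupport _) hκt, hκt.trans ?_,
    fun y => integral_nonneg fun z => hk0 _, fun η hη => ?_⟩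
  · rintro _ ⟨p, hp, rfl⟩
    exact (hO'O (hvO' hp)).2.2
  · have hkint : ∀ y, Integrable (fun z => k (z, y)) (Λ.prod volume) := by
      intro y
      refine (hks.continuous.comp (Continuous.prodMk_left y)).integrable_of_hasCompactSupport ?_
      refine (hkc.isCompact.image continuous_fst).of_isClosed_subset (isClosed_tsupport _) ?_
      exact closure_minimal (fun z hz => ⟨(z, y), subset_tsupport _ hz, rfl⟩)
        (hkc.isCompact.image continuous_fst).isClosed
    set G : Eu d × Eu n → ℝ≥0∞ := fun z => ENNReal.ofReal (w z) * η (F z) with hG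
    have hGm : Measurable G :=
      measurable_mul_comp hw.continuous hO hF.continuousOn (hws.trans inter_subset_left) hη
    calc ∫⁻ x, (∫⁻ θ, G (x, θ)) ∂Λ
        = ∫⁻ z, (∫⁻ s, ENNReal.ofReal (κ₀ s) * G (A (z, s))) ∂(Λ.prod volume) :=
          (lintegral_shear R Λ hκ₀s.continuous.measurable.ennreal_ofReal hκ₀1 hGm).symm
      _ = ∫⁻ z, (∫⁻ y, ENNReal.ofReal (k (z, y)) * η y) ∂(Λ.prod volume) := by
          refine lintegral_congr fun z => ?_
          rw [← hkη η z]
          refine lintegral_congr fun s => ?_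
          simp only [hG, hv, hf, ENNReal.ofReal_mul (hκ₀0 _), mul_assoc]
      _ = ∫⁻ y, ∫⁻ z, ENNReal.ofReal (k (z, y)) * η y ∂(Λ.prod volume) :=
          lintegral_lintegral_swap
            (hks.continuous.measurable.ennreal_ofReal.mul (hη.comp measurable_snd)).aemeasurable
      _ = ∫⁻ y, ENNReal.ofReal (κ y) * η y := by
          refine lintegral_congr fun y => ?_
          rw [hκ, ofReal_integral_eq_lintegral_ofReal (hkint y) (ae_of_all _ fun z => hk0 _),
            lintegral_mul_const]
          exact (hks.continuous.comp (Continuous.prodMk_left y)).measurable.ennreal_ofReal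

end Submersion

/-! ### Densities of images under submersive families -/

section SubmersiveFamily

variable {d n : ℕ} {M : Type*} [TopologicalSpace M] [ChartedSpace (Eu d) M]
  [IsManifold (𝓡 d) ∞ M] {Θ : Type*} [TopologicalSpace Θ] [ChartedSpace (Eu n) Θ]
  [IsManifold (𝓡 n) ∞ Θ]

/-- A family `Φ` read in the charts around `x₀`, `θ₀` and `q`. -/
def familyInCharts (Φ : M × Θ → M) (x₀ : M) (θ₀ : Θ) (q : M) : Eu d × Eu n → Eu d :=
  chartAt (Eu d) q ∘ Φ ∘ ((chartAt (Eu d) x₀).prod (chartAt (Eu n) θ₀)).symm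

theorem contMDiffOn_prod_chart_symm (r : ℕ) (x₀ : M) (θ₀ : Θ) :
    ContMDiffOn 𝓘(ℝ, Eu d × Eu n) ((𝓡 d).prod (𝓡 n)) r
      ((chartAt (Eu d) x₀).prod (chartAt (Eu n) θ₀)).symm
      ((chartAt (Eu d) x₀).prod (chartAt (Eu n) θ₀)).target := by
  have := isManifold_nat (d := d) (M := M) r
  have := isManifold_nat (d := n) (M := Θ) r
  exact ((contMDiffOn_chart_symm (I := 𝓡 d) (x := x₀) (n := r)).comp
      (contDiff_fst.contMDiff (E := Eu d × Eu n)).contMDiffOn fun z hz => hz.1).prodMk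
    ((contMDiffOn_chart_symm (I := 𝓡 n) (x := θ₀) (n := r)).comp
      (contDiff_snd.contMDiff (E := Eu d × Eu n)).contMDiffOn fun z hz => hz.2)

theorem contDiffOn_familyInCharts {r : ℕ} {Φ : M × Θ → M}
    (hΦ : ContMDiff ((𝓡 d).prod (𝓡 n)) (𝓡 d) r Φ) (x₀ : M) (θ₀ : Θ) (q : M) :
    ContDiffOn ℝ r (familyInCharts Φ x₀ θ₀ q)
      (((chartAt (Eu d) x₀).prod (chartAt (Eu n) θ₀)).target ∩
        ((chartAt (Eu d) x₀).prod (chartAt (Eu n) θ₀)).symm ⁻¹'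
          (Φ ⁻¹' (chartAt (Eu d) q).source)) := by
  have := isManifold_nat (d := d) (M := M) r
  rw [← contMDiffOn_iff_contDiffOn]
  exact (contMDiffOn_chart (I := 𝓡 d) (x := q)).comp
    (hΦ.comp_contMDiffOn ((contMDiffOn_prod_chart_symm r x₀ θ₀).mono inter_subset_left))
    fun y hy => hy.2

theorem surjective_fderiv_familyInCharts {r : ℕ} (hr : 1 ≤ r) {Φ : M × Θ → M}
    (hΦ : ContMDiff ((𝓡 d).prod (𝓡 n)) (𝓡 d) r Φ) {x₀ : M} {θ₀ : Θ}
    (hs : Function.Surjective (mfderiv (𝓡 n) (𝓡 d) (fun θ : Θ => Φ (x₀, θ)) θ₀)) :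
    Function.Surjective ((fderiv ℝ (familyInCharts Φ x₀ θ₀ (Φ (x₀, θ₀)))
      (chartAt (Eu d) x₀ x₀, chartAt (Eu n) θ₀ θ₀)).comp
        (ContinuousLinearMap.inr ℝ (Eu d) (Eu n))) := by
  have hr0 : (r : ℕ∞ω) ≠ 0 := by exact_mod_cast (by omega : r ≠ 0)
  set q := Φ (x₀, θ₀) with hq
  set F : Eu d × Eu n → Eu d := familyInCharts Φ x₀ θ₀ q with hF
  have ht : chartAt (Eu n) θ₀ θ₀ ∈ (chartAt (Eu n) θ₀).target :=
    mem_chart_target (Eu n) θ₀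
  have hOo : IsOpen (((chartAt (Eu d) x₀).prod (chartAt (Eu n) θ₀)).target ∩
        ((chartAt (Eu d) x₀).prod (chartAt (Eu n) θ₀)).symm ⁻¹'
          (Φ ⁻¹' (chartAt (Eu d) q).source)) :=
    ((chartAt (Eu d) x₀).prod (chartAt (Eu n) θ₀)).isOpen_inter_preimage_symm
      ((chartAt (Eu d) q).open_source.preimage hΦ.continuous)
  have hz : (chartAt (Eu d) x₀ x₀, chartAt (Eu n) θ₀ θ₀) ∈
      ((chartAt (Eu d) x₀).prod (chartAt (Eu n) θ₀)).target ∩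
        ((chartAt (Eu d) x₀).prod (chartAt (Eu n) θ₀)).symm ⁻¹'
          (Φ ⁻¹' (chartAt (Eu d) q).source) := by
    refine ⟨⟨mem_chart_target _ _, ht⟩, ?_⟩
    simp [hq]
  have hFd : DifferentiableAt ℝ F (chartAt (Eu d) x₀ x₀, chartAt (Eu n) θ₀ θ₀) :=
    ((contDiffOn_familyInCharts hΦ x₀ θ₀ q).contDiffAt (hOo.mem_nhds hz)).differentiableAt hr0
  have h1 : HasFDerivAt (fun t => F (chartAt (Eu d) x₀ x₀, t))
      ((fderiv ℝ F (chartAt (Eu d) x₀ x₀, chartAt (Eu n) θ₀ θ₀)).comp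
        (ContinuousLinearMap.inr ℝ (Eu d) (Eu n))) (chartAt (Eu n) θ₀ θ₀) :=
    hFd.hasFDerivAt.comp _ (hasFDerivAt_prodMk_right _ _)
  have h2 : (fun t => F (chartAt (Eu d) x₀ x₀, t)) =
      chartAt (Eu d) q ∘ (fun θ => Φ (x₀, θ)) ∘ (chartAt (Eu n) θ₀).symm := by
    funext t
    simp [hF, familyInCharts]
  have hθ : (chartAt (Eu n) θ₀).symm (chartAt (Eu n) θ₀ θ₀) = θ₀ :=
    (chartAt (Eu n) θ₀).left_inv (mem_chart_source _ _)
  have hm1 : MDifferentiableAt (𝓡 n) (𝓡 n) (chartAt (Eu n) θ₀).symm (chartAt (Eu n) θ₀ θ₀) :=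
    (mdifferentiable_chart (I := 𝓡 n) θ₀).symm.mdifferentiableAt ht
  have hm2 : MDifferentiableAt (𝓡 n) (𝓡 d) (fun θ => Φ (x₀, θ))
      ((chartAt (Eu n) θ₀).symm (chartAt (Eu n) θ₀ θ₀)) :=
    (hΦ.comp (contMDiff_const.prodMk contMDiff_id)).mdifferentiable hr0 _
  have hm3 : MDifferentiableAt (𝓡 d) (𝓡 d) (chartAt (Eu d) q) q :=
    (mdifferentiable_chart (I := 𝓡 d) q).mdifferentiableAt (mem_chart_source _ _)
  have hm3' : MDifferentiableAt (𝓡 d) (𝓡 d) (chartAt (Eu d) q)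
      (((fun θ => Φ (x₀, θ)) ∘ (chartAt (Eu n) θ₀).symm) (chartAt (Eu n) θ₀ θ₀)) := by
    simpa only [Function.comp_apply, hθ] using hm3
  have h4 := hm3'.hasMFDerivAt.comp (chartAt (Eu n) θ₀ θ₀)
    (hm2.hasMFDerivAt.comp _ hm1.hasMFDerivAt)
  rw [← h2] at h4
  rw [h1.unique h4.hasFDerivAt]
  have h5 := (mdifferentiable_chart (I := 𝓡 n) θ₀).symm.mfderiv_surjective ht
  have h6 := (mdifferentiable_chart (I := 𝓡 d) q).mfderiv_surjective (mem_chart_source (Eu d) q)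
  have hs' : Function.Surjective (mfderiv (𝓡 n) (𝓡 d) (fun θ : Θ => Φ (x₀, θ))
      ((chartAt (Eu n) θ₀).symm (chartAt (Eu n) θ₀ θ₀))) := by
    rw [hθ]
    exact hs
  have h6' : Function.Surjective (mfderiv (𝓡 d) (𝓡 d) (chartAt (Eu d) q)
      (Φ (x₀, (chartAt (Eu n) θ₀).symm (chartAt (Eu n) θ₀ θ₀)))) := by
    rw [hθ]
    exact h6
  exact h6'.comp (hs'.comp h5)

variable [MeasurableSpace M] [BorelSpace M] [SecondCountableTopology M] [T2Space M]
  [MeasurableSpace Θ] [BorelSpace Θ] [SecondCountableTopology Θ] [T2Space Θ]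

/-- Near a point where `∂_θ Φ` is onto, a `C^{r-1}` density on `M × Θ` has a `C^{r-1}` image under
`Φ`. -/
theorem exists_nhds_density (g : RiemMetric d M) (gΘ : RiemMetric n Θ) {r : ℕ} (hr : 1 ≤ r)
    {Φ : M × Θ → M} (hΦ : ContMDiff ((𝓡 d).prod (𝓡 n)) (𝓡 d) r Φ) {x₀ : M} {θ₀ : Θ}
    (hs : Function.Surjective (mfderiv (𝓡 n) (𝓡 d) (fun θ : Θ => Φ (x₀, θ)) θ₀)) :
    ∃ W : Set (M × Θ), IsOpen W ∧ (x₀, θ₀) ∈ W ∧ ∀ H : M × Θ → ℝ,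
      ContMDiff ((𝓡 d).prod (𝓡 n)) 𝓘(ℝ, ℝ) (r - 1 : ℕ) H → HasCompactSupport H →
      tsupport H ⊆ W → (∀ z, 0 ≤ H z) → ∀ (μ : Measure M) [IsFiniteMeasure μ],
      ∃ ρ : M → ℝ, ContMDiff (𝓡 d) 𝓘(ℝ, ℝ) (r - 1 : ℕ) ρ ∧ (∀ x, 0 ≤ ρ x) ∧
        ∀ η : M → ℝ≥0∞, Measurable η →
          ∫⁻ x, (∫⁻ θ, ENNReal.ofReal (H (x, θ)) * η (Φ (x, θ)) ∂(riemMeasure gΘ)) ∂μ =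
            ∫⁻ y, ENNReal.ofReal (ρ y) * η y ∂(riemMeasure g) := by
  have := isManifold_nat (d := d) (M := M) (r - 1)
  set q : M := Φ (x₀, θ₀) with hq
  set eM := chartAt (Eu d) x₀ with heM
  set eΘ := chartAt (Eu n) θ₀ with heΘ
  set eq := chartAt (Eu d) q with heq
  set e := eM.prod eΘ with he
  set F : Eu d × Eu n → Eu d := familyInCharts Φ x₀ θ₀ q with hF
  have hO : IsOpen (e.target ∩ e.symm ⁻¹' (Φ ⁻¹' eq.source)) :=
    e.isOpen_inter_preimage_symm (eq.open_source.preimage hΦ.continuous)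
  have hx₀ : eM.symm (eM x₀) = x₀ := eM.left_inv (mem_chart_source _ _)
  have hθ₀ : eΘ.symm (eΘ θ₀) = θ₀ := eΘ.left_inv (mem_chart_source _ _)
  have hesymm : ∀ x t, e.symm (x, t) = (eM.symm x, eΘ.symm t) := fun _ _ => rfl
  have hz₀ : (eM x₀, eΘ θ₀) ∈ e.target ∩ e.symm ⁻¹' (Φ ⁻¹' eq.source) := by
    refine ⟨⟨mem_chart_target _ _, mem_chart_target (Eu n) θ₀⟩, ?_⟩
    rw [mem_preimage, mem_preimage, hesymm, hx₀, hθ₀]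
    exact mem_chart_source _ _
  have hFz₀ : F (eM x₀, eΘ θ₀) ∈ eq.target := by
    exact eq.map_source hz₀.2
  obtain ⟨W, hWO, hW, hz₀W, hdens⟩ := exists_density_of_surjective hr hO
    (contDiffOn_familyInCharts hΦ x₀ θ₀ q) hz₀ (surjective_fderiv_familyInCharts hr hΦ hs)
    eq.open_target hFz₀
  refine ⟨e.source ∩ e ⁻¹' W, e.isOpen_inter_preimage hW,
    ⟨⟨mem_chart_source _ _, mem_chart_source (Eu n) θ₀⟩, hz₀W⟩,
    fun H hH hHc hHW hH0 μ _ => ?_⟩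
  have hHs : tsupport H ⊆ e.source := hHW.trans inter_subset_left
  -- the density in coordinates, with respect to Lebesgue measure in `θ`
  set H' : Eu d × Eu n → ℝ := transport e H with hH'
  have hH's : ContDiff ℝ (r - 1 : ℕ) H' := contMDiff_iff_contDiff.1
    (contMDiff_transport (contMDiffOn_prod_chart_symm _ x₀ θ₀) hH hHc hHs)
  set w : Eu d × Eu n → ℝ := fun z => H' z * chartDensity gΘ θ₀ z.2 with hw
  have hwt : tsupport w ⊆ tsupport H' := closure_mono fun p hp => left_ne_zero_of_mul hp
  have hwe : tsupport w ⊆ e.target := hwt.trans (tsupport_transport_subset_target hHc hHs)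
  have hws : ContDiff ℝ (r - 1 : ℕ) w := by
    refine contDiff_of_forall_tsupport fun z hz => hH's.contDiffAt.mul ?_
    have h1 := ((contDiffOn_chartDensity gΘ θ₀).of_le (natCast_le_infty (r - 1))).contDiffAt
      (eΘ.open_target.mem_nhds (hwe hz).2)
    exact h1.comp z contDiffAt_snd
  have hwW : tsupport w ⊆ W := by
    refine (hwt.trans (tsupport_transport_subset hHc hHs)).trans ?_
    rintro _ ⟨z, hz, rfl⟩
    exact (hHW hz).2
  have hw0 : ∀ z, 0 ≤ w z := fun z =>
    mul_nonneg (transport_nonneg e hH0 z) (Real.sqrt_nonneg _)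
  have heMm : AEMeasurable eM (μ.restrict eM.source) :=
    eM.continuousOn.aemeasurable eM.open_source.measurableSet
  obtain ⟨κ, hκs, hκc, hκt, hκ0, hκη⟩ := hdens w hws
    ((hasCompactSupport_transport hHc hHs).mul_right) hwW hw0 ((μ.restrict eM.source).map eM)
  -- the density on `M`: the one in coordinates, relative to the Riemannian measure
  set κ' : Eu d → ℝ := fun y => κ y * (chartDensity g q y)⁻¹ with hκ'
  have hκ't : tsupport κ' ⊆ tsupport κ := closure_mono fun p hp => left_ne_zero_of_mul hp
  have hκ's : ContDiff ℝ (r - 1 : ℕ) κ' := by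
    refine contDiff_of_forall_tsupport fun y hy => hκs.contDiffAt.mul ?_
    have hyt := hκt (hκ't hy)
    exact (((contDiffOn_chartDensity g q).of_le (natCast_le_infty (r - 1))).contDiffAt
      (eq.open_target.mem_nhds hyt)).inv (chartDensity_pos g hyt).ne'
  have hκ'0 : ∀ y, 0 ≤ κ' y := fun y => mul_nonneg (hκ0 y) (inv_nonneg.2 (Real.sqrt_nonneg _))
  have hρs : ContMDiff (𝓡 d) 𝓘(ℝ, ℝ) (r - 1 : ℕ) (transport eq.symm κ') :=
    contMDiff_transport (I := 𝓘(ℝ, Eu d)) (contMDiffOn_chart (I := 𝓡 d) (x := q))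
      (contMDiff_iff_contDiff.2 hκ's) hκc.mul_right (hκ't.trans hκt)
  refine ⟨transport eq.symm κ', hρs, transport_nonneg _ hκ'0, fun η hη => ?_⟩
  classical
  set η' : Eu d → ℝ≥0∞ := fun y => η (eq.target.piecewise eq.symm (fun _ => q) y) with hη'
  have hη'm : Measurable η' := hη.comp
    (eq.continuousOn_symm.measurable_piecewise continuousOn_const eq.open_target.measurableSet)
  have hη't : ∀ y ∈ eq.target, η' y = η (eq.symm y) := fun y hy => by simp [hη', hy]
  have hGm : Measurable fun z => ENNReal.ofReal (w z) * η' (F z) :=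
    measurable_mul_comp hws.continuous hO (contDiffOn_familyInCharts hΦ x₀ θ₀ q).continuousOn
      (hwW.trans hWO) hη'm
  have hHm : ∀ x, Measurable fun θ => ENNReal.ofReal (H (x, θ)) * η (Φ (x, θ)) := fun x =>
    ((hH.continuous.comp (Continuous.prodMk_right x)).measurable.ennreal_ofReal).mul
      (hη.comp (hΦ.continuous.comp (Continuous.prodMk_right x)).measurable)
  have hH0' : ∀ x θ, (x, θ) ∉ e.source → H (x, θ) = 0 := fun x θ h =>
    image_eq_zero_of_notMem_tsupport fun h' => h (hHs h')
  calc ∫⁻ x, (∫⁻ θ, ENNReal.ofReal (H (x, θ)) * η (Φ (x, θ)) ∂(riemMeasure gΘ)) ∂μ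
      = ∫⁻ x in eM.source,
          (∫⁻ θ, ENNReal.ofReal (H (x, θ)) * η (Φ (x, θ)) ∂(riemMeasure gΘ)) ∂μ := by
        refine (setLIntegral_eq_of_support_subset fun x hx => ?_).symm
        by_contra h
        exact hx (by simp [fun θ => hH0' x θ fun h' => h h'.1])
    _ = ∫⁻ x in eM.source, (∫⁻ t, ENNReal.ofReal (w (eM x, t)) * η' (F (eM x, t))) ∂μ := by
        refine setLIntegral_congr_fun eM.open_source.measurableSet fun x hx => ?_
        calc ∫⁻ θ, ENNReal.ofReal (H (x, θ)) * η (Φ (x, θ)) ∂(riemMeasure gΘ)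
            = ∫⁻ θ in eΘ.source, ENNReal.ofReal (H (x, θ)) * η (Φ (x, θ)) ∂(riemMeasure gΘ) := by
              refine (setLIntegral_eq_of_support_subset fun θ hθ => ?_).symm
              by_contra h
              exact hθ (by simp [hH0' x θ fun h' => h h'.2])
          _ = ∫⁻ t in eΘ.target, ENNReal.ofReal (chartDensity gΘ θ₀ t) *
                (ENNReal.ofReal (H (x, eΘ.symm t)) * η (Φ (x, eΘ.symm t))) :=
              lintegral_riemMeasure_source gΘ θ₀ (hHm x).aemeasurable
          _ = ∫⁻ t in eΘ.target, ENNReal.ofReal (w (eM x, t)) * η' (F (eM x, t)) := by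
              refine setLIntegral_congr_fun eΘ.open_target.measurableSet fun t ht => ?_
              have hxt : (x, eΘ.symm t) ∈ e.source := ⟨hx, eΘ.map_target ht⟩
              have h1 : H' (eM x, t) = H (x, eΘ.symm t) := by
                have h2 := transport_apply H hxt
                rwa [show e (x, eΘ.symm t) = (eM x, t) from
                  Prod.ext rfl (eΘ.right_inv ht)] at h2
              simp only [hw, h1]
              rw [mul_comm (H _), ENNReal.ofReal_mul (chartDensity_pos gΘ ht).le, mul_assoc]
              by_cases h0 : H (x, eΘ.symm t) = 0
              · simp [h0]
              · have h3 := hWO (hHW (subset_tsupport _ h0)).2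
                have h4 : Φ (x, eΘ.symm t) ∈ eq.source := by
                  have h5 := h3.2
                  rw [mem_preimage, mem_preimage, e.left_inv hxt] at h5
                  exact h5
                have h6 : F (eM x, t) = eq (Φ (x, eΘ.symm t)) := by
                  simp only [hF, familyInCharts, Function.comp_apply]
                  rw [← he, hesymm, eM.left_inv hx]
                rw [h6, hη't _ (eq.map_source h4), eq.left_inv h4]
          _ = ∫⁻ t, ENNReal.ofReal (w (eM x, t)) * η' (F (eM x, t)) := by
              refine setLIntegral_eq_of_support_subset fun t ht => ?_
              by_contra h
              refine ht ?_
              have : w (eM x, t) = 0 :=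
                image_eq_zero_of_notMem_tsupport fun h' => h (hwe h').2
              simp [this]
    _ = ∫⁻ x, (∫⁻ t, ENNReal.ofReal (w (x, t)) * η' (F (x, t))) ∂((μ.restrict eM.source).map eM) :=
        (lintegral_map' hGm.lintegral_prod_right'.aemeasurable heMm).symm
    _ = ∫⁻ y, ENNReal.ofReal (κ y) * η' y := hκη η' hη'm
    _ = ∫⁻ y in eq.target, ENNReal.ofReal (κ y) * η' y := by
        refine (setLIntegral_eq_of_support_subset fun y hy => hκt (subset_tsupport _ ?_)).symm
        intro h0
        exact hy (by simp [h0])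
    _ = ∫⁻ y in eq.target, ENNReal.ofReal (chartDensity g q y) *
          (ENNReal.ofReal (transport eq.symm κ' (eq.symm y)) * η (eq.symm y)) := by
        refine setLIntegral_congr_fun eq.open_target.measurableSet fun y hy => ?_
        have h1 : transport eq.symm κ' (eq.symm y) = κ' y := transport_apply κ' hy
        simp only [h1, hη't y hy]
        have h2 := chartDensity_pos g hy
        rw [← mul_assoc, ← ENNReal.ofReal_mul h2.le,
          show chartDensity g q y * κ' y = κ y by simp only [hκ']; field_simp]
    _ = ∫⁻ y in eq.source, ENNReal.ofReal (transport eq.symm κ' y) * η y ∂(riemMeasure g) :=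
        (lintegral_riemMeasure_source g q
          (hρs.continuous.measurable.ennreal_ofReal.mul hη).aemeasurable).symm
    _ = ∫⁻ y, ENNReal.ofReal (transport eq.symm κ' y) * η y ∂(riemMeasure g) := by
        refine setLIntegral_eq_of_support_subset fun y hy => ?_
        by_contra h
        refine hy ?_
        have : transport eq.symm κ' y = 0 := indicator_of_notMem h _
        simp [this]

/-- If `θ` has a compactly supported `C^r` density, `Φ` is of class `C^r` and `∂_θ Φ` is onto, then
`Φ (x, θ)` has a `C^{r-1}` density, whatever the law `μ` of `x`. A partition of unity on
`M × Θ` reduces this to densities with small supports. -/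
theorem exists_density_of_submersive_family [CompactSpace M] (g : RiemMetric d M)
    (gΘ : RiemMetric n Θ) {r : ℕ} (hr : 1 ≤ r) {Φ : M × Θ → M}
    (hΦ : ContMDiff ((𝓡 d).prod (𝓡 n)) (𝓡 d) r Φ) {h : Θ → ℝ} (hh : ContMDiff (𝓡 n) 𝓘(ℝ, ℝ) r h)
    (hh0 : ∀ θ, 0 ≤ h θ) (hhc : HasCompactSupport h)
    (hs : ∀ x : M, ∀ θ ∈ tsupport h,
      Function.Surjective (mfderiv (𝓡 n) (𝓡 d) (fun θ' : Θ => Φ (x, θ')) θ))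
    (μ : Measure M) [IsFiniteMeasure μ] :
    ∃ ρ : M → ℝ, ContMDiff (𝓡 d) 𝓘(ℝ, ℝ) (r - 1 : ℕ) ρ ∧ (∀ x, 0 ≤ ρ x) ∧
      ∀ η : M → ℝ≥0∞, Measurable η →
        ∫⁻ x, (∫⁻ θ, ENNReal.ofReal (h θ) * η (Φ (x, θ)) ∂(riemMeasure gΘ)) ∂μ =
          ∫⁻ y, ENNReal.ofReal (ρ y) * η y ∂(riemMeasure g) := by
  have hr3 : ((r - 1 : ℕ) : ℕ∞ω) ≤ r := by exact_mod_cast Nat.sub_le r 1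
  have : LocallyCompactSpace M := ChartedSpace.locallyCompactSpace (Eu d) M
  have : LocallyCompactSpace Θ := ChartedSpace.locallyCompactSpace (Eu n) Θ
  have hKc : IsCompact ((univ : Set M) ×ˢ tsupport h) := isCompact_univ.prod hhc.isCompact
  choose! W hW using fun z (hz : z ∈ (univ : Set M) ×ˢ tsupport h) =>
    exists_nhds_density g gΘ hr hΦ (hs z.1 z.2 hz.2)
  obtain ⟨t, htK, htW⟩ := hKc.elim_nhds_subcover W
    fun z hz => (hW z hz).1.mem_nhds (hW z hz).2.1
  obtain ⟨f, hf⟩ := SmoothPartitionOfUnity.exists_isSubordinate ((𝓡 d).prod (𝓡 n)) hKc.isClosed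
    (fun i : t => W i.1) (fun i => (hW i.1 (htK i.1 i.2)).1) fun z hz => by
      obtain ⟨i, hi, hzi⟩ := mem_iUnion₂.1 (htW hz)
      exact mem_iUnion.2 ⟨⟨i, hi⟩, hzi⟩
  set H : t → M × Θ → ℝ := fun i z => f i z * h z.2 with hH
  have hHs : ∀ i, ContMDiff ((𝓡 d).prod (𝓡 n)) 𝓘(ℝ, ℝ) (r - 1 : ℕ) (H i) := fun i =>
    ((f i).contMDiff.of_le (natCast_le_infty (r - 1))).mul ((hh.of_le hr3).comp contMDiff_snd)
  have hHK : ∀ i, tsupport (H i) ⊆ (univ : Set M) ×ˢ tsupport h := fun i =>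
    closure_minimal (fun z hz => ⟨mem_univ _, subset_tsupport _ (right_ne_zero_of_mul hz)⟩)
      hKc.isClosed
  have hHc : ∀ i, HasCompactSupport (H i) := fun i =>
    hKc.of_isClosed_subset (isClosed_tsupport _) (hHK i)
  have hHW : ∀ i : t, tsupport (H i) ⊆ W i.1 := fun i =>
    (closure_mono fun z hz => left_ne_zero_of_mul hz).trans (hf i)
  have hH0 : ∀ i z, 0 ≤ H i z := fun i z => mul_nonneg (f.nonneg i z) (hh0 _)
  have hHsum : ∀ x θ, ∑ i, H i (x, θ) = h θ := by
    intro x θ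
    simp only [hH, ← Finset.sum_mul]
    by_cases hθ : θ ∈ tsupport h
    · have := f.sum_eq_one (show (x, θ) ∈ (univ : Set M) ×ˢ tsupport h from ⟨mem_univ _, hθ⟩)
      rw [finsum_eq_sum_of_fintype] at this
      rw [this, one_mul]
    · rw [image_eq_zero_of_notMem_tsupport hθ, mul_zero]
  choose ρ hρs hρ0 hρη using fun i : t =>
    (hW i.1 (htK i.1 i.2)).2.2 (H i) (hHs i) (hHc i) (hHW i) (hH0 i) μ
  refine ⟨fun x => ∑ i, ρ i x, contMDiff_finsetSum fun i _ => hρs i,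
    fun x => Finset.sum_nonneg fun i _ => hρ0 i x, fun η hη => ?_⟩
  have hm : ∀ i, Measurable fun z : M × Θ => ENNReal.ofReal (H i z) * η (Φ z) := fun i =>
    (hHs i).continuous.measurable.ennreal_ofReal.mul (hη.comp hΦ.continuous.measurable)
  have := isLocallyFiniteMeasure_riemMeasure gΘ
  calc ∫⁻ x, (∫⁻ θ, ENNReal.ofReal (h θ) * η (Φ (x, θ)) ∂(riemMeasure gΘ)) ∂μ
      = ∫⁻ x, ∑ i, (∫⁻ θ, ENNReal.ofReal (H i (x, θ)) * η (Φ (x, θ)) ∂(riemMeasure gΘ)) ∂μ := by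
        refine lintegral_congr fun x => ?_
        refine Eq.trans (lintegral_congr fun θ => ?_) (lintegral_finsetSum Finset.univ
          (f := fun i θ => ENNReal.ofReal (H i (x, θ)) * η (Φ (x, θ)))
          fun i _ => (hm i).comp measurable_prodMk_left)
        rw [← Finset.sum_mul, ← ENNReal.ofReal_sum_of_nonneg fun i _ => hH0 i _, hHsum]
    _ = ∑ i, ∫⁻ y, ENNReal.ofReal (ρ i y) * η y ∂(riemMeasure g) := by
        rw [lintegral_finsetSum _ fun i _ => (hm i).lintegral_prod_right']
        exact Finset.sum_congr rfl fun i _ => hρη i η hη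
    _ = ∫⁻ y, ENNReal.ofReal (∑ i, ρ i y) * η y ∂(riemMeasure g) := by
        refine Eq.trans (lintegral_finsetSum Finset.univ
          (f := fun i y => ENNReal.ofReal (ρ i y) * η y) fun i _ =>
          (hρs i).continuous.measurable.ennreal_ofReal.mul hη).symm (lintegral_congr fun y => ?_)
        rw [ENNReal.ofReal_sum_of_nonneg fun i _ => hρ0 i _, Finset.sum_mul]

end SubmersiveFamily

/-! ### Duality of the averaged transfer operator -/

section Duality

variable {d : ℕ} {M : Type*} [TopologicalSpace M] [ChartedSpace (Eu d) M]
  [IsManifold (𝓡 d) ∞ M] [MeasurableSpace M] [BorelSpace M] [SecondCountableTopology M]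
  [T2Space M] [CompactSpace M] {r : ℕ}

theorem measurable_indicator_transfer_uncurry (g : RiemMetric d M) (hr : 1 ≤ r) {ρ : M → ℝ}
    (hρ : Continuous ρ) : Measurable fun z : M × C^r⟮𝓡 d, M; 𝓡 d, M⟯ =>
      (diffLoc d M r).indicator (fun φ => transfer g φ ρ z.1) z.2 := by
  refine measurable_uncurry_of_continuous_of_measurable
    (u := fun (y : M) (φ : C^r⟮𝓡 d, M; 𝓡 d, M⟯) =>
      (diffLoc d M r).indicator (fun φ => transfer g φ ρ y) φ) (fun φ => ?_)
    (fun y => measurable_indicator_transfer g hr hρ y)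
  by_cases hφ : φ ∈ diffLoc d M r
  · simpa [hφ] using continuous_transfer g hr hφ hρ
  · simpa [hφ] using continuous_const

/-- Integrability on `M × C^r(M, M)`, for a density `ρ` that is merely continuous. -/
theorem integrable_indicator_transfer_of_nonneg (g : RiemMetric d M) (hr : 1 ≤ r)
    (ν : Measure C^r⟮𝓡 d, M; 𝓡 d, M⟯) [IsFiniteMeasure ν] {ρ : M → ℝ} (hρ : Continuous ρ)
    (hρ0 : ∀ x, 0 ≤ ρ x) : Integrable (fun z : M × C^r⟮𝓡 d, M; 𝓡 d, M⟯ =>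
      (diffLoc d M r).indicator (fun φ => transfer g φ ρ z.1) z.2) ((riemMeasure g).prod ν) := by
  have := isFiniteMeasure_riemMeasure g
  have hm := measurable_indicator_transfer_uncurry g hr hρ
  refine ⟨hm.aestronglyMeasurable, ?_⟩
  rw [HasFiniteIntegral, lintegral_prod_symm _ hm.enorm.aemeasurable]
  calc ∫⁻ φ, (∫⁻ y, ‖(diffLoc d M r).indicator (fun φ => transfer g φ ρ y) φ‖ₑ ∂(riemMeasure g)) ∂ν
      ≤ ∫⁻ _, (∫⁻ x, ENNReal.ofReal (ρ x) ∂(riemMeasure g)) ∂ν := by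
        refine lintegral_mono fun φ => ?_
        by_cases hφ : φ ∈ diffLoc d M r
        -- the duality with `η = 1`: `L_φ` preserves the integral of `ρ`
        · have h := lintegral_transfer g hr φ.contMDiff hφ hρ hρ0 (η := fun _ => 1)
            measurable_const
          simp only [mul_one] at h
          simp only [hφ, indicator_of_mem, ← h]
          exact le_of_eq (lintegral_congr fun y =>
            Real.enorm_eq_ofReal (transfer_nonneg g φ hρ0 y))
        · simp [hφ]
    _ < ⊤ := by
        rw [lintegral_const]
        exact ENNReal.mul_lt_top
          (hρ.integrable_of_hasCompactSupport
            (HasCompactSupport.of_compactSpace ρ)).lintegral_lt_top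
          (measure_lt_top _ _)

theorem integrable_indicator_transfer (g : RiemMetric d M) (hr : 1 ≤ r)
    (ν : Measure C^r⟮𝓡 d, M; 𝓡 d, M⟯) [IsFiniteMeasure ν] {ρ : M → ℝ} (hρ : Continuous ρ) :
    Integrable (fun z : M × C^r⟮𝓡 d, M; 𝓡 d, M⟯ =>
      (diffLoc d M r).indicator (fun φ => transfer g φ ρ z.1) z.2) ((riemMeasure g).prod ν) := by
  have h := (integrable_indicator_transfer_of_nonneg g hr ν (hρ.max continuous_const)
    (fun x => le_max_right _ _)).sub (integrable_indicator_transfer_of_nonneg g hr ν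
      (hρ.neg.max continuous_const) (fun x => le_max_right _ _))
  convert h using 1
  funext z
  by_cases hφ : z.2 ∈ diffLoc d M r
  · simp [hφ, transfer_eq_posPart_sub_negPart g hr hφ ρ]
  · simp [hφ]

theorem integrable_mul_of_continuous (g : RiemMetric d M) {ρ η : M → ℝ} (hρ : Continuous ρ)
    (hη : Measurable η) {C : ℝ} (hC : ∀ x, |η x| ≤ C) :
    Integrable (fun x => ρ x * η x) (riemMeasure g) := by
  have := isFiniteMeasure_riemMeasure g
  exact (hρ.integrable_of_hasCompactSupport (HasCompactSupport.of_compactSpace ρ)).mul_bdd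
    hη.aestronglyMeasurable (ae_of_all _ hC)

theorem integral_transfer_mul_of_nonneg (g : RiemMetric d M) (hr : 1 ≤ r)
    {φ : C^r⟮𝓡 d, M; 𝓡 d, M⟯} (hφ : φ ∈ diffLoc d M r) {ρ : M → ℝ} (hρ : Continuous ρ)
    (hρ0 : ∀ x, 0 ≤ ρ x) {η : M → ℝ} (hη : Measurable η) :
    ∫ y, transfer g φ ρ y * η y ∂(riemMeasure g) = ∫ x, ρ x * η (φ x) ∂(riemMeasure g) := by
  have hφm : Measurable φ := φ.contMDiff.continuous.measurable
  have hL := continuous_transfer g hr hφ hρ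
  have h1 : ((riemMeasure g).withDensity fun x => ENNReal.ofReal (ρ x)).map φ =
      (riemMeasure g).withDensity fun y => ENNReal.ofReal (transfer g φ ρ y) := by
    ext s hs
    rw [Measure.map_apply hφm hs, withDensity_apply _ (hφm hs), withDensity_apply _ hs,
      ← lintegral_indicator (hφm hs), ← lintegral_indicator hs]
    have h := lintegral_transfer g hr φ.contMDiff hφ hρ hρ0 (measurable_one.indicator hs)
    convert h.symm using 2
    · funext x
      by_cases hx : φ x ∈ s <;> simp [hx]
    · funext x
      by_cases hx : x ∈ s <;> simp [hx]
  have h2 := integral_map (μ := (riemMeasure g).withDensity fun x => ENNReal.ofReal (ρ x))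
    hφm.aemeasurable (f := η) hη.aestronglyMeasurable
  rw [h1, integral_withDensity_eq_integral_toReal_smul hL.measurable.ennreal_ofReal
      (ae_of_all _ fun _ => ENNReal.ofReal_lt_top),
    integral_withDensity_eq_integral_toReal_smul hρ.measurable.ennreal_ofReal
      (ae_of_all _ fun _ => ENNReal.ofReal_lt_top)] at h2
  simpa only [smul_eq_mul, ENNReal.toReal_ofReal (hρ0 _),
    ENNReal.toReal_ofReal (transfer_nonneg g φ hρ0 _)] using h2

theorem integral_transfer_mul (g : RiemMetric d M) (hr : 1 ≤ r)
    {φ : C^r⟮𝓡 d, M; 𝓡 d, M⟯} (hφ : φ ∈ diffLoc d M r) {ρ : M → ℝ} (hρ : Continuous ρ)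
    {η : M → ℝ} (hη : Measurable η) {C : ℝ} (hC : ∀ x, |η x| ≤ C) :
    ∫ y, transfer g φ ρ y * η y ∂(riemMeasure g) = ∫ x, ρ x * η (φ x) ∂(riemMeasure g) := by
  have hφm : Measurable φ := φ.contMDiff.continuous.measurable
  have hp : Continuous fun x => max (ρ x) 0 := hρ.max continuous_const
  have hn : Continuous fun x => max (-ρ x) 0 := hρ.neg.max continuous_const
  have hρe : ∀ x, ρ x = max (ρ x) 0 - max (-ρ x) 0 := fun x => by
    rcases le_total (ρ x) 0 with h | h <;> simp [h]
  have e1 : ∀ x, ρ x * η (φ x) = max (ρ x) 0 * η (φ x) - max (-ρ x) 0 * η (φ x) := fun x => by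
    rw [← sub_mul, ← hρe]
  have hηφ : Measurable fun x => η (φ x) := hη.comp hφm
  simp only [transfer_eq_posPart_sub_negPart g hr hφ ρ, sub_mul, e1]
  rw [integral_sub (integrable_mul_of_continuous g (continuous_transfer g hr hφ hp) hη hC)
      (integrable_mul_of_continuous g (continuous_transfer g hr hφ hn) hη hC),
    integral_sub (integrable_mul_of_continuous g hp hηφ fun x => hC _)
      (integrable_mul_of_continuous g hn hηφ fun x => hC _),
    integral_transfer_mul_of_nonneg g hr hφ hp (fun x => le_max_right _ _) hη,
    integral_transfer_mul_of_nonneg g hr hφ hn (fun x => le_max_right _ _) hη]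

/-- The averaged transfer operator is dual to the Markov operator `η ↦ ∫ η (φ ·) ν(dφ)`. -/
theorem integral_avgTransfer_mul (g : RiemMetric d M) (hr : 1 ≤ r)
    (ν : Measure C^r⟮𝓡 d, M; 𝓡 d, M⟯) [IsFiniteMeasure ν] {ρ : M → ℝ} (hρ : Continuous ρ)
    {η : M → ℝ} (hη : Measurable η) {C : ℝ} (hC : ∀ x, |η x| ≤ C) :
    ∫ y, avgTransfer g ν ρ y * η y ∂(riemMeasure g) =
      ∫ x, ρ x * (∫ φ in diffLoc d M r, η (φ x) ∂ν) ∂(riemMeasure g) := by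
  have := isFiniteMeasure_riemMeasure g
  have hDm : MeasurableSet (diffLoc d M r) := (isOpen_diffLoc hr).measurableSet
  have hint1 : Integrable (fun z : M × C^r⟮𝓡 d, M; 𝓡 d, M⟯ =>
      (diffLoc d M r).indicator (fun φ => transfer g φ ρ z.1) z.2 * η z.1)
      ((riemMeasure g).prod ν) :=
    (integrable_indicator_transfer g hr ν hρ).mul_bdd
      (hη.comp measurable_fst).aestronglyMeasurable (ae_of_all _ fun z => hC _)
  have hint2 : Integrable (fun z : M × C^r⟮𝓡 d, M; 𝓡 d, M⟯ => ρ z.1 * η (z.2 z.1))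
      ((riemMeasure g).prod (ν.restrict (diffLoc d M r))) := by
    refine Integrable.mul_bdd ?_ (hη.comp measurable_eval).aestronglyMeasurable
      (ae_of_all _ fun z => hC _)
    exact (hρ.integrable_of_hasCompactSupport (HasCompactSupport.of_compactSpace ρ)).comp_fst _
  calc ∫ y, avgTransfer g ν ρ y * η y ∂(riemMeasure g)
      = ∫ y, (∫ φ, (diffLoc d M r).indicator (fun φ : C^r⟮𝓡 d, M; 𝓡 d, M⟯ => transfer g φ ρ y) φ *
          η y ∂ν) ∂(riemMeasure g) := by
        refine integral_congr_ae (ae_of_all _ fun y => ?_)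
        simp only [avgTransfer]
        rw [← integral_indicator hDm, integral_mul_const]
    _ = ∫ φ, (∫ y, (diffLoc d M r).indicator (fun φ : C^r⟮𝓡 d, M; 𝓡 d, M⟯ => transfer g φ ρ y) φ *
          η y ∂(riemMeasure g)) ∂ν := integral_integral_swap hint1
    _ = ∫ φ in diffLoc d M r, (∫ x, ρ x * η (φ x) ∂(riemMeasure g)) ∂ν := by
        rw [← integral_indicator hDm]
        refine integral_congr_ae (ae_of_all _ fun φ => ?_)
        by_cases hφ : φ ∈ diffLoc d M r
        · simpa [hφ] using integral_transfer_mul g hr hφ hρ hη hC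
        · simp [hφ]
    _ = ∫ x, (∫ φ in diffLoc d M r, ρ x * η (φ x) ∂ν) ∂(riemMeasure g) :=
        (integral_integral_swap hint2).symm
    _ = ∫ x, ρ x * (∫ φ in diffLoc d M r, η (φ x) ∂ν) ∂(riemMeasure g) := by
        simp only [integral_const_mul]

end Duality

/-! ### Invariant measures -/

section Invariant

variable {d : ℕ} {M : Type*} [TopologicalSpace M] [ChartedSpace (Eu d) M]
  [IsManifold (𝓡 d) ∞ M] [MeasurableSpace M] [BorelSpace M] [SecondCountableTopology M]
  [T2Space M] [CompactSpace M] {r : ℕ}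

theorem lintegral_measure_eval_map_fiberMap {n : ℕ} {Θ : Type*} [TopologicalSpace Θ]
    [ChartedSpace (Eu n) Θ] [MeasurableSpace Θ] [BorelSpace Θ]
    (m : Measure Θ) {h : Θ → ℝ≥0∞} (Φ : C^r⟮(𝓡 d).prod (𝓡 n), M × Θ; 𝓡 d, M⟯)
    [IsProbabilityMeasure ((m.withDensity h).map fun θ => fiberMap Φ θ)]
    {s : Set M} (hs : MeasurableSet s) (x : M) :
    (m.withDensity h).map (fun θ => fiberMap Φ θ) {φ | φ x ∈ s} =
      ∫⁻ θ, h θ * s.indicator 1 (Φ (x, θ)) ∂m := by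
  -- the image under a map that is not almost everywhere measurable would be `0`
  have hae : AEMeasurable (fun θ => fiberMap Φ θ) (m.withDensity h) :=
    AEMeasurable.of_map_ne_zero (IsProbabilityMeasure.ne_zero _)
  have hΦ : Measurable fun θ => Φ (x, θ) :=
    (Φ.contMDiff.continuous.comp (Continuous.prodMk_right x)).measurable
  have hev : Measurable fun φ : C^r⟮𝓡 d, M; 𝓡 d, M⟯ => φ x :=
    measurable_eval.comp measurable_prodMk_left
  have hms : MeasurableSet ((fun θ => Φ (x, θ)) ⁻¹' s) := hΦ hs
  have hset : MeasurableSet {φ : C^r⟮𝓡 d, M; 𝓡 d, M⟯ | φ x ∈ s} := hev hs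
  rw [Measure.map_apply_of_aemeasurable hae hset]
  change m.withDensity h ((fun θ => Φ (x, θ)) ⁻¹' s) = _
  rw [withDensity_apply _ hms, ← lintegral_indicator hms]
  refine lintegral_congr fun θ => ?_
  by_cases hθ : Φ (x, θ) ∈ s <;> simp [hθ]

/-- The law of the next point, for a kernel induced by a convex combination. -/
theorem comp_inducedKernel_apply (a : ℝ) (ν₀ ν₁ : Measure C^r⟮𝓡 d, M; 𝓡 d, M⟯)
    [IsProbabilityMeasure ν₀] [IsProbabilityMeasure ν₁] (μ : Measure M)
    [IsProbabilityMeasure μ] {s : Set M} (hs : MeasurableSet s) :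
    μ.bind (inducedKernel (ENNReal.ofReal (1 - a) • ν₀ + ENNReal.ofReal a • ν₁)) s =
      ENNReal.ofReal (1 - a) * ∫⁻ x, ν₀ {φ | φ x ∈ s} ∂μ +
        ENNReal.ofReal a * (μ.prod ν₁).map (fun z => z.2 z.1) s := by
  have hms : MeasurableSet ((fun z : M × C^r⟮𝓡 d, M; 𝓡 d, M⟯ => z.2 z.1) ⁻¹' s) :=
    measurable_eval hs
  have h0 : Measurable fun x => ν₀ {φ : C^r⟮𝓡 d, M; 𝓡 d, M⟯ | φ x ∈ s} :=
    measurable_measure_prodMk_left hms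
  have h1 : Measurable fun x => ν₁ {φ : C^r⟮𝓡 d, M; 𝓡 d, M⟯ | φ x ∈ s} :=
    measurable_measure_prodMk_left hms
  rw [Measure.bind_apply hs (Kernel.aemeasurable _), Measure.map_apply measurable_eval hs,
    Measure.prod_apply hms, ← lintegral_const_mul _ h0]
  change _ = _ + ENNReal.ofReal a * ∫⁻ x, ν₁ {φ : C^r⟮𝓡 d, M; 𝓡 d, M⟯ | φ x ∈ s} ∂μ
  rw [← lintegral_const_mul _ h1, ← lintegral_add_left (h0.const_mul _)]
  refine lintegral_congr fun x => ?_
  have hev : Measurable fun φ : C^r⟮𝓡 d, M; 𝓡 d, M⟯ => φ x :=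
    measurable_eval.comp measurable_prodMk_left
  change (Measure.map (fun φ : C^r⟮𝓡 d, M; 𝓡 d, M⟯ => φ x) _) s = _
  rw [Measure.map_apply hev hs]
  rfl

/-- A signed measure `σ = μ - ρ m` with `σ = a P* σ` and `0 ≤ a < 1` vanishes, if `P` does not
increase the sup norm. -/
theorem integral_eq_of_contraction {X : Type*} [MeasurableSpace X] {m μ : Measure X}
    [IsProbabilityMeasure μ] {ρ : X → ℝ} (hρ : Integrable ρ m) {a : ℝ} (ha0 : 0 ≤ a) (ha1 : a < 1)
    (P : (X → ℝ) → X → ℝ)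
    (hPm : ∀ η : X → ℝ, Measurable η → Measurable (P η))
    (hPb : ∀ η : X → ℝ, (∀ x, |η x| ≤ 1) → ∀ x, |P η x| ≤ 1)
    (h : ∀ η : X → ℝ, Measurable η → (∀ x, |η x| ≤ 1) →
      ∫ x, η x ∂μ - ∫ x, ρ x * η x ∂m = a * (∫ x, P η x ∂μ - ∫ x, ρ x * P η x ∂m))
    {η : X → ℝ} (hη : Measurable η) (hη1 : ∀ x, |η x| ≤ 1) :
    ∫ x, η x ∂μ = ∫ x, ρ x * η x ∂m := by
  set C : ℝ := 1 + ∫ x, |ρ x| ∂m with hC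
  have hbound : ∀ k : ℕ, ∀ η : X → ℝ, Measurable η → (∀ x, |η x| ≤ 1) →
      |∫ x, η x ∂μ - ∫ x, ρ x * η x ∂m| ≤ a ^ k * C := by
    intro k
    induction k with
    | zero =>
      intro η hη hη1
      have h1 : |∫ x, η x ∂μ| ≤ 1 := by
        have := norm_integral_le_of_norm_le_const (μ := μ) (f := η) (ae_of_all _ hη1)
        simpa using this
      have h2 : |∫ x, ρ x * η x ∂m| ≤ ∫ x, |ρ x| ∂m := by
        refine norm_integral_le_of_norm_le (f := fun x => ρ x * η x) (g := fun x => |ρ x|) hρ.abs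
          (ae_of_all _ fun x => ?_)
        rw [Real.norm_eq_abs, abs_mul]
        exact mul_le_of_le_one_right (abs_nonneg _) (hη1 x)
      have h3 := abs_sub (∫ x, η x ∂μ) (∫ x, ρ x * η x ∂m)
      rw [pow_zero, one_mul]
      linarith
    | succ k ih =>
      intro η hη hη1
      rw [h η hη hη1, abs_mul, abs_of_nonneg ha0, pow_succ', mul_assoc]
      exact mul_le_mul_of_nonneg_left (ih _ (hPm η hη) (hPb η hη1)) ha0
  have hlim : Tendsto (fun k : ℕ => a ^ k * C) atTop (𝓝 0) := by
    simpa using (tendsto_pow_atTop_nhds_zero_of_lt_one ha0 ha1).mul_const C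
  have h0 := ge_of_tendsto' hlim fun k => hbound k η hη hη1
  exact sub_eq_zero.1 (abs_eq_zero.1 (le_antisymm h0 (abs_nonneg _)))

/-- If `μ A = ∫_A ρ dm` for all `A`, then the continuous function `ρ` is nonnegative and is the
density of `μ`. -/
theorem nonneg_and_eq_withDensity {X : Type*} [TopologicalSpace X] [MeasurableSpace X]
    [BorelSpace X] {m μ : Measure X} [m.IsOpenPosMeasure] [IsFiniteMeasure μ] {ρ : X → ℝ}
    (hρ : Continuous ρ) (hρi : Integrable ρ m)
    (h : ∀ s, MeasurableSet s → μ.real s = ∫ x in s, ρ x ∂m) :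
    (∀ x, 0 ≤ ρ x) ∧ μ = m.withDensity fun x => ENNReal.ofReal (ρ x) := by
  have hae : 0 ≤ᵐ[m] ρ := ae_nonneg_of_forall_setIntegral_nonneg hρi fun s hs _ => by
    rw [← h s hs]
    exact measureReal_nonneg
  have h0 : ∀ x, 0 ≤ ρ x := by
    have h1 : IsOpen {x | ρ x < 0} := isOpen_lt hρ continuous_const
    have h2 : m {x | ρ x < 0} = 0 := by
      have h3 := ae_iff.1 hae
      simpa using h3
    have h4 := h1.eq_empty_of_measure_zero h2
    intro x
    by_contra hx
    exact (h4 ▸ (not_le.1 hx : x ∈ {x | ρ x < 0}) : x ∈ (∅ : Set X))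
  refine ⟨h0, ?_⟩
  ext s hs
  rw [withDensity_apply _ hs, ← ofReal_integral_eq_lintegral_ofReal hρi.integrableOn
    (ae_of_all _ h0), ← h s hs, ofReal_measureReal]

end Invariant

end

theorem mainTheorem6
    -- the compact connected Riemannian manifold `M`
    {d : ℕ} {M : Type*} [TopologicalSpace M] [T2Space M] [SecondCountableTopology M]
    [ChartedSpace (EuclideanSpace ℝ (Fin d)) M] [IsManifold (𝓡 d) ∞ M]
    [CompactSpace M] [ConnectedSpace M] [MeasurableSpace M] [BorelSpace M]
    (g : RiemMetric d M)
    {r : ℕ} (hr : 1 ≤ r)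
    -- the laws of the random maps
    (a : ℝ) (ha0 : 0 < a) (ha1 : a < 1)
    (ν₀ ν₁ : Measure C^r⟮𝓡 d, M; 𝓡 d, M⟯) [IsProbabilityMeasure ν₀] [IsProbabilityMeasure ν₁]
    -- `ν₀` is the image of a `C^r` compactly supported density under a submersive `C^r` family
    {n : ℕ} (hdn : d ≤ n) {Θ : Type*} [TopologicalSpace Θ] [T2Space Θ]
    [SecondCountableTopology Θ] [ChartedSpace (EuclideanSpace ℝ (Fin n)) Θ]
    [IsManifold (𝓡 n) ∞ Θ] [MeasurableSpace Θ] [BorelSpace Θ]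
    (gΘ : RiemMetric n Θ)
    (h₀ : C^r⟮𝓡 n, Θ; ℝ⟯) (h₀_nonneg : ∀ θ, 0 ≤ h₀ θ) (h₀_supp : HasCompactSupport h₀)
    (h₀_prob : ∫⁻ θ, ENNReal.ofReal (h₀ θ) ∂(riemMeasure gΘ) = 1)
    (Φ : C^r⟮(𝓡 d).prod (𝓡 n), M × Θ; 𝓡 d, M⟯)
    (hν₀ : ν₀ = ((riemMeasure gΘ).withDensity fun θ => ENNReal.ofReal (h₀ θ)).map
      fun θ => fiberMap Φ θ)
    (hsub : ∀ x : M, ∀ θ ∈ tsupport h₀,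
      Function.Surjective (mfderiv (𝓡 n) (𝓡 d) (fun θ' => Φ (x, θ')) θ))
    -- `ν₁` is supported by the local diffeomorphisms
    (hν₁ : ν₁ (diffLoc d M r) = 1)
    -- integrability and the spectral condition, on the Banach space `C^{r-1}(M)`
    (N : CkNorm d M (r - 1))
    (hint : ∫⁻ φ in diffLoc d M r, N.opENorm (transfer g φ) ∂ν₁ < ⊤)
    (hres : 1 / a ∈ resolventSet ℝ (N.toCLM (avgTransfer g ν₁)))
    -- an invariant distribution of the kernel induced by `(1 - a) ν₀ + a ν₁`
    (μ : Measure M) [IsProbabilityMeasure μ]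
    (hμ : Kernel.Invariant
      (inducedKernel (ENNReal.ofReal (1 - a) • ν₀ + ENNReal.ofReal a • ν₁)) μ) :
    HasCkDensity g (r - 1) μ := by
  have hDm : MeasurableSet (diffLoc d M r) := (isOpen_diffLoc hr).measurableSet
  have hνD : ν₁.restrict (diffLoc d M r) = ν₁ :=
    Measure.restrict_eq_self_of_ae_mem ((prob_compl_eq_zero_iff hDm).2 hν₁)
  have hfin := isFiniteMeasure_riemMeasure g
  have hpos := isOpenPosMeasure_riemMeasure g
  -- the first part of the invariance equation has a density `ρ₀` of class `C^{r-1}`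
  obtain ⟨ρ₀, hρ₀s, hρ₀0, hρ₀η⟩ := exists_density_of_submersive_family g gΘ hr Φ.contMDiff
    h₀.contMDiff h₀_nonneg h₀_supp hsub μ
  set m := riemMeasure g with hm
  set κ : Measure M := (μ.prod ν₁).map (fun z => z.2 z.1) with hκ
  have hprob : IsProbabilityMeasure (((riemMeasure gΘ).withDensity
      fun θ => ENNReal.ofReal (h₀ θ)).map fun θ => fiberMap Φ θ) := hν₀ ▸ inferInstance
  have hμeq : μ = ENNReal.ofReal (1 - a) • m.withDensity (fun x => ENNReal.ofReal (ρ₀ x)) +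
      ENNReal.ofReal a • κ := by
    ext s hs
    have h1 : μ s =
        μ.bind (inducedKernel (ENNReal.ofReal (1 - a) • ν₀ + ENNReal.ofReal a • ν₁)) s :=
      congrArg (fun μ' : Measure M => μ' s) hμ.symm
    rw [h1, comp_inducedKernel_apply a ν₀ ν₁ μ hs]
    have h2 : ∫⁻ x, ν₀ {φ | φ x ∈ s} ∂μ = m.withDensity (fun x => ENNReal.ofReal (ρ₀ x)) s := by
      rw [withDensity_apply _ hs, ← lintegral_indicator hs]
      simp only [hν₀, lintegral_measure_eval_map_fiberMap _ Φ hs]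
      rw [hρ₀η _ (measurable_one.indicator hs)]
      refine lintegral_congr fun x => ?_
      by_cases hx : x ∈ s <;> simp [hx]
    rw [h2]
    rfl
  -- solve `ρ = a L ρ + (1 - a) ρ₀` in `C^{r-1}(M)`
  obtain ⟨u, hu⟩ := hres
  set T := N.toCLM (avgTransfer g ν₁) with hT
  have hTapp : ∀ ρ : N.Space, ⇑(T ρ) = avgTransfer g ν₁ ρ :=
    N.toCLM_apply _ (exists_clm_avgTransfer g hr ν₁ hint)
  set ρ₁ : N.Space := (⟨ρ₀, hρ₀s⟩ : C^(r - 1 : ℕ)⟮𝓡 d, M; ℝ⟯) with hρ₁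
  obtain ⟨ρ, hρ⟩ : ∃ ρ : N.Space, ∀ x,
      ρ x = a * avgTransfer g ν₁ ρ x + (1 - a) * ρ₀ x := by
    refine ⟨(↑u⁻¹ : N.Space →L[ℝ] N.Space) (((1 - a) / a) • ρ₁), fun x => ?_⟩
    set ρ := (↑u⁻¹ : N.Space →L[ℝ] N.Space) (((1 - a) / a) • ρ₁)
    have h1 : (u : N.Space →L[ℝ] N.Space) ρ = ((1 - a) / a) • ρ₁ := by
      have h2 := congrArg (fun A : N.Space →L[ℝ] N.Space => A (((1 - a) / a) • ρ₁)) u.mul_inv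
      exact h2
    rw [hu] at h1
    have h3 : (1 / a) * ρ x - T ρ x = ((1 - a) / a) * ρ₀ x :=
      congrArg (fun η : N.Space => η x) h1
    rw [hTapp] at h3
    field_simp at h3
    linarith
  have hρc : Continuous ρ := ρ.contMDiff.continuous
  have hρi : Integrable ρ m :=
    hρc.integrable_of_hasCompactSupport (HasCompactSupport.of_compactSpace _)
  have hLc : Continuous (avgTransfer g ν₁ ρ) := (contMDiff_avgTransfer g hr ν₁ hint ρ).continuous
  -- the Markov operator of `ν₁`
  set P : (M → ℝ) → M → ℝ := fun η x => ∫ φ, η (φ x) ∂ν₁ with hP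
  have hPm : ∀ η : M → ℝ, Measurable η → Measurable (P η) := fun η hη =>
    ((hη.comp measurable_eval).stronglyMeasurable.integral_prod_right').measurable
  have hPb : ∀ η : M → ℝ, (∀ x, |η x| ≤ 1) → ∀ x, |P η x| ≤ 1 := fun η hη x => by
    have := norm_integral_le_of_norm_le_const (μ := ν₁) (f := fun φ => η (φ x))
      (ae_of_all _ fun φ => hη (φ x))
    simpa using this
  -- `σ = μ - ρ m` satisfies `σ = a P* σ`: the source terms cancel
  have hkey : ∀ η : M → ℝ, Measurable η → (∀ x, |η x| ≤ 1) →
      ∫ x, η x ∂μ - ∫ x, ρ x * η x ∂m = a * (∫ x, P η x ∂μ - ∫ x, ρ x * P η x ∂m) := by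
    intro η hη hη1
    have hκf : IsProbabilityMeasure κ :=
      Measure.isProbabilityMeasure_map measurable_eval.aemeasurable
    have hηi : ∀ (μ' : Measure M) [IsFiniteMeasure μ'], Integrable η μ' := fun μ' _ =>
      Integrable.of_bound hη.aestronglyMeasurable 1 (ae_of_all _ hη1)
    have hdf : IsFiniteMeasure (m.withDensity fun x => ENNReal.ofReal (ρ₀ x)) :=
      isFiniteMeasure_withDensity_ofReal (hρ₀s.continuous.integrable_of_hasCompactSupport
        (HasCompactSupport.of_compactSpace ρ₀)).2
    have h1 : ∫ x, η x ∂μ = (1 - a) * ∫ x, ρ₀ x * η x ∂m + a * ∫ x, P η x ∂μ := by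
      conv_lhs => rw [hμeq]
      rw [integral_add_measure ((hηi _).smul_measure ENNReal.ofReal_ne_top)
        ((hηi _).smul_measure ENNReal.ofReal_ne_top), integral_smul_measure, integral_smul_measure,
        ENNReal.toReal_ofReal ha0.le, ENNReal.toReal_ofReal (sub_pos.2 ha1).le, hκ,
        integral_map measurable_eval.aemeasurable hη.aestronglyMeasurable,
        integral_withDensity_eq_integral_toReal_smul hρ₀s.continuous.measurable.ennreal_ofReal
          (ae_of_all _ fun _ => ENNReal.ofReal_lt_top),
        integral_prod (fun z : M × C^r⟮𝓡 d, M; 𝓡 d, M⟯ => η (z.2 z.1))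
          (Integrable.of_bound (hη.comp measurable_eval).aestronglyMeasurable 1
            (ae_of_all _ fun z => hη1 _))]
      simp only [smul_eq_mul, ENNReal.toReal_ofReal (hρ₀0 _), hP]
    have h2 : ∫ x, ρ x * η x ∂m = a * ∫ x, ρ x * P η x ∂m + (1 - a) * ∫ x, ρ₀ x * η x ∂m := by
      have h3 := integral_avgTransfer_mul g hr ν₁ hρc hη hη1
      rw [hνD] at h3
      rw [← h3, ← integral_const_mul, ← integral_const_mul, ← integral_add
        ((integrable_mul_of_continuous g hLc hη hη1).const_mul _)
        ((integrable_mul_of_continuous g hρ₀s.continuous hη hη1).const_mul _)]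
      refine integral_congr_ae (ae_of_all _ fun x => ?_)
      simp only
      rw [hρ x]
      ring
    rw [h1, h2]
    ring
  obtain ⟨hρ0, hμρ⟩ := nonneg_and_eq_withDensity hρc hρi (μ := μ) fun s hs => by
    have h1 := integral_eq_of_contraction hρi ha0.le ha1 P hPm hPb hkey
      (η := s.indicator 1) (measurable_one.indicator hs) fun x => by
        by_cases hx : x ∈ s <;> simp [hx]
    rw [integral_indicator_one hs] at h1
    rw [h1, ← integral_indicator hs]
    refine integral_congr_ae (ae_of_all _ fun x => ?_)
    by_cases hx : x ∈ s <;> simp [hx]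
  exact ⟨(ρ : C^(r - 1 : ℕ)⟮𝓡 d, M; ℝ⟯), hρ0, hμρ⟩
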